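/- **Setting.** Let $\mathcal M$ be a (connected, finite-dimensional, smooth) Riemannian manifold without boundary, with distance $d$, and let $\mathcal X\subseteq\mathcal M$ be compact and geodesically convex: any two points $x,y\in\mathcal X$ are joined by a unique minimizing geodesic $\gamma:[0,1]\to\mathcal M$, and it lies in $\mathcal X$. Write $\mathrm{Exp}_x^{-1}(y)=\dot\gamma(0)$, $\Gamma_x^y$ for Levi-Civita parallel transport along $\gamma$, and $D=\mathrm{diam}(\mathcal X)$. Call a differentiable $f:\mathcal M\to\mathbb R$ $L$-smooth on $\mathcal X$ if $\|\mathrm{grad} f(y)-\Gamma_x^y\,\mathrm{grad} f(x)\|\le L\,d(x,y)$ for all $x,y\in\mathcal X$. The Frank-Wolfe gap of $\Phi$ is $\mathcal G(x)=\max_{y\in\mathcal X}\langle \mathrm{Exp}_x^{-1}(y),-\mathrm{grad}\,\Phi(x)\rangle$. Fix $L>0$ and $C$, and consider minimization over $\mathcal X$ of one of the following objectives. * *Stochastic*: $\Phi(x)=\mathbb E_{\xi\sim\mathcal P}[\phi(x,\xi)]$, where $\Phi$ and ($\mathcal P$-almost) all $\phi(\cdot,\xi)$ are $L$-smooth on $\mathcal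 X$, and for every $x\in\mathcal X$ one has $\mathbb E_\xi[\mathrm{grad}\,\phi(x,\xi)]=\mathrm{grad}\,\Phi(x)$ and $\|\mathrm{grad}\,\phi(x,\xi)\|\le C$ almost surely. * *Finite sum*: $\Phi=\frac1m\sum_{i=1}^m\phi_i$ with $m\ge1$ and all $\phi_i$ $L$-smooth on $\mathcal X$; here $C$ denotes any number with $\|\mathrm{grad}\,\phi_i(x_0)\|\le C$ for all $i$, where $x_0$ is the initial point. **Algorithm (SPIDER-RFW with parameter $n\in\mathbb N$, $n\ge1$).** Put $K=n^2$, $\eta=\frac1{\sqrt K}=\frac1n$, $\varepsilon_n=\frac1n$. For a batch $S$ let $\mathrm{grad}\,\Phi_S(x)$ be the average over $S$ of the component gradients at $x$ (zero if $S$ is empty). Start at $x_0\in\mathcal X$. For $k=0,\dots,K-1$: 1. If $n\mid k$, draw i.i.d. samples $S_1$, with $|S_1|=\lceil 2C^2/\varepsilon_n^2\rceil$ (stochastic) or $|S_1|=\lceil 2L^2D^2/\varepsilon_n^2\rceil$ (finite sum), and set $g_k=\mathrm{grad}\,\Phi_{S_1}(x_k)$. 2. If $n\nmid k$, let $|S_2|=\left\lceil\min\left\{m,\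 2nL^2\|\mathrm{Exp}_{x_{k-1}}^{-1}(x_k)\|^2/\varepsilon_n^2\right\}\right\rceil$ ($m=\infty$ in the stochastic case), draw i.i.d. samples $S_2$ (in the finite-sum case $S_2$ is the whole index set when $|S_2|=m$), and set $g_k=\mathrm{grad}\,\Phi_{S_2}(x_k)-\Gamma_{x_{k-1}}^{x_k}\left(\mathrm{grad}\,\Phi_{S_2}(x_{k-1})-g_{k-1}\right)$. 3. Choose $z_{k+1}\in\arg\min_{z\in\mathcal X}\langle g_k,\mathrm{Exp}_{x_k}^{-1}(z)\rangle$ (one RLO call; ties may be broken arbitrarily) and let $x_{k+1}=\gamma(\eta)$, where $\gamma$ is the minimizing geodesic from $x_k$ to $z_{k+1}$. In the stochastic case the samples have law $\mathcal P$; in the finite-sum case they are uniform indices. The samples of each iteration are independent of the past. The output $\hat x$ is chosen uniformly at random from $x_0,\dots,x_{K-1}$, independently of the run. An SFO/IFO call is the evaluation of one component gradient at one point, so that $S_1$ costs $|S_1|$ calls and $S_2$ costs $2|S_2|$ calls. **Statement.** In each of the two cases there are constants $A,B$, depending only on $\mathcal M,\mathcal X,L,C$ (not on $\epsilon$, $m$,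 $x_0$, the objective or its sampling law), such that for every $\epsilon\in(0,1]$ there is $n\ge1$, depending only on $\epsilon$ and on $\mathcal M,\mathcal X,L,C$, for which every run of SPIDER-RFW with parameter $n$ satisfies $$\mathbb E[\mathcal G(\hat x)]\le\epsilon ,$$ makes at most $A/\epsilon^3$ SFO (respectively IFO) calls, whatever the samples drawn (hence also in expectation), and makes $K=n^2\le B/\epsilon^2$ RLO calls. -/

import Mathlib

open Bundle Set MeasureTheory ProbabilityTheory
open scoped Manifold ContDiff Topology ENNReal Bundle

noncomputable section

namespace SpiderRFW

/-! ### Riemannian geometry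

`M` is a smooth Riemannian manifold without boundary, modelled on the finite-dimensional space `E`.
Vector fields along curves are curves `W : ℝ → TangentBundle 𝓘(ℝ, E) M`, looked at on `[0, 1]`; the
base curve is `t ↦ (W t).proj` and the vector at time `t` is `(W t).2`. -/

section Geometry

variable {E : Type*} [NormedAddCommGroup E] [NormedSpace ℝ E] [FiniteDimensional ℝ E]
  {M : Type*} [MetricSpace M] [ChartedSpace E M] [IsManifold 𝓘(ℝ, E) ∞ M]
  [RiemannianBundle (fun x : M => TangentSpace 𝓘(ℝ, E) x)]

/-- The coordinates, in the chart centred at `p`, of a tangent vector. -/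
def tangentCoord (p : M) (W : TangentBundle 𝓘(ℝ, E) M) : E :=
  mfderiv 𝓘(ℝ, E) 𝓘(ℝ, E) (extChartAt 𝓘(ℝ, E) p) W.proj W.2

/-- The metric tensor in the chart centred at `p`: the inner product, at the point with
coordinates `e`, of the tangent vectors with coordinates `u` and `v`. -/
def metricCoord (p : M) (e u v : E) : ℝ :=
  inner ℝ (mfderiv 𝓘(ℝ, E) 𝓘(ℝ, E) (extChartAt 𝓘(ℝ, E) p).symm e u)
    (mfderiv 𝓘(ℝ, E) 𝓘(ℝ, E) (extChartAt 𝓘(ℝ, E) p).symm e v)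

/-- Christoffel symbols of the first kind of the Levi-Civita connection in the chart centred
at `p`: the trilinear form `⟨∇ᵤ v, w⟩` for the constant coordinate fields `u`, `v`, `w`, that is
`(∂ᵤ g(v, w) + ∂ᵥ g(u, w) - ∂_w g(u, v)) / 2`. -/
def christoffel (p : M) (e u v w : E) : ℝ :=
  (fderiv ℝ (fun e' => metricCoord p e' v w) e u + fderiv ℝ (fun e' => metricCoord p e' u w) e v
    - fderiv ℝ (fun e' => metricCoord p e' u v) e w) / 2

/-- `W` is a parallel vector field along its base curve on `[0, 1]`: in every chart around every
point of the curve, the covariant derivative `W' + Γ(γ', W)` vanishes (here it is paired with an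
arbitrary vector `w`). -/
def IsParallel (W : ℝ → TangentBundle 𝓘(ℝ, E) M) : Prop :=
  ContinuousOn W (Icc 0 1) ∧
  ∀ t ∈ Icc (0 : ℝ) 1, ∀ p : M, (W t).proj ∈ (chartAt E p).source →
    ∃ u v' : E,
      HasDerivWithinAt (fun s => extChartAt 𝓘(ℝ, E) p (W s).proj) u (Icc 0 1) t ∧
      HasDerivWithinAt (fun s => tangentCoord p (W s)) v' (Icc 0 1) t ∧
      ∀ w : E, metricCoord p (extChartAt 𝓘(ℝ, E) p (W t).proj) v' w +
        christoffel p (extChartAt 𝓘(ℝ, E) p (W t).proj) u (tangentCoord p (W t)) w = 0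

/-- `c` is a geodesic on `[0, 1]` together with its velocity: `(c t).2` is the velocity at time `t`
of the curve `t ↦ (c t).proj`, and it is parallel along that curve. -/
def IsGeodesic (c : ℝ → TangentBundle 𝓘(ℝ, E) M) : Prop :=
  IsParallel c ∧
  ∀ t ∈ Icc (0 : ℝ) 1, ∀ p : M, (c t).proj ∈ (chartAt E p).source →
    HasDerivWithinAt (fun s => extChartAt 𝓘(ℝ, E) p (c s).proj) (tangentCoord p (c t)) (Icc 0 1) t

/-- `c` is a geodesic from `x` to `y`, parametrized by `[0, 1]`, of length `d(x, y)`; as geodesics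
have constant speed, this means that its speed is `d(x, y)`. -/
def IsMinGeodesic (x y : M) (c : ℝ → TangentBundle 𝓘(ℝ, E) M) : Prop :=
  IsGeodesic c ∧ (c 0).proj = x ∧ (c 1).proj = y ∧ ∀ t ∈ Icc (0 : ℝ) 1, ‖(c t).2‖ = dist x y

variable (E) in
/-- Geodesic convexity: any two points of `𝒳` are joined by a unique minimizing geodesic, and that
geodesic stays in `𝒳`. -/
def GeodesicallyConvex (𝒳 : Set M) : Prop :=
  ∀ x ∈ 𝒳, ∀ y ∈ 𝒳, ∃ c : ℝ → TangentBundle 𝓘(ℝ, E) M,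
    IsMinGeodesic x y c ∧ (∀ t ∈ Icc (0 : ℝ) 1, (c t).proj ∈ 𝒳) ∧
    ∀ c' : ℝ → TangentBundle 𝓘(ℝ, E) M, IsMinGeodesic x y c' → EqOn c' c (Icc 0 1)

variable (E) in
open Classical in
/-- The inverse exponential map `Exp_x⁻¹(y)`: the initial velocity of the minimizing geodesic
from `x` to `y` (zero if there is none). -/
def logMap (x y : M) : TangentSpace 𝓘(ℝ, E) x :=
  if h : ∃ v : TangentSpace 𝓘(ℝ, E) x,
      ∃ c : ℝ → TangentBundle 𝓘(ℝ, E) M, IsMinGeodesic x y c ∧ c 0 = ⟨x, v⟩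
  then h.choose else 0

open Classical in
/-- Parallel transport `Γ_x^y v` along the minimizing geodesic from `x` to `y`: the final value of
the parallel field along that geodesic with initial value `v` (zero if there is none). -/
def parallelTransport (x y : M) (v : TangentSpace 𝓘(ℝ, E) x) : TangentSpace 𝓘(ℝ, E) y :=
  if h : ∃ w : TangentSpace 𝓘(ℝ, E) y, ∃ c W : ℝ → TangentBundle 𝓘(ℝ, E) M,
      IsMinGeodesic x y c ∧ IsParallel W ∧ (∀ t ∈ Icc (0 : ℝ) 1, (W t).proj = (c t).proj) ∧
      W 0 = ⟨x, v⟩ ∧ W 1 = ⟨y, w⟩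
  then h.choose else 0

instance (x : M) : FiniteDimensional ℝ (TangentSpace 𝓘(ℝ, E) x) :=
  inferInstanceAs (FiniteDimensional ℝ E)

instance (x : M) : CompleteSpace (TangentSpace 𝓘(ℝ, E) x) :=
  FiniteDimensional.complete ℝ _

variable (E) in
/-- The Riemannian gradient: the vector `v` with `Df(x)[w] = ⟨v, w⟩` for all tangent `w`. -/
def rgrad (f : M → ℝ) (x : M) : TangentSpace 𝓘(ℝ, E) x :=
  (InnerProductSpace.toDual ℝ (TangentSpace 𝓘(ℝ, E) x)).symm (mfderiv 𝓘(ℝ, E) 𝓘(ℝ, ℝ) f x)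

variable (E) in
/-- `f` is differentiable and `L`-smooth on `𝒳`. -/
def IsLSmoothOn (𝒳 : Set M) (L : ℝ) (f : M → ℝ) : Prop :=
  MDifferentiable 𝓘(ℝ, E) 𝓘(ℝ, ℝ) f ∧
  ∀ x ∈ 𝒳, ∀ y ∈ 𝒳, ‖rgrad E f y - parallelTransport x y (rgrad E f x)‖ ≤ L * dist x y

variable (E) in
/-- The Frank-Wolfe gap `max_{y ∈ 𝒳} ⟨Exp_x⁻¹(y), -grad f(x)⟩`. -/
def fwGap (𝒳 : Set M) (f : M → ℝ) (x : M) : ℝ :=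
  sSup ((fun y => inner ℝ (logMap E x y) (-rgrad E f x)) '' 𝒳)

end Geometry

/-! ### The algorithm -/

section Algorithm

variable {E : Type*} [NormedAddCommGroup E] [NormedSpace ℝ E] [FiniteDimensional ℝ E]
  {M : Type*} [MetricSpace M] [ChartedSpace E M] [IsManifold 𝓘(ℝ, E) ∞ M]
  [RiemannianBundle (fun x : M => TangentSpace 𝓘(ℝ, E) x)]
  {Ξ Ω : Type*}

variable (E) in
/-- The batch gradient `(1 / |S|) ∑_{ξ ∈ S} grad φ(x, ξ)`; it is zero for the empty batch. -/
def batchGrad (φ : Ξ → M → ℝ) (S : List Ξ) (x : M) : TangentSpace 𝓘(ℝ, E) x :=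
  (S.length : ℝ)⁻¹ • (S.map fun ξ => rgrad E (φ ξ) x).sum

/-- The batch made of the first `b` elements of a stream of samples. -/
def sampleBatch (b : ℕ) (s : ℕ → Ξ) : List Ξ := (List.range b).map s

/-- The batch of size `⌈min {m, r}⌉` for a sum of `m` components: the whole index set if this size
is `m`, and a batch of samples otherwise. -/
def cappedBatch (m : ℕ) (r : ℝ) (s : ℕ → Fin m) : List (Fin m) :=
  if m ≤ ⌈r⌉₊ then List.finRange m else sampleBatch ⌈r⌉₊ s

/-- How the batches are formed from a stream of samples: `first s` is the batch `S₁` at the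
beginning of an epoch, and `inner r s` is the batch `S₂` within an epoch, where `r` is the real
number `2 n L² ‖Exp_{x_{k-1}}⁻¹(x_k)‖² / ε²`. -/
structure BatchRule (Ξ : Type*) where
  first : (ℕ → Ξ) → List Ξ
  inner : ℝ → (ℕ → Ξ) → List Ξ

/-- The rule for stochastic objectives with gradient bound `C`, where `ε = 1 / n`:
`|S₁| = ⌈2 C² / ε²⌉` and `|S₂| = ⌈r⌉`. -/
def stochasticRule (Ξ : Type*) (C : ℝ) (n : ℕ) : BatchRule Ξ where
  first := sampleBatch ⌈2 * C ^ 2 / (1 / (n : ℝ)) ^ 2⌉₊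
  inner r := sampleBatch ⌈r⌉₊

/-- The rule for sums of `m` components, `L`-smooth on a set of diameter `D`, where `ε = 1 / n`:
`|S₁| = ⌈2 L² D² / ε²⌉` and `|S₂| = ⌈min {m, r}⌉`. -/
def finiteSumRule (m : ℕ) (L D : ℝ) (n : ℕ) : BatchRule (Fin m) where
  first := sampleBatch ⌈2 * L ^ 2 * D ^ 2 / (1 / (n : ℝ)) ^ 2⌉₊
  inner r := cappedBatch m r

variable (E) in
/-- The batch used in iteration `k`, for iterates `x`, epochs of length `n` and `ε = 1 / n`. -/
def batch (L : ℝ) (n : ℕ) (R : BatchRule Ξ) (x : ℕ → M) (k : ℕ) (s : ℕ → Ξ) : List Ξ :=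
  if k % n = 0 then R.first s
  else R.inner (2 * n * L ^ 2 * ‖logMap E (x (k - 1)) (x k)‖ ^ 2 / (1 / (n : ℝ)) ^ 2) s

/-- The gradient estimate `g_k` as a function of the iterates `x`, the previous estimates `g` and
the stream `s` of fresh samples of iteration `k`. -/
def spiderEstimate (φ : Ξ → M → ℝ) (L : ℝ) (n : ℕ) (R : BatchRule Ξ) (x : ℕ → M)
    (g : ∀ k, TangentSpace 𝓘(ℝ, E) (x k)) : ∀ k, (ℕ → Ξ) → TangentSpace 𝓘(ℝ, E) (x k)
  | 0, s => batchGrad E φ (batch E L n R x 0 s) (x 0)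
  | k + 1, s =>
    let S := batch E L n R x (k + 1) s
    if (k + 1) % n = 0 then batchGrad E φ S (x (k + 1))
    else batchGrad E φ S (x (k + 1)) -
      parallelTransport (x k) (x (k + 1)) (batchGrad E φ S (x k) - g k)

variable (E) in
/-- The number of first-order oracle calls (evaluations of one component gradient at one point) in
the iterations `0, …, n² - 1`: a batch `S` costs `|S|` calls at the beginning of an epoch, and
`2 |S|` calls within an epoch, where its gradient is evaluated at two points. -/
def firstOrderCalls (L : ℝ) (n : ℕ) (R : BatchRule Ξ) (x : ℕ → M) (s : ℕ → ℕ → Ξ) : ℕ :=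
  ∑ k ∈ Finset.range (n ^ 2),
    (if k % n = 0 then 1 else 2) * (batch E L n R x k (s k)).length

/-- The number of linear optimization oracle calls: one in each of the `K = n²` iterations. -/
def linearOracleCalls (n : ℕ) : ℕ := ∑ _k ∈ Finset.range (n ^ 2), 1

/-- A run of SPIDER-RFW on `𝒳` with initial point `x₀`, components `φ ξ`, sampling law `P`,
`K = n²` iterations, epochs of length `n`, step size `η = 1 / √K = 1 / n` and `ε = 1 / n`.
On a probability space with filtration `ℱ` it consists of iterates `x k`, gradient estimates `g k`,
streams `ξ k` of samples (the one of iteration `k` is fresh, i.e. independent of `ℱ k`, which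
contains the history of `x k`) and the index `κ` of the output `x̂ = x κ`. Minimizers of the linear
subproblem may be chosen in any way. -/
structure IsSpiderRun [MeasurableSpace Ξ] [mΩ : MeasurableSpace Ω] (𝒳 : Set M) (x₀ : M)
    (φ : Ξ → M → ℝ) (P : Measure Ξ) (L : ℝ) (n : ℕ) (R : BatchRule Ξ)
    (μ : Measure Ω) (ℱ : Filtration ℕ mΩ) (x : ℕ → Ω → M)
    (g : ∀ k w, TangentSpace 𝓘(ℝ, E) (x k w)) (ξ : ℕ → ℕ → Ω → Ξ) (κ : Ω → Fin (n ^ 2)) :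
    Prop where
  init : ∀ w, x 0 w = x₀
  /-- the samples of iteration `k` are independent with law `P` -/
  sample_law : ∀ k < n ^ 2, ∀ j, Measure.map (ξ k j) μ = P
  sample_iIndep : ∀ k < n ^ 2, iIndepFun (ξ k) μ
  /-- they are independent of the past, and known after iteration `k` -/
  sample_fresh : ∀ k < n ^ 2,
    Indep (MeasurableSpace.comap (fun w j => ξ k j w) inferInstance) (ℱ k) μ
  sample_measurable : ∀ k < n ^ 2, ∀ j, Measurable[ℱ (k + 1)] (ξ k j)
  /-- the iterates are adapted random points -/
  iterate_measurable : ∀ k ≤ n ^ 2, @Measurable Ω M (ℱ k) (borel M) (x k)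
  /-- the gradient estimate is a measurable function of the past and of the fresh samples -/
  estimate_measurable : ∀ k < n ^ 2,
    @Measurable (Ω × (ℕ → Ξ)) (TangentBundle 𝓘(ℝ, E) M)
    (@Prod.instMeasurableSpace _ _ (ℱ k) inferInstance) (borel _)
    fun q => ⟨x k q.1, spiderEstimate φ L n R (fun k => x k q.1) (fun k => g k q.1) k q.2⟩
  estimate : ∀ k < n ^ 2, ∀ w, g k w =
    spiderEstimate φ L n R (fun k => x k w) (fun k => g k w) k (fun j => ξ k j w)
  /-- `x_{k+1} = γ(η)` for the geodesic from `x_k` to a solution `z` of the linear subproblem -/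
  step : ∀ k < n ^ 2, ∀ w, ∃ z ∈ 𝒳,
    (∀ y ∈ 𝒳, (inner ℝ (g k w) (logMap E (x k w) z) : ℝ) ≤ inner ℝ (g k w) (logMap E (x k w) y)) ∧
    ∃ c : ℝ → TangentBundle 𝓘(ℝ, E) M, IsMinGeodesic (x k w) z c ∧
      x (k + 1) w = (c (1 / (n : ℝ))).proj
  /-- the index of the output is uniformly distributed and independent of the run -/
  output_measurable : Measurable κ
  output_law : ∀ i, μ (κ ⁻¹' {i}) = ((n : ℝ≥0∞) ^ 2)⁻¹
  output_indep : Indep (MeasurableSpace.comap κ inferInstance) (ℱ (n ^ 2)) μ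

end Algorithm

end SpiderRFW

end

/-! One Frank-Wolfe step is analysed with an inexact gradient `g`. The Taylor estimate
`abs_sub_sub_le` along the minimizing geodesic, the optimality of `z` for `g`, and Young's
inequality give (`inner_logMap_le_of_step`) gap at `x_k` ≤ n (Φ(x_k) - Φ(x_{k+1})) + n D² ‖g_k -
grad Φ(x_k)‖² + (L D²/2 + 1)/n. Averaged over the n² iterates, the first term telescopes and is
O(1/n), because smoothness and compactness bound Φ(x₀) - Φ(y) independently of the objective. So an
error D² E‖g_k - grad Φ(x_k)‖² = O(1/n²) makes the expected gap O(1/n) (`lintegral_fwGap_le`), and n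
~ 1/ε suffices.

For the error, let Γ be the transport from x_{k-1} to x_k. Within an epoch, the new error is Γ
applied to the old error plus the centred average of the vectors grad φ_ξ(x_k) - Γ grad
φ_ξ(x_{k-1}), each of norm at most L d(x_{k-1}, x_k). Conditionally on the past, the average has
mean zero and Γ is an isometry, so the mean square grows by at most (L d)²/|S₂| ≤ 1/(2n³)
(`lintegral_batchGrad_transport`). An epoch has n iterations and thus adds at most 1/(2n²) to the
O(1/n²) error left by S₁ (`lintegral_error_le`).

For the cost, consecutive iterates are at distance at most D/n, so |S₂| = O(n), while |S₁| = O(n²)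
is paid n times: O(n³) in total (`firstOrderCalls_le`).

The geometric input is that Γ is a well-defined linear isometry. In a chart, parallel fields solve a
linear ODE whose form is invariant under changes of chart, so local solutions can be glued
(`exists_isParallel`). Metric compatibility makes inner products of parallel fields constant
(`inner_const_of_isParallel`), and this alone yields uniqueness and linearity of transport. -/

noncomputable section

set_option linter.unusedSectionVars false
set_option synthInstance.maxHeartbeats 100000

namespace SpiderRFW

/-! ### Chart coordinates of tangent vectors and the metric tensor. -/

section Coordinates

variable {E : Type*} [NormedAddCommGroup E] [NormedSpace ℝ E] [FiniteDimensional ℝ E]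
  {M : Type*} [MetricSpace M] [ChartedSpace E M] [IsManifold 𝓘(ℝ, E) ∞ M]

/-- The tangent vector with given coordinates in the chart centred at `p`. -/
def pushChart (p : M) (e : E) : E →L[ℝ] TangentSpace 𝓘(ℝ, E) ((extChartAt 𝓘(ℝ, E) p).symm e) :=
  mfderiv 𝓘(ℝ, E) 𝓘(ℝ, E) (extChartAt 𝓘(ℝ, E) p).symm e

lemma exists_symm_eq {p x : M} (hx : x ∈ (chartAt E p).source) :
    ∃ e ∈ (extChartAt 𝓘(ℝ, E) p).target, (extChartAt 𝓘(ℝ, E) p).symm e = x :=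
  ⟨extChartAt 𝓘(ℝ, E) p x, (extChartAt 𝓘(ℝ, E) p).map_source (by simpa using hx),
    (extChartAt 𝓘(ℝ, E) p).left_inv (by simpa using hx)⟩

lemma mem_target {p x : M} (hx : x ∈ (chartAt E p).source) :
    extChartAt 𝓘(ℝ, E) p x ∈ (extChartAt 𝓘(ℝ, E) p).target :=
  (extChartAt 𝓘(ℝ, E) p).map_source (by simpa using hx)

lemma tangentCoord_pushChart (p : M) {e : E} (he : e ∈ (extChartAt 𝓘(ℝ, E) p).target) (u : E) :
    tangentCoord p ⟨(extChartAt 𝓘(ℝ, E) p).symm e, pushChart p e u⟩ = u := by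
  have := mfderiv_extChartAt_comp_mfderivWithin_extChartAt_symm he
  rw [modelWithCornersSelf_coe, range_id, mfderivWithin_univ] at this
  exact congrArg (fun f => f u) this

lemma pushChart_tangentCoord (p : M) {e : E} (he : e ∈ (extChartAt 𝓘(ℝ, E) p).target)
    (v : TangentSpace 𝓘(ℝ, E) ((extChartAt 𝓘(ℝ, E) p).symm e)) :
    pushChart p e (tangentCoord p ⟨(extChartAt 𝓘(ℝ, E) p).symm e, v⟩) = v := by
  have := mfderivWithin_extChartAt_symm_comp_mfderiv_extChartAt he
  rw [modelWithCornersSelf_coe, range_id, mfderivWithin_univ] at this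
  exact congrArg (fun f => f v) this

lemma tangentCoord_smul (p x : M) (a : ℝ) (v : TangentSpace 𝓘(ℝ, E) x) :
    tangentCoord p ⟨x, a • v⟩ = a • tangentCoord p ⟨x, v⟩ :=
  map_smul (mfderiv 𝓘(ℝ, E) 𝓘(ℝ, E) (extChartAt 𝓘(ℝ, E) p) x) a v

lemma tangentCoord_sub (p x : M) (v w : TangentSpace 𝓘(ℝ, E) x) :
    tangentCoord p ⟨x, v - w⟩ = tangentCoord p ⟨x, v⟩ - tangentCoord p ⟨x, w⟩ :=
  map_sub (mfderiv 𝓘(ℝ, E) 𝓘(ℝ, E) (extChartAt 𝓘(ℝ, E) p) x) v w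

lemma exists_tangentCoord_eq {p x : M} (hx : x ∈ (chartAt E p).source) (u : E) :
    ∃ v : TangentSpace 𝓘(ℝ, E) x, tangentCoord p ⟨x, v⟩ = u := by
  obtain ⟨e, he, rfl⟩ := exists_symm_eq hx
  exact ⟨pushChart p e u, tangentCoord_pushChart p he u⟩

/-- Links `tangentCoord` to the topology of the tangent bundle; the continuity lemmas below rest on
it. -/
lemma trivializationAt_snd {p : M} {W : TangentBundle 𝓘(ℝ, E) M}
    (hW : W.proj ∈ (chartAt E p).source) :
    (trivializationAt E (TangentSpace 𝓘(ℝ, E) : M → Type _) p W).2 = tangentCoord p W := by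
  have h := TangentBundle.continuousLinearMapAt_trivializationAt (I := 𝓘(ℝ, E)) hW
  have h2 := congrArg (fun f => f W.2) h
  refine Eq.trans ?_ h2
  rw [Trivialization.continuousLinearMapAt_apply, Trivialization.linearMapAt_apply, if_pos]
  simpa using hW

lemma continuousOn_tangentCoord (p : M) : ContinuousOn (tangentCoord p)
    {W : TangentBundle 𝓘(ℝ, E) M | W.proj ∈ (chartAt E p).source} := by
  have h := (trivializationAt E (TangentSpace 𝓘(ℝ, E) : M → Type _) p).continuousOn_toFun
  refine ContinuousOn.congr (continuous_snd.comp_continuousOn (h.mono fun W hW => ?_))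
    fun W hW => (trivializationAt_snd hW).symm
  simpa [Trivialization.mem_source] using hW

lemma continuousWithinAt_tangent {W : ℝ → TangentBundle 𝓘(ℝ, E) M} {s : Set ℝ} {t : ℝ}
    (hproj : ContinuousWithinAt (fun r => (W r).proj) s t)
    (hc : ContinuousWithinAt (fun r => tangentCoord (W t).proj (W r)) s t) :
    ContinuousWithinAt W s t := by
  refine (FiberBundle.continuousWithinAt_totalSpace E W).2 ⟨hproj, ?_⟩
  refine hc.congr_of_eventuallyEq ?_ (trivializationAt_snd (mem_chart_source E _))
  filter_upwards [hproj.preimage_mem_nhdsWithin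
    ((chartAt E (W t).proj).open_source.mem_nhds (mem_chart_source E _))] with r hr
  exact trivializationAt_snd hr

variable [RiemannianBundle (fun x : M => TangentSpace 𝓘(ℝ, E) x)]

/-- The metric tensor in the chart centred at `p`, as a continuous bilinear form. -/
def metricForm (p : M) (e : E) : E →L[ℝ] E →L[ℝ] ℝ :=
  (innerSL ℝ).bilinearComp (pushChart p e) (pushChart p e)

lemma metricCoord_eq (p : M) (e u v : E) : metricCoord p e u v = metricForm p e u v := rfl

lemma metricForm_apply (p : M) (e u v : E) :
    metricForm p e u v = inner ℝ (pushChart p e u) (pushChart p e v) := rfl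

lemma metricForm_comm (p : M) (e u v : E) : metricForm p e u v = metricForm p e v u :=
  real_inner_comm (pushChart p e v) (pushChart p e u)

lemma metricForm_tangentCoord {p x : M} (hx : x ∈ (chartAt E p).source)
    (v w : TangentSpace 𝓘(ℝ, E) x) :
    metricForm p (extChartAt 𝓘(ℝ, E) p x) (tangentCoord p ⟨x, v⟩) (tangentCoord p ⟨x, w⟩)
      = inner ℝ v w := by
  obtain ⟨e, he, rfl⟩ := exists_symm_eq hx
  rw [(extChartAt 𝓘(ℝ, E) p).right_inv he, metricForm_apply, pushChart_tangentCoord p he,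
    pushChart_tangentCoord p he]

lemma metricForm_self_eq_zero {p : M} {e : E} (he : e ∈ (extChartAt 𝓘(ℝ, E) p).target) {u : E}
    (h : metricForm p e u u = 0) : u = 0 := by
  have h0 : pushChart p e u = 0 := by
    rwa [metricForm_apply, inner_self_eq_zero] at h
  rw [← tangentCoord_pushChart p he u, h0]
  exact map_zero (mfderiv 𝓘(ℝ, E) 𝓘(ℝ, E) (extChartAt 𝓘(ℝ, E) p) _)

/-- Positive definiteness gives injectivity, and `E` and its dual have the same finite dimension. -/
lemma isInvertible_metricForm {p : M} {e : E} (he : e ∈ (extChartAt 𝓘(ℝ, E) p).target) :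
    (metricForm p e).IsInvertible := by
  have hinj : Function.Injective (metricForm p e : E →ₗ[ℝ] E →L[ℝ] ℝ) := by
    rw [injective_iff_map_eq_zero]
    intro u hu
    exact metricForm_self_eq_zero he (congrArg (fun f : E →L[ℝ] ℝ => f u) hu)
  have hdim : Module.finrank ℝ E = Module.finrank ℝ (E →L[ℝ] ℝ) := by
    rw [← (LinearMap.toContinuousLinearMap (𝕜 := ℝ) (E := E) (F' := ℝ)).finrank_eq]
    exact Subspace.dual_finrank_eq.symm
  exact ⟨(LinearEquiv.ofInjectiveOfFinrankEq (metricForm p e : E →ₗ[ℝ] E →L[ℝ] ℝ) hinj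
    hdim).toContinuousLinearEquiv, by ext; rfl⟩

lemma inverse_metricForm_eq {p : M} {e : E} (he : e ∈ (extChartAt 𝓘(ℝ, E) p).target)
    {u : E} {ℓ : E →L[ℝ] ℝ} (h : ∀ w, metricForm p e u w = ℓ w) :
    (metricForm p e).inverse ℓ = u := by
  rw [show ℓ = metricForm p e u from (ContinuousLinearMap.ext h).symm]
  exact (isInvertible_metricForm he).inverse_apply_eq.2 rfl

lemma eq_of_metricForm_eq {p : M} {e : E} (he : e ∈ (extChartAt 𝓘(ℝ, E) p).target) {u v : E}
    (h : ∀ w, metricForm p e u w = metricForm p e v w) : u = v :=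
  (inverse_metricForm_eq he h).symm.trans (inverse_metricForm_eq he fun _ => rfl)

variable [IsContMDiffRiemannianBundle 𝓘(ℝ, E) ∞ E (fun x : M => TangentSpace 𝓘(ℝ, E) x)]

/-- The section is the tangent map of the inverse chart composed with the constant field `u`. -/
lemma contMDiffOn_pushChart (p : M) (u : E) :
    ContMDiffOn 𝓘(ℝ, E) 𝓘(ℝ, E).tangent ∞
      (fun e => (⟨(extChartAt 𝓘(ℝ, E) p).symm e, pushChart p e u⟩ : TangentBundle 𝓘(ℝ, E) M))
      (extChartAt 𝓘(ℝ, E) p).target := by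
  have h1 := (contMDiffOn_extChartAt_symm (I := 𝓘(ℝ, E)) (n := ∞) p).contMDiffOn_tangentMapWithin
    (m := ∞) (by simp) (isOpen_extChartAt_target (I := 𝓘(ℝ, E)) p).uniqueMDiffOn
  have h2 : ContMDiff 𝓘(ℝ, E) 𝓘(ℝ, E).tangent ∞ (fun e : E => (⟨e, u⟩ : TangentBundle 𝓘(ℝ, E) E)) :=
    contMDiff_vectorSpace_iff_contDiff.2 contDiff_const
  refine (h1.comp (s := (extChartAt 𝓘(ℝ, E) p).target) h2.contMDiffOn fun e he => he).congr ?_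
  intro e he
  simp only [Function.comp, tangentMapWithin]
  rw [mfderivWithin_of_isOpen (isOpen_extChartAt_target p) he]
  rfl

lemma contDiffOn_metricForm (p : M) :
    ContDiffOn ℝ ∞ (metricForm p : E → _) (extChartAt 𝓘(ℝ, E) p).target := by
  rw [contDiffOn_clm_apply]
  intro u
  rw [contDiffOn_clm_apply]
  intro v
  rw [← contMDiffOn_iff_contDiffOn]
  exact ContMDiffOn.inner_bundle (E := fun x : M => TangentSpace 𝓘(ℝ, E) x)
    (b := (extChartAt 𝓘(ℝ, E) p).symm) (v := fun e => pushChart p e u)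
    (w := fun e => pushChart p e v) (contMDiffOn_pushChart p u) (contMDiffOn_pushChart p v)

end Coordinates

/-! ### The transport equation for a field of bilinear forms on a vector space. -/

section BilinearFields

variable {E : Type*} [NormedAddCommGroup E] [NormedSpace ℝ E]

instance : NormedAddCommGroup (E →L[ℝ] E →L[ℝ] ℝ) := ContinuousLinearMap.toNormedAddCommGroup

instance : NormedSpace ℝ (E →L[ℝ] E →L[ℝ] ℝ) := ContinuousLinearMap.toNormedSpace

/-- The Christoffel symbols of the first kind of a field of bilinear forms, as a continuous
trilinear form. -/
def christoffelOf (G : E → E →L[ℝ] E →L[ℝ] ℝ) (e : E) : E →L[ℝ] E →L[ℝ] E →L[ℝ] ℝ :=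
  (2⁻¹ : ℝ) • (fderiv ℝ G e + (fderiv ℝ G e).flip -
    (ContinuousLinearMap.flipₗᵢ ℝ E E ℝ).toContinuousLinearEquiv.toContinuousLinearMap ∘L
      (fderiv ℝ G e).flip)

lemma christoffelOf_apply (G : E → E →L[ℝ] E →L[ℝ] ℝ) (e u v w : E) : christoffelOf G e u v w =
    (fderiv ℝ G e u v w + fderiv ℝ G e v u w - fderiv ℝ G e w u v) / 2 := by
  rw [div_eq_inv_mul]; rfl

lemma fderiv_apply_apply {G : E → E →L[ℝ] E →L[ℝ] ℝ} {e : E} (hG : DifferentiableAt ℝ G e)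
    (u v w : E) : fderiv ℝ (fun e' => G e' v w) e u = fderiv ℝ G e u v w := by
  have h := (hG.hasFDerivAt.clm_apply (hasFDerivAt_const v e)).clm_apply (hasFDerivAt_const w e)
  rw [h.fderiv]
  simp

lemma continuousAt_christoffelOf {G : E → E →L[ℝ] E →L[ℝ] ℝ} {e : E} (hG : ContDiffAt ℝ ∞ G e) :
    ContinuousAt (christoffelOf G) e := by
  have h0 : ContinuousAt (fderiv ℝ G) e := (hG.fderiv_right (m := 0) (by simp)).continuousAt
  have h0' : ContinuousAt (fun y => (fderiv ℝ G y).flip) e :=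
    ContinuousAt.comp (g := (ContinuousLinearMap.flipₗᵢ ℝ E E (E →L[ℝ] ℝ)))
      (LinearIsometryEquiv.continuous _).continuousAt h0
  exact ((h0.add h0').sub (continuousAt_const.clm_comp h0')).const_smul (2⁻¹ : ℝ)

lemma continuousAt_connection [CompleteSpace E] {G : E → E →L[ℝ] E →L[ℝ] ℝ} {e : E}
    (hG : ContDiffAt ℝ ∞ G e) (hG' : (G e).IsInvertible) (u : E) :
    ContinuousAt (fun q : E × E => (G q.1).inverse ∘L christoffelOf G q.1 q.2) (e, u) := by
  have h1 : ContinuousAt (fun y => (G y).inverse) e :=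
    (hG'.contDiffAt_map_inverse (n := 0)).continuousAt.comp hG.continuousAt
  have h3 : ContinuousAt (fun q : E × E => (G q.1).inverse) (e, u) :=
    ContinuousAt.comp (f := Prod.fst) (x := (e, u)) h1 continuousAt_fst
  have h4 : ContinuousAt (fun q : E × E => christoffelOf G q.1) (e, u) :=
    ContinuousAt.comp (f := Prod.fst) (x := (e, u)) (continuousAt_christoffelOf hG) continuousAt_fst
  exact h3.clm_comp (h4.clm_apply continuousAt_snd)

/-- Raising the index turns the equation paired with test vectors into a linear ODE in normal form.
-/
lemma parallel_eq_iff {G : E → E →L[ℝ] E →L[ℝ] ℝ} {e : E} (hG : (G e).IsInvertible) {u v v' : E} :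
    (∀ w, G e v' w + christoffelOf G e u v w = 0) ↔
      v' = -((G e).inverse ∘L christoffelOf G e u) v := by
  have key : G e ((G e).inverse (christoffelOf G e u v)) = christoffelOf G e u v :=
    (hG.inverse_apply_eq.1 rfl).symm
  rw [ContinuousLinearMap.comp_apply, ← map_neg, eq_comm (a := v'), hG.inverse_apply_eq,
    ContinuousLinearMap.ext_iff]
  refine forall_congr' fun w => ?_
  rw [neg_apply]
  constructor <;> intro h <;> linarith

lemma fderiv_pullback {G H : E → E →L[ℝ] E →L[ℝ] ℝ} {τ : E → E} {e : E} (hτ : ContDiffAt ℝ ∞ τ e)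
    (hG : DifferentiableAt ℝ G (τ e)) (hH : DifferentiableAt ℝ H e)
    (hGH : ∀ᶠ y in 𝓝 e, ∀ v w, H y v w = G (τ y) (fderiv ℝ τ y v) (fderiv ℝ τ y w)) (u v w : E) :
    fderiv ℝ H e u v w =
      fderiv ℝ G (τ e) (fderiv ℝ τ e u) (fderiv ℝ τ e v) (fderiv ℝ τ e w) +
      G (τ e) (fderiv ℝ (fderiv ℝ τ) e u v) (fderiv ℝ τ e w) +
      G (τ e) (fderiv ℝ τ e v) (fderiv ℝ (fderiv ℝ τ) e u w) := by
  have hT : HasFDerivAt (fderiv ℝ τ) (fderiv ℝ (fderiv ℝ τ) e) e :=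
    ((hτ.fderiv_right (m := 1) (WithTop.coe_le_coe.2 le_top)).differentiableAt
      one_ne_zero).hasFDerivAt
  have hτ' : HasFDerivAt τ (fderiv ℝ τ e) e := (hτ.differentiableAt (by simp)).hasFDerivAt
  have hG1 : HasFDerivAt (fun y => G (τ y)) (fderiv ℝ G (τ e) ∘L fderiv ℝ τ e) e :=
    hG.hasFDerivAt.comp e hτ'
  have h := (hG1.clm_apply (hT.clm_apply (hasFDerivAt_const v e))).clm_apply
    (hT.clm_apply (hasFDerivAt_const w e))
  have hev : (fun y => H y v w) =ᶠ[𝓝 e] fun y => G (τ y) (fderiv ℝ τ y v) (fderiv ℝ τ y w) :=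
    hGH.mono fun y hy => hy v w
  rw [← fderiv_apply_apply hH, hev.fderiv_eq, h.fderiv]
  simp
  abel

/-- The three derivatives of the pulled back form contain six terms with second derivatives of `τ`.
By symmetry of `G` and of the second derivative, four cancel and the other two coincide. -/
lemma christoffelOf_pullback {G H : E → E →L[ℝ] E →L[ℝ] ℝ} {τ : E → E} {e : E}
    (hτ : ContDiffAt ℝ ∞ τ e) (hG : DifferentiableAt ℝ G (τ e)) (hH : DifferentiableAt ℝ H e)
    (hsymm : ∀ v w, G (τ e) v w = G (τ e) w v)
    (hGH : ∀ᶠ y in 𝓝 e, ∀ v w, H y v w = G (τ y) (fderiv ℝ τ y v) (fderiv ℝ τ y w)) (u v w : E) :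
    christoffelOf H e u v w =
      christoffelOf G (τ e) (fderiv ℝ τ e u) (fderiv ℝ τ e v) (fderiv ℝ τ e w) +
      G (τ e) (fderiv ℝ (fderiv ℝ τ) e u v) (fderiv ℝ τ e w) := by
  have hs : ∀ a b, fderiv ℝ (fderiv ℝ τ) e a b = fderiv ℝ (fderiv ℝ τ) e b a :=
    (hτ.isSymmSndFDerivAt (by rw [minSmoothness_of_isRCLikeNormedField]; exact WithTop.coe_le_coe.2 le_top)).eq
  simp only [christoffelOf_apply, fderiv_pullback hτ hG hH hGH]
  rw [hs v u, hs w u, hs w v, hsymm (fderiv ℝ τ e v) (fderiv ℝ (fderiv ℝ τ) e u w)]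
  ring

/-- The parallel transport equation is invariant under a change of coordinates `τ`. -/
lemma parallel_pullback {G H : E → E →L[ℝ] E →L[ℝ] ℝ} {τ : E → E} {b v b₁ v₁ : ℝ → E} {s : Set ℝ}
    {t : ℝ} (hτ : ContDiffAt ℝ ∞ τ (b t)) (hG : DifferentiableAt ℝ G (τ (b t)))
    (hH : DifferentiableAt ℝ H (b t)) (hsymm : ∀ v w, G (τ (b t)) v w = G (τ (b t)) w v)
    (hGH : ∀ᶠ y in 𝓝 (b t), ∀ v w, H y v w = G (τ y) (fderiv ℝ τ y v) (fderiv ℝ τ y w))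
    (hsurj : Function.Surjective (fderiv ℝ τ (b t)))
    (ht : t ∈ s) (hb₁ : ∀ᶠ r in 𝓝[s] t, b₁ r = τ (b r))
    (hv₁ : ∀ᶠ r in 𝓝[s] t, v₁ r = fderiv ℝ τ (b r) (v r))
    {u v' : E} (hu : HasDerivWithinAt b u s t) (hv : HasDerivWithinAt v v' s t)
    (heq : ∀ w, H (b t) v' w + christoffelOf H (b t) u (v t) w = 0) :
    ∃ v₁', HasDerivWithinAt b₁ (fderiv ℝ τ (b t) u) s t ∧ HasDerivWithinAt v₁ v₁' s t ∧
      ∀ w, G (b₁ t) v₁' w + christoffelOf G (b₁ t) (fderiv ℝ τ (b t) u) (v₁ t) w = 0 := by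
  have hT : HasFDerivAt (fderiv ℝ τ) (fderiv ℝ (fderiv ℝ τ) (b t)) (b t) :=
    ((hτ.fderiv_right (m := 1) (WithTop.coe_le_coe.2 le_top)).differentiableAt
      one_ne_zero).hasFDerivAt
  have hτ' : HasFDerivAt τ (fderiv ℝ τ (b t)) (b t) :=
    (hτ.differentiableAt (by simp)).hasFDerivAt
  have hb₁t : b₁ t = τ (b t) := hb₁.self_of_nhdsWithin ht
  have hv₁t : v₁ t = fderiv ℝ τ (b t) (v t) := hv₁.self_of_nhdsWithin ht
  -- Product rule for `Dτ(b) v`. The second-derivative term is exactly the inhomogeneous term of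
  -- `christoffelOf_pullback`.
  refine ⟨fderiv ℝ (fderiv ℝ τ) (b t) u (v t) + fderiv ℝ τ (b t) v',
    (hτ'.comp_hasDerivWithinAt t hu).congr_of_eventuallyEq hb₁ hb₁t,
    ((hT.comp_hasDerivWithinAt t hu).clm_apply hv).congr_of_eventuallyEq hv₁ hv₁t, fun w' => ?_⟩
  obtain ⟨w, rfl⟩ := hsurj w'
  have h1 := heq w
  rw [hGH.self_of_nhds, christoffelOf_pullback hτ hG hH hsymm hGH] at h1
  rw [hb₁t, hv₁t, map_add, add_apply]
  linarith

/-- Two solutions of the parallel transport equation have constant inner product. -/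
lemma hasDerivWithinAt_parallel {G : E → E →L[ℝ] E →L[ℝ] ℝ} {b v w : ℝ → E} {s : Set ℝ} {t : ℝ}
    (hG : DifferentiableAt ℝ G (b t)) (hsymm : ∀ᶠ y in 𝓝 (b t), ∀ v w, G y v w = G y w v)
    {u v' w' : E} (hu : HasDerivWithinAt b u s t) (hv : HasDerivWithinAt v v' s t)
    (hw : HasDerivWithinAt w w' s t)
    (hv' : ∀ z, G (b t) v' z + christoffelOf G (b t) u (v t) z = 0)
    (hw' : ∀ z, G (b t) w' z + christoffelOf G (b t) u (w t) z = 0) :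
    HasDerivWithinAt (fun r => G (b r) (v r) (w r)) 0 s t := by
  have h := ((hG.hasFDerivAt.comp_hasDerivWithinAt t hu).clm_apply hv).clm_apply hw
  have hs : ∀ u v w, fderiv ℝ G (b t) u v w = fderiv ℝ G (b t) u w v := by
    intro u v w
    rw [← fderiv_apply_apply hG, ← fderiv_apply_apply hG]
    have : (fun y => G y v w) =ᶠ[𝓝 (b t)] fun y => G y w v := hsymm.mono fun y hy => hy v w
    rw [this.fderiv_eq]
  -- Each equation is tested against the other field; the two Christoffel terms then add up to the
  -- derivative of `G` in the direction `u`.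
  have h1 := hv' (w t)
  have h2 := hw' (v t)
  rw [christoffelOf_apply] at h1 h2
  rw [hsymm.self_of_nhds] at h2
  rw [hs u (w t) (v t)] at h2
  have key : (fderiv ℝ G (b t) u (v t) + (G ∘ b) t v') (w t) + (G ∘ b) t (v t) w' = 0 := by
    simp only [Function.comp, add_apply]
    linarith
  rw [key] at h
  exact h

end BilinearFields

/-! ### Independence of the transport equation of the chart. -/

section Christoffel

variable {E : Type*} [NormedAddCommGroup E] [NormedSpace ℝ E] [FiniteDimensional ℝ E]
  {M : Type*} [MetricSpace M] [ChartedSpace E M] [IsManifold 𝓘(ℝ, E) ∞ M]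

/-- The transition map between two charts. -/
def transition (q p : M) : E → E := extChartAt 𝓘(ℝ, E) p ∘ (extChartAt 𝓘(ℝ, E) q).symm

lemma transition_apply {p q x : M} (hq : x ∈ (chartAt E q).source) :
    transition q p (extChartAt 𝓘(ℝ, E) q x) = extChartAt 𝓘(ℝ, E) p x := by
  rw [transition, Function.comp, (extChartAt 𝓘(ℝ, E) q).left_inv (by simpa using hq)]

lemma contDiffAt_transition {p q x : M} (hq : x ∈ (chartAt E q).source)
    (hp : x ∈ (chartAt E p).source) :
    ContDiffAt ℝ ∞ (transition q p : E → E) (extChartAt 𝓘(ℝ, E) q x) := by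
  rw [← contDiffWithinAt_univ, ← range_id (α := E)]
  refine contDiffWithinAt_ext_coord_change (I := 𝓘(ℝ, E)) p q ?_
  rw [PartialEquiv.trans_source]
  refine ⟨mem_target hq, ?_⟩
  rw [mem_preimage, (extChartAt 𝓘(ℝ, E) q).left_inv (by simpa using hq)]
  simpa using hp

variable [RiemannianBundle (fun x : M => TangentSpace 𝓘(ℝ, E) x)]

lemma tangentCoord_transition {p q x : M} (hq : x ∈ (chartAt E q).source)
    (hp : x ∈ (chartAt E p).source) (v : TangentSpace 𝓘(ℝ, E) x) :
    tangentCoord p ⟨x, v⟩ =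
      fderiv ℝ (transition q p) (extChartAt 𝓘(ℝ, E) q x) (tangentCoord q ⟨x, v⟩) := by
  obtain ⟨e, he, rfl⟩ := exists_symm_eq hq
  rw [(extChartAt 𝓘(ℝ, E) q).right_inv he]
  conv_lhs => rw [← pushChart_tangentCoord q he v]
  rw [← mfderiv_eq_fderiv, transition, mfderiv_comp (I' := 𝓘(ℝ, E)) _ (mdifferentiableAt_extChartAt hp)]
  · rfl
  · exact (mdifferentiableOn_extChartAt_symm (I := 𝓘(ℝ, E)) (x := q)).mdifferentiableAt
      ((isOpen_extChartAt_target q).mem_nhds he)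

lemma metricForm_transition {p q x : M} (hq : x ∈ (chartAt E q).source)
    (hp : x ∈ (chartAt E p).source) (v w : E) :
    metricForm q (extChartAt 𝓘(ℝ, E) q x) v w = metricForm p (extChartAt 𝓘(ℝ, E) p x)
      (fderiv ℝ (transition q p) (extChartAt 𝓘(ℝ, E) q x) v)
      (fderiv ℝ (transition q p) (extChartAt 𝓘(ℝ, E) q x) w) := by
  obtain ⟨v, rfl⟩ := exists_tangentCoord_eq hq v
  obtain ⟨w, rfl⟩ := exists_tangentCoord_eq hq w
  rw [← tangentCoord_transition hq hp, ← tangentCoord_transition hq hp,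
    metricForm_tangentCoord hq, metricForm_tangentCoord hp]

lemma eventually_metricForm_transition {p q x : M} (hq : x ∈ (chartAt E q).source)
    (hp : x ∈ (chartAt E p).source) : ∀ᶠ y in 𝓝 (extChartAt 𝓘(ℝ, E) q x), ∀ v w,
      metricForm q y v w = metricForm p (transition q p y)
      (fderiv ℝ (transition q p) y v) (fderiv ℝ (transition q p) y w) := by
  have h1 : ∀ᶠ y in 𝓝 (extChartAt 𝓘(ℝ, E) q x), y ∈ (extChartAt 𝓘(ℝ, E) q).target :=
    (isOpen_extChartAt_target q).mem_nhds (mem_target hq)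
  have h2 : ∀ᶠ y in 𝓝 (extChartAt 𝓘(ℝ, E) q x),
      (extChartAt 𝓘(ℝ, E) q).symm y ∈ (chartAt E p).source := by
    refine (continuousAt_extChartAt_symm'' (mem_target hq)).preimage_mem_nhds
      ((chartAt E p).open_source.mem_nhds ?_)
    rwa [(extChartAt 𝓘(ℝ, E) q).left_inv (by simpa using hq)]
  filter_upwards [h1, h2] with y hy1 hy2 v w
  have hy3 : (extChartAt 𝓘(ℝ, E) q).symm y ∈ (chartAt E q).source := by
    simpa using (extChartAt 𝓘(ℝ, E) q).map_target hy1
  have := metricForm_transition hy3 hy2 v w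
  rwa [(extChartAt 𝓘(ℝ, E) q).right_inv hy1] at this

/-- In the chart centred at `p`, the base curve of `W` has velocity `X` at time `t`, and the field
`W` has vanishing covariant derivative there. -/
def IsParallelWithinAt (W : ℝ → TangentBundle 𝓘(ℝ, E) M) (s : Set ℝ) (t : ℝ) (p : M)
    (X : TangentSpace 𝓘(ℝ, E) (W t).proj) : Prop :=
  HasDerivWithinAt (fun r => extChartAt 𝓘(ℝ, E) p (W r).proj) (tangentCoord p ⟨_, X⟩) s t ∧
  ∃ v' : E, HasDerivWithinAt (fun r => tangentCoord p (W r)) v' s t ∧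
    ∀ w, metricForm p (extChartAt 𝓘(ℝ, E) p (W t).proj) v' w +
      christoffelOf (metricForm p) (extChartAt 𝓘(ℝ, E) p (W t).proj) (tangentCoord p ⟨_, X⟩)
        (tangentCoord p (W t)) w = 0

variable [IsContMDiffRiemannianBundle 𝓘(ℝ, E) ∞ E (fun x : M => TangentSpace 𝓘(ℝ, E) x)]

lemma contDiffAt_metricForm {p : M} {e : E} (he : e ∈ (extChartAt 𝓘(ℝ, E) p).target) :
    ContDiffAt ℝ ∞ (metricForm p) e :=
  (contDiffOn_metricForm p).contDiffAt ((isOpen_extChartAt_target p).mem_nhds he)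

lemma differentiableAt_metricForm {p : M} {e : E} (he : e ∈ (extChartAt 𝓘(ℝ, E) p).target) :
    DifferentiableAt ℝ (metricForm p) e :=
  (contDiffAt_metricForm he).differentiableAt (by simp)

lemma christoffel_eq {p : M} {e : E} (he : e ∈ (extChartAt 𝓘(ℝ, E) p).target) (u v w : E) :
    christoffel p e u v w = christoffelOf (metricForm p) e u v w := by
  have h := fderiv_apply_apply (differentiableAt_metricForm he)
  rw [christoffelOf_apply, ← h, ← h, ← h]
  rfl

/-- The velocity becomes a tangent vector `X` instead of a coordinate vector, so that it is the same
object in all charts. -/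
lemma isParallel_iff {W : ℝ → TangentBundle 𝓘(ℝ, E) M} : IsParallel W ↔
    ContinuousOn W (Icc 0 1) ∧ ∀ t ∈ Icc (0 : ℝ) 1, ∀ p : M, (W t).proj ∈ (chartAt E p).source →
      ∃ X, IsParallelWithinAt W (Icc 0 1) t p X := by
  refine and_congr Iff.rfl (forall₂_congr fun t _ => forall₂_congr fun p hp => ?_)
  simp only [IsParallelWithinAt, metricCoord_eq, christoffel_eq (mem_target hp)]
  constructor
  · rintro ⟨u, v', h⟩
    obtain ⟨X, rfl⟩ := exists_tangentCoord_eq hp u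
    exact ⟨X, h.1, v', h.2⟩
  · rintro ⟨X, h1, v', h2⟩
    exact ⟨_, v', h1, h2⟩

/-- Thanks to this, a field constructed by solving the equation in one chart is parallel in every
chart. -/
lemma IsParallelWithinAt.change_chart {W : ℝ → TangentBundle 𝓘(ℝ, E) M} {s : Set ℝ} {t : ℝ}
    {q p : M} {X : TangentSpace 𝓘(ℝ, E) (W t).proj} (h : IsParallelWithinAt W s t q X)
    (hc : ContinuousWithinAt (fun r => (W r).proj) s t) (ht : t ∈ s)
    (hq : (W t).proj ∈ (chartAt E q).source) (hp : (W t).proj ∈ (chartAt E p).source) :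
    IsParallelWithinAt W s t p X := by
  obtain ⟨hu, v', hv, heq⟩ := h
  have hevq : ∀ᶠ r in 𝓝[s] t, (W r).proj ∈ (chartAt E q).source :=
    hc.preimage_mem_nhdsWithin ((chartAt E q).open_source.mem_nhds hq)
  have hevp : ∀ᶠ r in 𝓝[s] t, (W r).proj ∈ (chartAt E p).source :=
    hc.preimage_mem_nhdsWithin ((chartAt E p).open_source.mem_nhds hp)
  obtain ⟨v₁', h1, h2, h3⟩ := parallel_pullback (G := metricForm p) (H := metricForm q)
    (τ := transition q p) (b := fun r => extChartAt 𝓘(ℝ, E) q (W r).proj)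
    (v := fun r => tangentCoord q (W r)) (b₁ := fun r => extChartAt 𝓘(ℝ, E) p (W r).proj)
    (v₁ := fun r => tangentCoord p (W r))
    (contDiffAt_transition hq hp)
    (by rw [transition_apply hq]; exact differentiableAt_metricForm (mem_target hp))
    (differentiableAt_metricForm (mem_target hq)) (metricForm_comm p _)
    (eventually_metricForm_transition hq hp)
    (fun w => by
      obtain ⟨w, rfl⟩ := exists_tangentCoord_eq hp w
      exact ⟨_, (tangentCoord_transition hq hp w).symm⟩)
    ht (hevq.mono fun r hr => (transition_apply hr).symm)
    ((hevq.and hevp).mono fun r hr => tangentCoord_transition hr.1 hr.2 _) hu hv heq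
  rw [← tangentCoord_transition hq hp] at h1 h3
  exact ⟨h1, v₁', h2, h3⟩

end Christoffel

/-- Picard-Lindelöf on the ball of radius `‖v‖ + 1` about `v`, where the field is at most `K (2‖v‖ +
1)`. With `K (b - a) ≤ 1/2` the displacement is at most `‖v‖ + 1/2`, so the admissible length of the
interval does not depend on `v`. -/
lemma exists_linear_ode {E : Type*} [NormedAddCommGroup E] [NormedSpace ℝ E] [CompleteSpace E]
    {A : ℝ → E →L[ℝ] E} {a b K : ℝ} (hab : a ≤ b) (hA : ContinuousOn A (Icc a b))
    (hK : ∀ t ∈ Icc a b, ‖A t‖ ≤ K) (hKab : K * (b - a) ≤ 1 / 2) (v : E) :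
    ∃ y : ℝ → E, y a = v ∧ ∀ t ∈ Icc a b, HasDerivWithinAt y (A t (y t)) (Icc a b) t := by
  have hK0 : 0 ≤ K := (norm_nonneg _).trans (hK a (left_mem_Icc.2 hab))
  lift K to NNReal using hK0
  refine IsPicardLindelof.exists_eq_forall_mem_Icc_hasDerivWithinAt₀ (f := fun t y => A t y)
    (t₀ := ⟨a, left_mem_Icc.2 hab⟩) (x₀ := v) (a := ‖v‖₊ + 1) (K := K) (L := K * (2 * ‖v‖₊ + 1))
    ⟨fun t ht => ?_, fun y _ => hA.clm_apply continuousOn_const, fun t ht y hy => ?_, ?_⟩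
  · exact ((A t).lipschitz.weaken (hK t ht)).lipschitzOnWith
  · have hy' : ‖y‖ ≤ 2 * ‖v‖ + 1 := by
      rw [mem_closedBall_iff_norm] at hy
      push_cast at hy
      have := norm_le_norm_add_norm_sub' y v
      linarith
    push_cast
    exact ((A t).le_opNorm y).trans (mul_le_mul (hK t ht) hy' (norm_nonneg _) K.2)
  · have h0 : (0 : ℝ) ≤ b - a := sub_nonneg.2 hab
    push_cast
    rw [sub_self, max_eq_left h0, mul_right_comm, sub_zero]
    nlinarith [norm_nonneg v]

/-! ### Gluing of parallel fields and constancy of their inner products. -/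

section Transport

variable {E : Type*} [NormedAddCommGroup E] [NormedSpace ℝ E] [FiniteDimensional ℝ E]
  {M : Type*} [MetricSpace M] [ChartedSpace E M] [IsManifold 𝓘(ℝ, E) ∞ M]
  [RiemannianBundle (fun x : M => TangentSpace 𝓘(ℝ, E) x)]

/-- The equation and the velocity determine the derivative of the field by nondegeneracy of the
metric, so the derivatives within `s` and `s'` agree. -/
lemma IsParallelWithinAt.union {W : ℝ → TangentBundle 𝓘(ℝ, E) M} {s s' : Set ℝ} {t : ℝ} {p : M}
    {X : TangentSpace 𝓘(ℝ, E) (W t).proj} (hp : (W t).proj ∈ (chartAt E p).source)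
    (h : IsParallelWithinAt W s t p X) (h' : IsParallelWithinAt W s' t p X) :
    IsParallelWithinAt W (s ∪ s') t p X := by
  obtain ⟨h1, v, h2, h3⟩ := h
  obtain ⟨h1', v', h2', h3'⟩ := h'
  have hv : v' = v := eq_of_metricForm_eq (mem_target hp) fun w => by linarith [h3 w, h3' w]
  exact ⟨h1.union h1', v, h2.union (hv ▸ h2'), h3⟩

lemma IsParallelWithinAt.congr {W W' : ℝ → TangentBundle 𝓘(ℝ, E) M} {s s' : Set ℝ} {t : ℝ} {p : M}
    {X : TangentSpace 𝓘(ℝ, E) (W t).proj} {X' : TangentSpace 𝓘(ℝ, E) (W' t).proj}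
    (h : IsParallelWithinAt W s t p X) (hs : s ∈ 𝓝[s'] t) (hW : W' =ᶠ[𝓝[s'] t] W)
    (ht : W' t = W t) (hX : (⟨_, X'⟩ : TangentBundle 𝓘(ℝ, E) M) = ⟨_, X⟩) :
    IsParallelWithinAt W' s' t p X' := by
  obtain ⟨h1, v, h2, h3⟩ := h
  refine ⟨?_, v, ?_, ?_⟩
  · rw [hX]
    exact (h1.mono_of_mem_nhdsWithin hs).congr_of_eventuallyEq (hW.mono fun r hr => by
      simp only [hr]) (by simp only [ht])
  · exact (h2.mono_of_mem_nhdsWithin hs).congr_of_eventuallyEq (hW.mono fun r hr => by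
      simp only [hr]) (by simp only [ht])
  · rw [hX, ht]
    exact h3

lemma IsParallel.congr {W W' : ℝ → TangentBundle 𝓘(ℝ, E) M} (h : IsParallel W)
    (hW : EqOn W' W (Icc 0 1)) : IsParallel W' := by
  refine ⟨h.1.congr hW, fun t ht p hp => ?_⟩
  rw [hW ht] at hp ⊢
  obtain ⟨u, v', h1, h2, h3⟩ := h.2 t ht p hp
  exact ⟨u, v', h1.congr (fun r hr => by simp only [hW hr]) (by simp only [hW ht]),
    h2.congr (fun r hr => by simp only [hW hr]) (by simp only [hW ht]), h3⟩

variable [IsContMDiffRiemannianBundle 𝓘(ℝ, E) ∞ E (fun x : M => TangentSpace 𝓘(ℝ, E) x)]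

lemma inner_const_of_isParallel {b : ℝ → M} {v w : ∀ t, TangentSpace 𝓘(ℝ, E) (b t)}
    (hv : IsParallel fun t => (⟨b t, v t⟩ : TangentBundle 𝓘(ℝ, E) M))
    (hw : IsParallel fun t => (⟨b t, w t⟩ : TangentBundle 𝓘(ℝ, E) M)) {t : ℝ} (ht : t ∈ Icc (0 : ℝ) 1) :
    (inner ℝ (v t) (w t) : ℝ) = inner ℝ (v 0) (w 0) := by
  rw [isParallel_iff] at hv hw
  have hd : ∀ t ∈ Icc (0 : ℝ) 1,
      HasDerivWithinAt (fun t => (inner ℝ (v t) (w t) : ℝ)) 0 (Icc 0 1) t := by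
    intro t ht
    set p := b t
    have hp : b t ∈ (chartAt E p).source := mem_chart_source E _
    obtain ⟨X, h1, v', h2, h3⟩ := hv.2 t ht p hp
    obtain ⟨X', h1', w', h2', h3'⟩ := hw.2 t ht p hp
    -- Both fields lie over the same curve, so their base velocities are the same derivative.
    have hX : tangentCoord p ⟨_, X⟩ = tangentCoord p ⟨_, X'⟩ :=
      (uniqueDiffOn_Icc (zero_lt_one' ℝ) t ht).eq_deriv _ h1 h1'
    rw [← hX] at h3'
    have hcont : ContinuousWithinAt b (Icc 0 1) t :=
      (FiberBundle.continuous_proj E (TangentSpace 𝓘(ℝ, E) : M → Type _)).continuousAt.comp_continuousWithinAt (hv.1 t ht)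
    have h := hasDerivWithinAt_parallel (G := metricForm p)
      (differentiableAt_metricForm (mem_target hp))
      (Filter.Eventually.of_forall fun y => metricForm_comm p y) h1 h2 h2' h3 h3'
    refine h.congr_of_eventuallyEq ?_ (metricForm_tangentCoord hp _ _).symm
    filter_upwards [hcont.preimage_mem_nhdsWithin ((chartAt E p).open_source.mem_nhds hp)]
      with r hr using (metricForm_tangentCoord hr _ _).symm
  have hcon := constant_of_has_deriv_right_zero (f := fun t => (inner ℝ (v t) (w t) : ℝ))
    (a := 0) (b := 1) (fun t ht => (hd t ht).continuousWithinAt) (fun t ht =>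
      (hd t (Ico_subset_Icc_self ht)).mono_of_mem_nhdsWithin (Icc_mem_nhdsGE_of_mem ht))
  exact hcon t ht

end Transport

/-! ### Existence of parallel fields along geodesics. -/

section Existence

variable {E : Type*} [NormedAddCommGroup E] [NormedSpace ℝ E] [FiniteDimensional ℝ E]
  {M : Type*} [MetricSpace M] [ChartedSpace E M] [IsManifold 𝓘(ℝ, E) ∞ M]

lemma continuousOn_proj {W : ℝ → TangentBundle 𝓘(ℝ, E) M} {s : Set ℝ} (h : ContinuousOn W s) :
    ContinuousOn (fun t => (W t).proj) s :=
  (FiberBundle.continuous_proj E (TangentSpace 𝓘(ℝ, E) : M → Type _)).comp_continuousOn h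

variable [RiemannianBundle (fun x : M => TangentSpace 𝓘(ℝ, E) x)]

/-- The section `v` along the curve `c` is parallel on the set `s`; here `c` carries the velocity of
its base curve. -/
def IsParallelAlong (c : ℝ → TangentBundle 𝓘(ℝ, E) M) (v : ∀ t, TangentSpace 𝓘(ℝ, E) (c t).proj)
    (s : Set ℝ) : Prop :=
  ∀ t ∈ s, ∀ p : M, (c t).proj ∈ (chartAt E p).source →
    IsParallelWithinAt (fun t => ⟨(c t).proj, v t⟩) s t p (c t).2

/-- The operator of the parallel transport equation along `c` in the chart centred at `q`. -/
def transportOp (c : ℝ → TangentBundle 𝓘(ℝ, E) M) (q : M) (t : ℝ) : E →L[ℝ] E :=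
  (metricForm q (extChartAt 𝓘(ℝ, E) q (c t).proj)).inverse ∘L
    christoffelOf (metricForm q) (extChartAt 𝓘(ℝ, E) q (c t).proj) (tangentCoord q (c t))

variable [IsContMDiffRiemannianBundle 𝓘(ℝ, E) ∞ E (fun x : M => TangentSpace 𝓘(ℝ, E) x)]

lemma continuousWithinAt_transportOp {c : ℝ → TangentBundle 𝓘(ℝ, E) M} {s : Set ℝ} {t : ℝ} {q : M}
    (hc : ContinuousWithinAt c s t) (hq : (c t).proj ∈ (chartAt E q).source) :
    ContinuousWithinAt (transportOp c q) s t := by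
  have h1 : ContinuousWithinAt (fun r => (extChartAt 𝓘(ℝ, E) q (c r).proj, tangentCoord q (c r)))
      s t := by
    refine ContinuousWithinAt.prodMk ?_ ?_
    · exact (continuousAt_extChartAt' (by simpa using hq)).comp_continuousWithinAt
        ((FiberBundle.continuous_proj E
          (TangentSpace 𝓘(ℝ, E) : M → Type _)).continuousAt.comp_continuousWithinAt hc)
    · refine ContinuousAt.comp_continuousWithinAt (g := tangentCoord q) (f := c) ?_ hc
      refine (continuousOn_tangentCoord q).continuousAt (IsOpen.mem_nhds ?_ hq)
      exact (chartAt E q).open_source.preimage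
        (FiberBundle.continuous_proj E (TangentSpace 𝓘(ℝ, E) : M → Type _))
  exact (continuousAt_connection (contDiffAt_metricForm (mem_target hq))
    (isInvertible_metricForm (mem_target hq)) (tangentCoord q (c t))).comp_continuousWithinAt
      (f := fun r => (extChartAt 𝓘(ℝ, E) q (c r).proj, tangentCoord q (c r))) h1

lemma exists_isParallelAlong_chart {c : ℝ → TangentBundle 𝓘(ℝ, E) M} (hc : IsGeodesic c)
    {t₁ t₂ K : ℝ} (h₁₂ : t₁ ≤ t₂) (hs : Icc t₁ t₂ ⊆ Icc 0 1) {q : M}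
    (hq : ∀ t ∈ Icc t₁ t₂, (c t).proj ∈ (chartAt E q).source)
    (hK : ∀ t ∈ Icc t₁ t₂, ‖transportOp c q t‖ ≤ K) (hKt : K * (t₂ - t₁) ≤ 1 / 2)
    (v₁ : TangentSpace 𝓘(ℝ, E) (c t₁).proj) :
    ∃ v : ∀ t, TangentSpace 𝓘(ℝ, E) (c t).proj, v t₁ = v₁ ∧ IsParallelAlong c v (Icc t₁ t₂) := by
  obtain ⟨y, hy1, hy⟩ := exists_linear_ode (A := fun t => -transportOp c q t) h₁₂
    (fun t ht => ((continuousWithinAt_transportOp (hc.1.1 t (hs ht)) (hq t ht)).mono hs).neg)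
    (fun t ht => (norm_neg (transportOp c q t)).le.trans (hK t ht)) hKt (tangentCoord q ⟨_, v₁⟩)
  have hex : ∀ t, ∃ v : TangentSpace 𝓘(ℝ, E) (c t).proj,
      t ∈ Icc t₁ t₂ → tangentCoord q ⟨_, v⟩ = y t := by
    intro t
    by_cases ht : t ∈ Icc t₁ t₂
    · obtain ⟨v, hv⟩ := exists_tangentCoord_eq (hq t ht) (y t)
      exact ⟨v, fun _ => hv⟩
    · exact ⟨0, fun h => absurd h ht⟩
  choose v hv using hex
  refine ⟨v, ?_, fun t ht p hp => ?_⟩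
  · have ht₁ := left_mem_Icc.2 h₁₂
    have h := (hv t₁ ht₁).trans hy1
    refine sub_eq_zero.1 ((inner_self_eq_zero (𝕜 := ℝ)).1 ?_)
    rw [← metricForm_tangentCoord (hq t₁ ht₁), tangentCoord_sub, h, sub_self, map_zero]
  · refine IsParallelWithinAt.change_chart (q := q) ?_ ((continuousOn_proj hc.1.1).mono hs t ht) ht
      (hq t ht) hp
    refine ⟨(hc.2 t (hs ht) q (hq t ht)).mono hs, -transportOp c q t (y t), ?_, ?_⟩
    · exact (hy t ht).congr (fun r hr => hv r hr) (hv t ht)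
    · have h := (parallel_eq_iff (G := metricForm q) (u := tangentCoord q (c t)) (v := y t)
        (v' := -transportOp c q t (y t)) (isInvertible_metricForm (mem_target (hq t ht)))).2 rfl
      simp only [hv t ht]
      exact h

/-- Away from `t₁` the concatenation is locally one of the two fields; at `t₁` the two one-sided
statements are joined by `IsParallelWithinAt.union`. -/
lemma IsParallelAlong.extend {c : ℝ → TangentBundle 𝓘(ℝ, E) M}
    {t₁ t₂ : ℝ} (h₁ : 0 ≤ t₁) (h₁₂ : t₁ ≤ t₂) {v v' : ∀ t, TangentSpace 𝓘(ℝ, E) (c t).proj}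
    (hv : IsParallelAlong c v (Icc 0 t₁)) (hv' : IsParallelAlong c v' (Icc t₁ t₂))
    (heq : v' t₁ = v t₁) :
    IsParallelAlong c (fun t => if t ≤ t₁ then v t else v' t) (Icc 0 t₂) := by
  intro t ht p hp
  rcases lt_trichotomy t t₁ with hlt | rfl | hlt
  · refine (hv t ⟨ht.1, hlt.le⟩ p hp).congr ?_ ?_ ?_ rfl
    · filter_upwards [mem_nhdsWithin_of_mem_nhds (Iio_mem_nhds hlt), self_mem_nhdsWithin]
        with r hr hr' using ⟨hr'.1, le_of_lt hr⟩
    · filter_upwards [mem_nhdsWithin_of_mem_nhds (Iio_mem_nhds hlt)] with r hr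
      rw [if_pos (le_of_lt hr)]
    · simp only [if_pos hlt.le]
  · rw [← Icc_union_Icc_eq_Icc h₁ h₁₂]
    refine IsParallelWithinAt.union hp ?_ ?_
    · refine (hv t ⟨h₁, le_rfl⟩ p hp).congr self_mem_nhdsWithin ?_ ?_ rfl
      · filter_upwards [self_mem_nhdsWithin] with r hr
        rw [if_pos hr.2]
      · simp only [if_pos le_rfl]
    · refine (hv' t ⟨le_rfl, h₁₂⟩ p hp).congr self_mem_nhdsWithin ?_ ?_ rfl
      · filter_upwards [self_mem_nhdsWithin] with r hr
        split_ifs with h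
        · obtain rfl : r = t := le_antisymm h hr.1
          rw [heq]
        · rfl
      · simp only [if_pos le_rfl, heq]
  · refine (hv' t ⟨hlt.le, ht.2⟩ p hp).congr ?_ ?_ ?_ rfl
    · filter_upwards [mem_nhdsWithin_of_mem_nhds (Ioi_mem_nhds hlt), self_mem_nhdsWithin]
        with r hr hr' using ⟨le_of_lt hr, hr'.2⟩
    · filter_upwards [mem_nhdsWithin_of_mem_nhds (Ioi_mem_nhds hlt)] with r hr
      rw [if_neg (not_le.2 hr)]
    · simp only [if_neg (not_le.2 hlt)]

/-- Near `t` the curve stays in one chart and the operator is bounded by continuity. Shrinking `δ`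
to at most `1 / (4K)` makes every interval inside the window short enough for `exists_linear_ode`.
-/
lemma exists_chart_window {c : ℝ → TangentBundle 𝓘(ℝ, E) M} (hc : IsGeodesic c) {t : ℝ}
    (ht : t ∈ Icc (0 : ℝ) 1) : ∃ q : M, ∃ K δ : ℝ, 0 < δ ∧ 0 ≤ K ∧ K * (2 * δ) ≤ 1 / 2 ∧
      ∀ r ∈ Icc (0 : ℝ) 1, |r - t| < δ →
        (c r).proj ∈ (chartAt E q).source ∧ ‖transportOp c q r‖ ≤ K := by
  set q := (c t).proj
  have hq : (c t).proj ∈ (chartAt E q).source := mem_chart_source E _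
  have h1 : ∀ᶠ r in 𝓝[Icc 0 1] t, (c r).proj ∈ (chartAt E q).source :=
    (continuousOn_proj hc.1.1 t ht).preimage_mem_nhdsWithin ((chartAt E q).open_source.mem_nhds hq)
  have h2 : ∀ᶠ r in 𝓝[Icc 0 1] t, ‖transportOp c q r‖ < ‖transportOp c q t‖ + 1 :=
    (continuousWithinAt_transportOp (hc.1.1 t ht) hq).norm.eventually_lt_const (lt_add_one _)
  obtain ⟨δ, hδ, h⟩ := Metric.mem_nhdsWithin_iff.1 (h1.and h2)
  set K := ‖transportOp c q t‖ + 1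
  have hK : 0 < K := by positivity
  refine ⟨q, K, min δ (1 / (4 * K)), by positivity, hK.le, ?_, fun r hr hrt => ?_⟩
  · calc K * (2 * min δ (1 / (4 * K))) ≤ K * (2 * (1 / (4 * K))) := by
          gcongr; exact min_le_right _ _
      _ = 1 / 2 := by field_simp; norm_num
  · have hrt' : dist r t < δ := hrt.trans_le (min_le_left _ _)
    have := h ⟨hrt', hr⟩
    exact ⟨this.1, this.2.le⟩

/-- Parallel fields along a geodesic with prescribed initial value exist. -/
theorem exists_isParallel {c : ℝ → TangentBundle 𝓘(ℝ, E) M} (hc : IsGeodesic c)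
    (v₀ : TangentSpace 𝓘(ℝ, E) (c 0).proj) :
    ∃ v : ∀ t, TangentSpace 𝓘(ℝ, E) (c t).proj, v 0 = v₀ ∧
      IsParallel (fun t => (⟨(c t).proj, v t⟩ : TangentBundle 𝓘(ℝ, E) M)) := by
  have : Nonempty M := ⟨(c 0).proj⟩
  choose! q K δ hδ hK hKδ hw using fun t ht => exists_chart_window hc (t := t) ht
  -- A finite subdivision of `[0, 1]` with each piece in one window; the field is extended piece by
  -- piece.
  obtain ⟨τ, hτ0, hτm, ⟨m, hm⟩, hτ⟩ := exists_monotone_Icc_subset_open_cover_Icc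
    (zero_le_one' ℝ) (c := fun i : Icc (0 : ℝ) 1 => Metric.ball i (δ i))
    (fun i => Metric.isOpen_ball) (fun i _ => mem_iUnion.2 ⟨i, Metric.mem_ball_self (hδ i i.2)⟩)
  have hstep : ∀ k : ℕ, ∃ v : ∀ t, TangentSpace 𝓘(ℝ, E) (c t).proj, v 0 = v₀ ∧
      IsParallelAlong c v (Icc 0 (τ k : ℝ)) := by
    intro k
    induction k with
    | zero =>
      obtain ⟨v, hv, hv'⟩ := exists_isParallelAlong_chart hc (le_refl (0 : ℝ))
        (Icc_subset_Icc le_rfl zero_le_one) (q := q 0) (K := K 0)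
        (fun t ht => (hw 0 (by simp) t (by simp_all) (by
          rw [Icc_self, mem_singleton_iff] at ht; simp [ht, hδ 0])).1)
        (fun t ht => (hw 0 (by simp) t (by simp_all) (by
          rw [Icc_self, mem_singleton_iff] at ht; simp [ht, hδ 0])).2) (by simp) v₀
      exact ⟨v, hv, by rwa [hτ0]⟩
    | succ k ih =>
      obtain ⟨v, hv, hv'⟩ := ih
      obtain ⟨i, hi⟩ := hτ k
      have hle : (τ k : ℝ) ≤ τ (k + 1) := hτm k.le_succ
      have hsub : Icc (τ k : ℝ) (τ (k + 1)) ⊆ Icc 0 1 := Icc_subset_Icc (τ k).2.1 (τ (k + 1)).2.2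
      have hball : ∀ t ∈ Icc (τ k : ℝ) (τ (k + 1)), |t - i| < δ i := fun t ht =>
        hi (show (⟨t, hsub ht⟩ : Icc (0 : ℝ) 1) ∈ Icc (τ k) (τ (k + 1)) from ht)
      obtain ⟨v', hv1, hv2⟩ := exists_isParallelAlong_chart hc hle hsub (q := q i) (K := K i)
        (fun t ht => (hw i i.2 t (hsub ht) (hball t ht)).1)
        (fun t ht => (hw i i.2 t (hsub ht) (hball t ht)).2)
        ((mul_le_mul_of_nonneg_left (by
          have h1 := abs_lt.1 (hball _ (left_mem_Icc.2 hle))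
          have h2 := abs_lt.1 (hball _ (right_mem_Icc.2 hle))
          linarith [h1.1, h2.2]) (hK i i.2)).trans (hKδ i i.2)) (v (τ k))
      refine ⟨_, ?_, hv'.extend (τ k).2.1 hle hv2 hv1⟩
      simp only [if_pos (τ k).2.1, hv]
  obtain ⟨v, hv, hv'⟩ := hstep m
  rw [hm m le_rfl] at hv'
  refine ⟨v, hv, isParallel_iff.2 ⟨fun t ht => ?_, fun t ht p hp => ⟨_, hv' t ht p hp⟩⟩⟩
  obtain ⟨-, y, hy, -⟩ := hv' t ht (c t).proj (mem_chart_source E _)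
  exact continuousWithinAt_tangent (continuousOn_proj hc.1.1 t ht) hy.continuousWithinAt

end Existence

/-! ### Regularity, rescaling and length of geodesics. -/

section Geodesics

variable {E : Type*} [NormedAddCommGroup E] [NormedSpace ℝ E] [FiniteDimensional ℝ E]
  {M : Type*} [MetricSpace M] [ChartedSpace E M] [IsManifold 𝓘(ℝ, E) ∞ M]
  [RiemannianBundle (fun x : M => TangentSpace 𝓘(ℝ, E) x)]

/-- In a chart the derivative of the base curve is `tangentCoord p (c r)`, which is continuous
because `c` is continuous into the tangent bundle. -/
lemma IsGeodesic.contMDiffOn {c : ℝ → TangentBundle 𝓘(ℝ, E) M} (hc : IsGeodesic c) :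
    ContMDiffOn 𝓘(ℝ, ℝ) 𝓘(ℝ, E) 1 (fun t => (c t).proj) (Icc 0 1) := by
  intro t ht
  have hcont := continuousOn_proj hc.1.1
  rw [contMDiffWithinAt_iff_target]
  refine ⟨hcont t ht, ?_⟩
  rw [contMDiffWithinAt_iff_contDiffWithinAt]
  set p := (c t).proj
  have hev : {r | (c r).proj ∈ (chartAt E p).source} ∈ 𝓝[Icc 0 1] t :=
    (hcont t ht).preimage_mem_nhdsWithin
      ((chartAt E p).open_source.mem_nhds (mem_chart_source E p))
  have hins : insert t (Icc (0 : ℝ) 1) = Icc 0 1 := insert_eq_of_mem ht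
  refine (contDiffWithinAt_succ_iff_hasFDerivWithinAt' (n := 0) (by simp)).2
    ⟨Icc 0 1 ∩ {r | (c r).proj ∈ (chartAt E p).source}, ?_, ?_, by simp,
      fun r => ContinuousLinearMap.toSpanSingleton ℝ (tangentCoord p (c r)), ?_, ?_⟩
  · rw [hins]
    exact Filter.inter_mem self_mem_nhdsWithin hev
  · rw [hins]; exact inter_subset_left
  · rintro r ⟨hr, hr'⟩
    exact (hc.2 r hr p hr').hasFDerivWithinAt
  · rw [contDiffWithinAt_zero ht]
    refine ⟨_, hev, ?_⟩
    have h1 : ContinuousOn (fun r => tangentCoord p (c r))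
        (Icc 0 1 ∩ {r | (c r).proj ∈ (chartAt E p).source}) :=
      (continuousOn_tangentCoord p).comp (hc.1.1.mono inter_subset_left) fun r hr => hr.2
    exact (ContinuousLinearMap.toSpanSingletonCLE (𝕜 := ℝ) (E := E)).continuous.comp_continuousOn h1

lemma IsGeodesic.mfderivWithin_eq {c : ℝ → TangentBundle 𝓘(ℝ, E) M} (hc : IsGeodesic c) {a b : ℝ}
    (hab : a < b) (hs : Icc a b ⊆ Icc 0 1) {t : ℝ} (ht : t ∈ Icc a b) :
    mfderivWithin 𝓘(ℝ, ℝ) 𝓘(ℝ, E) (fun t => (c t).proj) (Icc a b) t (1 : ℝ) = (c t).2 := by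
  set p := (c t).proj
  have hp : (c t).proj ∈ (chartAt E p).source := mem_chart_source E _
  have hmd : MDifferentiableWithinAt 𝓘(ℝ, ℝ) 𝓘(ℝ, E) (fun t => (c t).proj) (Icc a b) t :=
    ((hc.contMDiffOn.mono hs) t ht).mdifferentiableWithinAt one_ne_zero
  have hu : UniqueMDiffWithinAt 𝓘(ℝ, ℝ) (Icc a b) t :=
    (uniqueDiffOn_Icc hab t ht).uniqueMDiffWithinAt
  have h := mfderiv_comp_mfderivWithin t (mdifferentiableAt_extChartAt (I := 𝓘(ℝ, E)) hp) hmd hu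
  rw [mfderivWithin_eq_fderivWithin] at h
  have h1 := congrArg (fun f => f (1 : ℝ)) h
  have h2 := ((hc.2 t (hs ht) p hp).mono hs).hasFDerivWithinAt.fderivWithin
    (uniqueDiffOn_Icc hab t ht)
  have h3 : tangentCoord p (c t) = tangentCoord p ⟨(c t).proj,
      mfderivWithin 𝓘(ℝ, ℝ) 𝓘(ℝ, E) (fun t => (c t).proj) (Icc a b) t (1 : ℝ)⟩ := by
    refine Eq.trans ?_ h1
    change _ = fderivWithin ℝ (fun s => extChartAt 𝓘(ℝ, E) p (c s).proj) (Icc a b) t 1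
    rw [h2]
    simp
  refine (sub_eq_zero.1 ((inner_self_eq_zero (𝕜 := ℝ)).1 ?_)).symm
  rw [← metricForm_tangentCoord hp, tangentCoord_sub, ← h3]
  exact (congrArg _ (sub_self _)).trans (map_zero _)

variable [IsContMDiffRiemannianBundle 𝓘(ℝ, E) ∞ E (fun x : M => TangentSpace 𝓘(ℝ, E) x)]

/-- Both terms of the transport equation are multiplied by `a * τ`. The factor `a` is free because
the velocity of a rescaled geodesic needs `a = τ`, while a field restricted to an initial segment
needs `a = 1`. -/
lemma isParallel_rescale {W : ℝ → TangentBundle 𝓘(ℝ, E) M} (hW : IsParallel W) {τ : ℝ}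
    (hτ : τ ∈ Icc (0 : ℝ) 1) (a : ℝ) : IsParallel fun s =>
      (⟨(W (s * τ)).proj, a • (W (s * τ)).2⟩ : TangentBundle 𝓘(ℝ, E) M) := by
  have hmaps : MapsTo (fun s => s * τ) (Icc (0 : ℝ) 1) (Icc 0 1) := fun s hs =>
    ⟨mul_nonneg hs.1 hτ.1, mul_le_one₀ hs.2 hτ.1 hτ.2⟩
  have hd : ∀ s, HasDerivWithinAt (fun s => s * τ) τ (Icc (0 : ℝ) 1) s := fun s => by
    simpa using (hasDerivWithinAt_id s (Icc (0 : ℝ) 1)).mul_const τ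
  rw [isParallel_iff] at hW ⊢
  have hd' : ∀ t ∈ Icc (0 : ℝ) 1, ∀ p : M, (W (t * τ)).proj ∈ (chartAt E p).source →
      ∃ X, IsParallelWithinAt (fun s => (⟨(W (s * τ)).proj, a • (W (s * τ)).2⟩ :
        TangentBundle 𝓘(ℝ, E) M)) (Icc 0 1) t p X := by
    intro t ht p hp
    obtain ⟨X, h1, v', h2, h3⟩ := hW.2 _ (hmaps ht) p hp
    refine ⟨τ • X, ?_, a • τ • v', ?_, fun w => ?_⟩
    · rw [tangentCoord_smul]
      exact h1.scomp t (hd t) hmaps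
    · simp only [tangentCoord_smul]
      exact (h2.scomp t (hd t) hmaps).const_smul a
    · simp only [tangentCoord_smul, map_smul, smul_apply]
      have := h3 w
      simp only [smul_eq_mul]
      linear_combination (a * τ) * this
  refine ⟨fun t ht => continuousWithinAt_tangent ?_ ?_, hd'⟩
  · exact (continuousOn_proj hW.1).comp (by fun_prop) hmaps t ht
  · obtain ⟨X, -, v', h, -⟩ := hd' t ht (W (t * τ)).proj (mem_chart_source E _)
    exact h.continuousWithinAt

lemma isGeodesic_rescale {c : ℝ → TangentBundle 𝓘(ℝ, E) M} (hc : IsGeodesic c) {τ : ℝ}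
    (hτ : τ ∈ Icc (0 : ℝ) 1) : IsGeodesic fun s =>
      (⟨(c (s * τ)).proj, τ • (c (s * τ)).2⟩ : TangentBundle 𝓘(ℝ, E) M) := by
  refine ⟨isParallel_rescale hc.1 hτ τ, fun t ht p hp => ?_⟩
  have hmaps : MapsTo (fun s => s * τ) (Icc (0 : ℝ) 1) (Icc 0 1) := fun s hs =>
    ⟨mul_nonneg hs.1 hτ.1, mul_le_one₀ hs.2 hτ.1 hτ.2⟩
  have hd : HasDerivWithinAt (fun s => s * τ) τ (Icc (0 : ℝ) 1) t := by
    simpa using (hasDerivWithinAt_id t (Icc (0 : ℝ) 1)).mul_const τ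
  rw [tangentCoord_smul]
  exact (hc.2 _ (hmaps ht) p hp).scomp t hd hmaps

variable [IsRiemannianManifold 𝓘(ℝ, E) M]

lemma IsGeodesic.dist_le {c : ℝ → TangentBundle 𝓘(ℝ, E) M} (hc : IsGeodesic c) {ℓ : ℝ}
    (hℓ : ∀ t ∈ Icc (0 : ℝ) 1, ‖(c t).2‖ = ℓ) {a b : ℝ} (hab : a ≤ b) (hs : Icc a b ⊆ Icc 0 1) :
    dist (c a).proj (c b).proj ≤ (b - a) * ℓ := by
  rcases hab.eq_or_lt with rfl | hlt
  · simp
  have hℓ0 : 0 ≤ ℓ := hℓ a (hs (left_mem_Icc.2 hab)) ▸ norm_nonneg _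
  have h := Manifold.riemannianEDist_le_pathELength (hc.contMDiffOn.mono hs) rfl rfl hab
  rw [← IsRiemannianManifold.out (I := 𝓘(ℝ, E)),
    Manifold.pathELength_eq_lintegral_mfderivWithin_Icc] at h
  have h2 : ∫⁻ t in Icc a b, ‖mfderivWithin 𝓘(ℝ, ℝ) 𝓘(ℝ, E) (fun t => (c t).proj) (Icc a b) t
      (1 : ℝ)‖ₑ = ∫⁻ _t in Icc a b, ENNReal.ofReal ℓ := by
    refine setLIntegral_congr_fun measurableSet_Icc fun t ht => ?_
    rw [hc.mfderivWithin_eq hlt hs ht, ← ofReal_norm, hℓ t (hs ht)]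
  have h3 := h.trans_eq h2
  rw [setLIntegral_const, Real.volume_Icc, ← ENNReal.ofReal_mul hℓ0, edist_dist,
    ENNReal.ofReal_le_ofReal_iff (mul_nonneg hℓ0 (sub_nonneg.2 hab))] at h3
  linarith

/-- The two arcs cut at `t` have lengths `t d` and `(1 - t) d` with `d = dist x z`. These bound the
distances of their endpoints, and the triangle inequality forces equality. -/
lemma IsMinGeodesic.dist_eq {x z : M} {c : ℝ → TangentBundle 𝓘(ℝ, E) M} (hc : IsMinGeodesic x z c)
    {t : ℝ} (ht : t ∈ Icc (0 : ℝ) 1) : dist x (c t).proj = t * dist x z := by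
  obtain ⟨hg, h0, h1, hs⟩ := hc
  have ha := hg.dist_le hs ht.1 (Icc_subset_Icc le_rfl ht.2)
  have hb := hg.dist_le hs ht.2 (Icc_subset_Icc ht.1 le_rfl)
  have := dist_triangle x (c t).proj z
  rw [h0] at ha
  rw [h1] at hb
  linarith

lemma IsMinGeodesic.rescale {x z : M} {c : ℝ → TangentBundle 𝓘(ℝ, E) M} (hc : IsMinGeodesic x z c)
    {τ : ℝ} (hτ : τ ∈ Icc (0 : ℝ) 1) : IsMinGeodesic x (c τ).proj fun s =>
      (⟨(c (s * τ)).proj, τ • (c (s * τ)).2⟩ : TangentBundle 𝓘(ℝ, E) M) := by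
  refine ⟨isGeodesic_rescale hc.1 hτ, by simp [hc.2.1], by simp, fun t ht => ?_⟩
  rw [norm_smul, hc.dist_eq hτ, hc.2.2.2 _ ⟨mul_nonneg ht.1 hτ.1, mul_le_one₀ ht.2 hτ.1 hτ.2⟩,
    Real.norm_of_nonneg hτ.1]

end Geodesics

/-! ### Inverse exponential map and parallel transport on a geodesically convex set. -/

section Convex

variable {E : Type*} [NormedAddCommGroup E] [NormedSpace ℝ E] [FiniteDimensional ℝ E]
  {M : Type*} [MetricSpace M] [ChartedSpace E M] [IsManifold 𝓘(ℝ, E) ∞ M]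
  [RiemannianBundle (fun x : M => TangentSpace 𝓘(ℝ, E) x)]
  {𝒳 : Set M}

lemma exists_mk_eq {x : M} (Z : TangentBundle 𝓘(ℝ, E) M) (h : Z.proj = x) :
    ∃ w : TangentSpace 𝓘(ℝ, E) x, (⟨x, w⟩ : TangentBundle 𝓘(ℝ, E) M) = Z := by
  subst h
  exact ⟨Z.2, rfl⟩

/-- Puts parallel fields over literally the same base curve, so that their values lie in the same
fibres and can be compared. -/
lemma exists_section {W : ℝ → TangentBundle 𝓘(ℝ, E) M} (hW : IsParallel W) {b : ℝ → M}
    (hb : ∀ t ∈ Icc (0 : ℝ) 1, (W t).proj = b t) :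
    ∃ w : ∀ t, TangentSpace 𝓘(ℝ, E) (b t),
      IsParallel (fun t => (⟨b t, w t⟩ : TangentBundle 𝓘(ℝ, E) M)) ∧
      ∀ t ∈ Icc (0 : ℝ) 1, ⟨b t, w t⟩ = W t := by
  have hex : ∀ t, ∃ w : TangentSpace 𝓘(ℝ, E) (b t),
      t ∈ Icc (0 : ℝ) 1 → (⟨b t, w⟩ : TangentBundle 𝓘(ℝ, E) M) = W t := by
    intro t
    by_cases ht : t ∈ Icc (0 : ℝ) 1
    · obtain ⟨w, hw⟩ := exists_mk_eq (W t) (hb t ht)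
      exact ⟨w, fun _ => hw⟩
    · exact ⟨0, fun h => absurd h ht⟩
  choose w hw using hex
  exact ⟨w, hW.congr fun t ht => hw t ht, hw⟩

lemma IsMinGeodesic.eqOn (h𝒳 : GeodesicallyConvex E 𝒳) {x y : M} (hx : x ∈ 𝒳) (hy : y ∈ 𝒳)
    {c c' : ℝ → TangentBundle 𝓘(ℝ, E) M} (hc : IsMinGeodesic x y c) (hc' : IsMinGeodesic x y c') :
    EqOn c' c (Icc 0 1) := by
  obtain ⟨c₀, -, -, h⟩ := h𝒳 x hx y hy
  exact (h c' hc').trans (h c hc).symm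

lemma IsMinGeodesic.proj_mem (h𝒳 : GeodesicallyConvex E 𝒳) {x y : M} (hx : x ∈ 𝒳) (hy : y ∈ 𝒳)
    {c : ℝ → TangentBundle 𝓘(ℝ, E) M} (hc : IsMinGeodesic x y c) {t : ℝ} (ht : t ∈ Icc (0 : ℝ) 1) :
    (c t).proj ∈ 𝒳 := by
  obtain ⟨c₀, -, h1, h2⟩ := h𝒳 x hx y hy
  rw [h2 c hc ht]
  exact h1 t ht

lemma mk_logMap (h𝒳 : GeodesicallyConvex E 𝒳) {x y : M} (hx : x ∈ 𝒳) (hy : y ∈ 𝒳)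
    {c : ℝ → TangentBundle 𝓘(ℝ, E) M} (hc : IsMinGeodesic x y c) :
    (⟨x, logMap E x y⟩ : TangentBundle 𝓘(ℝ, E) M) = c 0 := by
  have h : ∃ v : TangentSpace 𝓘(ℝ, E) x,
      ∃ c : ℝ → TangentBundle 𝓘(ℝ, E) M, IsMinGeodesic x y c ∧ c 0 = ⟨x, v⟩ := by
    obtain ⟨w, hw⟩ := exists_mk_eq (c 0) hc.2.1
    exact ⟨w, c, hc, hw.symm⟩
  obtain ⟨c', hc', h0⟩ := h.choose_spec
  rw [logMap, dif_pos h, ← h0]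
  exact hc.eqOn h𝒳 hx hy hc' (by simp)

lemma norm_logMap (h𝒳 : GeodesicallyConvex E 𝒳) {x y : M} (hx : x ∈ 𝒳) (hy : y ∈ 𝒳) :
    ‖logMap E x y‖ = dist x y := by
  obtain ⟨c, hc, -⟩ := h𝒳 x hx y hy
  have h := mk_logMap h𝒳 hx hy hc
  have h2 := hc.2.2.2 0 (by simp)
  rwa [← h] at h2

variable [IsContMDiffRiemannianBundle 𝓘(ℝ, E) ∞ E (fun x : M => TangentSpace 𝓘(ℝ, E) x)]

/-- Expanding `‖v t - w t‖²` gives inner products of parallel fields, which keep their values at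
time 0. No uniqueness theorem for the ODE is involved. -/
lemma eq_of_isParallel {b : ℝ → M} {v w : ∀ t, TangentSpace 𝓘(ℝ, E) (b t)}
    (hv : IsParallel fun t => (⟨b t, v t⟩ : TangentBundle 𝓘(ℝ, E) M))
    (hw : IsParallel fun t => (⟨b t, w t⟩ : TangentBundle 𝓘(ℝ, E) M)) (h0 : v 0 = w 0)
    {t : ℝ} (ht : t ∈ Icc (0 : ℝ) 1) : v t = w t := by
  refine sub_eq_zero.1 ((inner_self_eq_zero (𝕜 := ℝ)).1 ?_)
  rw [inner_sub_left, inner_sub_right, inner_sub_right, inner_const_of_isParallel hv hv ht,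
    inner_const_of_isParallel hv hw ht, inner_const_of_isParallel hw hv ht,
    inner_const_of_isParallel hw hw ht, h0]
  ring

/-- `parallelTransport` is computed by any parallel field along the minimizing geodesic. -/
lemma mk_parallelTransport (h𝒳 : GeodesicallyConvex E 𝒳) {x y : M} (hx : x ∈ 𝒳) (hy : y ∈ 𝒳)
    {c W : ℝ → TangentBundle 𝓘(ℝ, E) M} (hc : IsMinGeodesic x y c) (hW : IsParallel W)
    (hWc : ∀ t ∈ Icc (0 : ℝ) 1, (W t).proj = (c t).proj) {v : TangentSpace 𝓘(ℝ, E) x}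
    (h0 : W 0 = ⟨x, v⟩) :
    (⟨y, parallelTransport x y v⟩ : TangentBundle 𝓘(ℝ, E) M) = W 1 := by
  have h : ∃ w : TangentSpace 𝓘(ℝ, E) y, ∃ c W : ℝ → TangentBundle 𝓘(ℝ, E) M,
      IsMinGeodesic x y c ∧ IsParallel W ∧ (∀ t ∈ Icc (0 : ℝ) 1, (W t).proj = (c t).proj) ∧
      W 0 = ⟨x, v⟩ ∧ W 1 = ⟨y, w⟩ := by
    obtain ⟨w, hw⟩ := exists_mk_eq (W 1) ((hWc 1 (by simp)).trans hc.2.2.1)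
    exact ⟨w, c, W, hc, hW, hWc, h0, hw.symm⟩
  obtain ⟨c', W', hc', hW', hWc', h0', h1'⟩ := h.choose_spec
  rw [parallelTransport, dif_pos h, ← h1']
  have hWc'' : ∀ t ∈ Icc (0 : ℝ) 1, (W' t).proj = (c t).proj := fun t ht => by
    rw [hWc' t ht, hc.eqOn h𝒳 hx hy hc' ht]
  obtain ⟨w, hw, hwW⟩ := exists_section hW hWc
  obtain ⟨w', hw', hwW'⟩ := exists_section hW' hWc''
  rw [← hwW 1 (by simp), ← hwW' 1 (by simp)]
  have h00 : (⟨(c 0).proj, w' 0⟩ : TangentBundle 𝓘(ℝ, E) M) = ⟨(c 0).proj, w 0⟩ := by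
    rw [hwW 0 (by simp), hwW' 0 (by simp), h0, h0']
  rw [eq_of_isParallel hw' hw (by simpa using h00) (by simp : (1 : ℝ) ∈ Icc (0 : ℝ) 1)]

lemma exists_mk_parallelTransport (h𝒳 : GeodesicallyConvex E 𝒳) {x y : M} (hx : x ∈ 𝒳)
    (hy : y ∈ 𝒳) {c : ℝ → TangentBundle 𝓘(ℝ, E) M} (hc : IsMinGeodesic x y c)
    (v : TangentSpace 𝓘(ℝ, E) x) : ∃ w : ∀ t, TangentSpace 𝓘(ℝ, E) (c t).proj,
      IsParallel (fun t => (⟨(c t).proj, w t⟩ : TangentBundle 𝓘(ℝ, E) M)) ∧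
      (⟨(c 0).proj, w 0⟩ : TangentBundle 𝓘(ℝ, E) M) = ⟨x, v⟩ ∧
      (⟨(c 1).proj, w 1⟩ : TangentBundle 𝓘(ℝ, E) M) = ⟨y, parallelTransport x y v⟩ := by
  obtain ⟨w₀, hw₀⟩ := exists_mk_eq (⟨x, v⟩ : TangentBundle 𝓘(ℝ, E) M) hc.2.1.symm
  obtain ⟨w, hw, hw'⟩ := exists_isParallel hc.1 w₀
  refine ⟨w, hw', by rw [hw, hw₀], ?_⟩
  exact (mk_parallelTransport h𝒳 hx hy hc hw' (fun t _ => rfl) (by rw [hw, hw₀])).symm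

lemma inner_parallelTransport (h𝒳 : GeodesicallyConvex E 𝒳) {x y : M} (hx : x ∈ 𝒳) (hy : y ∈ 𝒳)
    (v w : TangentSpace 𝓘(ℝ, E) x) :
    (inner ℝ (parallelTransport x y v) (parallelTransport x y w) : ℝ) = inner ℝ v w := by
  obtain ⟨c, hc, -⟩ := h𝒳 x hx y hy
  obtain ⟨v', hv', hv0, hv1⟩ := exists_mk_parallelTransport h𝒳 hx hy hc v
  obtain ⟨w', hw', hw0, hw1⟩ := exists_mk_parallelTransport h𝒳 hx hy hc w
  have h := inner_const_of_isParallel hv' hw' (by simp : (1 : ℝ) ∈ Icc (0 : ℝ) 1)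
  obtain rfl := hc.2.1
  obtain rfl := hc.2.2.1
  rw [TotalSpace.mk_inj] at hv0 hv1 hw0 hw1
  rw [← hv1, ← hw1, ← hv0, ← hw0]
  exact h

/-- Parallel transport along minimizing geodesics of a geodesically convex set, as a linear
isometry. -/
def transportIsometry (h𝒳 : GeodesicallyConvex E 𝒳) {x y : M} (hx : x ∈ 𝒳) (hy : y ∈ 𝒳) :
    TangentSpace 𝓘(ℝ, E) x →ₗᵢ[ℝ] TangentSpace 𝓘(ℝ, E) y :=
  LinearMap.isometryOfInner
    { toFun := parallelTransport x y
      map_add' := fun v w => by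
        have h := inner_parallelTransport h𝒳 hx hy
        -- A map that preserves inner products is additive: the squared norm of the defect expands
        -- to zero.
        refine sub_eq_zero.1 ((inner_self_eq_zero (𝕜 := ℝ)).1 ?_)
        simp only [inner_sub_left, inner_sub_right, inner_add_left, inner_add_right, h]
        ring
      map_smul' := fun a v => by
        have h := inner_parallelTransport h𝒳 hx hy
        refine sub_eq_zero.1 ((inner_self_eq_zero (𝕜 := ℝ)).1 ?_)
        simp only [inner_sub_left, inner_sub_right, inner_smul_left, inner_smul_right, h,
          RingHom.id_apply]
        ring }
    (inner_parallelTransport h𝒳 hx hy)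

lemma transportIsometry_apply (h𝒳 : GeodesicallyConvex E 𝒳) {x y : M} (hx : x ∈ 𝒳) (hy : y ∈ 𝒳)
    (v : TangentSpace 𝓘(ℝ, E) x) : transportIsometry h𝒳 hx hy v = parallelTransport x y v := rfl

end Convex

/-! ### Taylor estimate along minimizing geodesics. -/

section Descent

variable {E : Type*} [NormedAddCommGroup E] [NormedSpace ℝ E] [FiniteDimensional ℝ E]
  {M : Type*} [MetricSpace M] [ChartedSpace E M] [IsManifold 𝓘(ℝ, E) ∞ M]
  [RiemannianBundle (fun x : M => TangentSpace 𝓘(ℝ, E) x)]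
  {𝒳 : Set M}

lemma inner_rgrad (f : M → ℝ) (x : M) (v : TangentSpace 𝓘(ℝ, E) x) :
    (inner ℝ (rgrad E f x) v : ℝ) = mfderiv 𝓘(ℝ, E) 𝓘(ℝ, ℝ) f x v := by
  unfold rgrad
  exact InnerProductSpace.toDual_symm_apply

lemma IsGeodesic.hasDerivWithinAt_comp {c : ℝ → TangentBundle 𝓘(ℝ, E) M} (hc : IsGeodesic c)
    {f : M → ℝ} (hf : MDifferentiable 𝓘(ℝ, E) 𝓘(ℝ, ℝ) f) {t : ℝ} (ht : t ∈ Icc (0 : ℝ) 1) :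
    HasDerivWithinAt (fun t => f (c t).proj) (inner ℝ (rgrad E f (c t).proj) (c t).2)
      (Icc 0 1) t := by
  have hmd : MDifferentiableWithinAt 𝓘(ℝ, ℝ) 𝓘(ℝ, E) (fun t => (c t).proj) (Icc 0 1) t :=
    (hc.contMDiffOn t ht).mdifferentiableWithinAt one_ne_zero
  have h := (hf (c t).proj).hasMFDerivAt.comp_hasMFDerivWithinAt t hmd.hasMFDerivWithinAt
  rw [hasMFDerivWithinAt_iff_hasFDerivWithinAt] at h
  have h2 := HasFDerivWithinAt.hasDerivWithinAt (𝕜 := ℝ) (F := ℝ) h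
  rw [inner_rgrad, ← hc.mfderivWithin_eq zero_lt_one le_rfl ht]
  exact h2

variable [IsContMDiffRiemannianBundle 𝓘(ℝ, E) ∞ E (fun x : M => TangentSpace 𝓘(ℝ, E) x)]
  [IsRiemannianManifold 𝓘(ℝ, E) M]

/-- The transported initial gradient and the velocity are both parallel, so their inner product at
time `t` is the one at time 0. What remains is the gradient at time `t` minus the transported one,
controlled by smoothness. -/
lemma abs_inner_rgrad_sub_le (h𝒳 : GeodesicallyConvex E 𝒳) {f : M → ℝ} {L : ℝ}
    (hf : IsLSmoothOn E 𝒳 L f) {x z : M} (hx : x ∈ 𝒳) (hz : z ∈ 𝒳)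
    {c : ℝ → TangentBundle 𝓘(ℝ, E) M} (hc : IsMinGeodesic x z c) {t : ℝ} (ht : t ∈ Icc (0 : ℝ) 1) :
    |(inner ℝ (rgrad E f (c t).proj) (c t).2 : ℝ) - inner ℝ (rgrad E f x) (logMap E x z)|
      ≤ L * t * dist x z ^ 2 := by
  obtain ⟨w, hw, hw0, -⟩ := exists_mk_parallelTransport h𝒳 hx hz hc (rgrad E f x)
  have hct := hc.proj_mem h𝒳 hx hz ht
  -- Transport to an intermediate point is read off the same field `w`: the initial segment,
  -- rescaled to `[0, 1]`, is itself a minimizing geodesic.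
  have h1 : parallelTransport x (c t).proj (rgrad E f x) = w t := by
    have h := mk_parallelTransport h𝒳 hx hct (hc.rescale ht) (isParallel_rescale hw ht 1)
      (fun s _ => rfl) (v := rgrad E f x) (by rw [zero_mul, one_smul, hw0])
    rw [one_smul, one_mul] at h
    exact TotalSpace.mk_injective _ h
  have h2 : (inner ℝ (w t) (c t).2 : ℝ) = inner ℝ (rgrad E f x) (logMap E x z) := by
    rw [inner_const_of_isParallel hw hc.1.1 ht]
    have hl := mk_logMap h𝒳 hx hz hc
    obtain rfl := hc.2.1
    rw [TotalSpace.mk_injective _ hl, TotalSpace.mk_injective _ hw0]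
  rw [← h2, ← h1, ← inner_sub_left]
  refine (abs_real_inner_le_norm _ _).trans ?_
  rw [hc.2.2.2 t ht]
  calc _ ≤ L * dist x (c t).proj * dist x z := by gcongr; exact hf.2 x hx _ hct
    _ = L * t * dist x z ^ 2 := by rw [hc.dist_eq ht]; ring

/-- First-order Taylor estimate along a minimizing geodesic. -/
theorem abs_sub_sub_le (h𝒳 : GeodesicallyConvex E 𝒳) {f : M → ℝ} {L : ℝ}
    (hf : IsLSmoothOn E 𝒳 L f) {x z : M} (hx : x ∈ 𝒳) (hz : z ∈ 𝒳)
    {c : ℝ → TangentBundle 𝓘(ℝ, E) M} (hc : IsMinGeodesic x z c) {t : ℝ} (ht : t ∈ Icc (0 : ℝ) 1) :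
    |f (c t).proj - f x - t * inner ℝ (rgrad E f x) (logMap E x z)|
      ≤ L * dist x z ^ 2 / 2 * t ^ 2 := by
  have hd : ∀ t ∈ Icc (0 : ℝ) 1, HasDerivWithinAt
      (fun t => f (c t).proj - f x - t * inner ℝ (rgrad E f x) (logMap E x z))
      (inner ℝ (rgrad E f (c t).proj) (c t).2 - inner ℝ (rgrad E f x) (logMap E x z))
      (Icc 0 1) t := fun t ht => by
    have := ((hc.1.hasDerivWithinAt_comp hf.1 ht).sub_const (f x)).sub
      ((hasDerivWithinAt_id t (Icc (0 : ℝ) 1)).mul_const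
        (inner ℝ (rgrad E f x) (logMap E x z) : ℝ))
    rwa [one_mul] at this
  have := image_norm_le_of_norm_deriv_right_le_deriv_boundary (a := 0) (b := 1)
    (f := fun t => f (c t).proj - f x - t * inner ℝ (rgrad E f x) (logMap E x z))
    (B := fun t => L * dist x z ^ 2 / 2 * t ^ 2)
    (B' := fun t => L * t * dist x z ^ 2)
    (fun t ht => (hd t ht).continuousWithinAt)
    (fun t ht => (hd t (Ico_subset_Icc_self ht)).mono_of_mem_nhdsWithin (Icc_mem_nhdsGE_of_mem ht))
    (by simp [hc.2.1]) (fun t => by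
      have h := (hasDerivAt_pow 2 t).const_mul (L * dist x z ^ 2 / 2)
      refine h.congr_deriv ?_
      push_cast; ring)
    (fun t ht => abs_inner_rgrad_sub_le h𝒳 hf hx hz hc (Ico_subset_Icc_self ht)) ht
  exact this

end Descent

/-! ### Measurability of the gradient error. -/

section Measurability

variable {E : Type*} [NormedAddCommGroup E] [NormedSpace ℝ E] [FiniteDimensional ℝ E]
  {M : Type*} [MetricSpace M] [ChartedSpace E M] [IsManifold 𝓘(ℝ, E) ∞ M]
  [RiemannianBundle (fun x : M => TangentSpace 𝓘(ℝ, E) x)]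

lemma fderiv_comp_symm_tangentCoord {Φ : M → ℝ} (hΦ : MDifferentiable 𝓘(ℝ, E) 𝓘(ℝ, ℝ) Φ) {p x : M}
    (hx : x ∈ (chartAt E p).source) (v : TangentSpace 𝓘(ℝ, E) x) :
    fderiv ℝ (Φ ∘ (extChartAt 𝓘(ℝ, E) p).symm) (extChartAt 𝓘(ℝ, E) p x) (tangentCoord p ⟨x, v⟩) =
      inner ℝ (rgrad E Φ x) v := by
  obtain ⟨e, he, rfl⟩ := exists_symm_eq hx
  rw [(extChartAt 𝓘(ℝ, E) p).right_inv he, inner_rgrad]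
  conv_rhs => rw [← pushChart_tangentCoord p he v]
  rw [← mfderiv_eq_fderiv, mfderiv_comp (I' := 𝓘(ℝ, E)) _ (hΦ _)]
  · rfl
  · exact (mdifferentiableOn_extChartAt_symm (I := 𝓘(ℝ, E)) (x := p)).mdifferentiableAt
      ((isOpen_extChartAt_target p).mem_nhds he)

lemma tangentCoord_rgrad {Φ : M → ℝ} (hΦ : MDifferentiable 𝓘(ℝ, E) 𝓘(ℝ, ℝ) Φ) {p x : M}
    (hx : x ∈ (chartAt E p).source) :
    tangentCoord p ⟨x, rgrad E Φ x⟩ = (metricForm p (extChartAt 𝓘(ℝ, E) p x)).inverse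
      (fderiv ℝ (Φ ∘ (extChartAt 𝓘(ℝ, E) p).symm) (extChartAt 𝓘(ℝ, E) p x)) := by
  refine (inverse_metricForm_eq (mem_target hx) fun w => ?_).symm
  obtain ⟨v, rfl⟩ := exists_tangentCoord_eq hx w
  rw [metricForm_tangentCoord hx, fderiv_comp_symm_tangentCoord hΦ hx]

lemma norm_sub_rgrad_eq {Φ : M → ℝ} (hΦ : MDifferentiable 𝓘(ℝ, E) 𝓘(ℝ, ℝ) Φ) {p : M}
    {Z : TangentBundle 𝓘(ℝ, E) M} (hZ : Z.proj ∈ (chartAt E p).source) :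
    ‖Z.2 - rgrad E Φ Z.proj‖ =
      (fun q : E × E => √(metricForm p q.1 (q.2 - (metricForm p q.1).inverse
        (fderiv ℝ (Φ ∘ (extChartAt 𝓘(ℝ, E) p).symm) q.1)) (q.2 - (metricForm p q.1).inverse
        (fderiv ℝ (Φ ∘ (extChartAt 𝓘(ℝ, E) p).symm) q.1))))
      (extChartAt 𝓘(ℝ, E) p Z.proj, tangentCoord p Z) := by
  simp only
  rw [← tangentCoord_rgrad hΦ hZ, norm_eq_sqrt_real_inner, ← metricForm_tangentCoord hZ,
    tangentCoord_sub]

variable [IsContMDiffRiemannianBundle 𝓘(ℝ, E) ∞ E (fun x : M => TangentSpace 𝓘(ℝ, E) x)]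

/-- `Φ` is merely differentiable, so its gradient need not be continuous; but in a chart the
derivative of any function is Borel measurable. Extending the chart expressions by zero gives
globally measurable functions. -/
lemma exists_measurable_norm_sub_rgrad {Φ : M → ℝ} (hΦ : MDifferentiable 𝓘(ℝ, E) 𝓘(ℝ, ℝ) Φ)
    (p : M) : ∃ h : TangentBundle 𝓘(ℝ, E) M → ℝ,
      @Measurable _ _ (borel (TangentBundle 𝓘(ℝ, E) M)) _ h ∧
      ∀ Z : TangentBundle 𝓘(ℝ, E) M, Z.proj ∈ (chartAt E p).source →
        ‖Z.2 - rgrad E Φ Z.proj‖ = h Z := by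
  let : MeasurableSpace E := borel E
  have : BorelSpace E := ⟨rfl⟩
  let : MeasurableSpace (TangentBundle 𝓘(ℝ, E) M) := borel _
  have : BorelSpace (TangentBundle 𝓘(ℝ, E) M) := ⟨rfl⟩
  classical
  set T := (extChartAt 𝓘(ℝ, E) p).target
  have hT : IsOpen T := isOpen_extChartAt_target p
  have hG : Measurable (T.piecewise (metricForm p) 0) :=
    (contDiffOn_metricForm p).continuousOn.measurable_piecewise continuousOn_const hT.measurableSet
  have hI : Measurable (T.piecewise (fun e => (metricForm p e).inverse) 0) := by
    refine ContinuousOn.measurable_piecewise (fun e he => ?_) continuousOn_const hT.measurableSet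
    exact ((isInvertible_metricForm he).contDiffAt_map_inverse (n := 0)).continuousAt.comp_continuousWithinAt
      ((contDiffOn_metricForm p).continuousOn e he)
  set F : E → E →L[ℝ] ℝ := fderiv ℝ (Φ ∘ (extChartAt 𝓘(ℝ, E) p).symm)
  have hF : Measurable F := measurable_fderiv ℝ _
  have happ1 : Measurable fun q : ((E →L[ℝ] ℝ) →L[ℝ] E) × (E →L[ℝ] ℝ) => q.1 q.2 :=
    (continuous_fst.clm_apply continuous_snd).measurable
  have happ2 : Measurable fun q : (E →L[ℝ] E →L[ℝ] ℝ) × E => q.1 q.2 q.2 :=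
    ((continuous_fst.clm_apply continuous_snd).clm_apply continuous_snd).measurable
  have hR : Measurable fun e => T.piecewise (fun e => (metricForm p e).inverse) 0 e (F e) :=
    happ1.comp (hI.prodMk hF)
  have hΨ : Measurable fun q : E × E => √(T.piecewise (metricForm p) 0 q.1
      (q.2 - T.piecewise (fun e => (metricForm p e).inverse) 0 q.1 (F q.1))
      (q.2 - T.piecewise (fun e => (metricForm p e).inverse) 0 q.1 (F q.1))) :=
    (happ2.comp ((hG.comp measurable_fst).prodMk
      (measurable_snd.sub (hR.comp measurable_fst)))).sqrt
  set U := {Z : TangentBundle 𝓘(ℝ, E) M | Z.proj ∈ (chartAt E p).source}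
  have hproj : Continuous (TotalSpace.proj : TangentBundle 𝓘(ℝ, E) M → M) :=
    FiberBundle.continuous_proj E (TangentSpace 𝓘(ℝ, E) : M → Type _)
  have hU : MeasurableSet U := ((chartAt E p).open_source.preimage hproj).measurableSet
  have hκ : Measurable (U.piecewise (fun Z => (extChartAt 𝓘(ℝ, E) p Z.proj, tangentCoord p Z)) 0) := by
    refine ContinuousOn.measurable_piecewise (ContinuousOn.prodMk ?_ (continuousOn_tangentCoord p))
      continuousOn_const hU
    refine (continuousOn_extChartAt p).comp hproj.continuousOn fun Z hZ => ?_
    have hZ' : Z.proj ∈ (chartAt E p).source := hZ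
    simpa using hZ'
  refine ⟨_, hΨ.comp hκ, fun Z hZ => ?_⟩
  have hZ' : extChartAt 𝓘(ℝ, E) p Z.proj ∈ T := mem_target hZ
  rw [norm_sub_rgrad_eq hΦ hZ, Function.comp, piecewise_eq_of_mem U _ _ hZ]
  simp only [piecewise_eq_of_mem T _ _ hZ', F]

/-- The distance of a random tangent vector with base point in a compact set to the gradient of `Φ`
is measurable. -/
lemma measurable_norm_sub_rgrad {𝒳 : Set M} (h𝒳 : IsCompact 𝒳) {Φ : M → ℝ}
    (hΦ : MDifferentiable 𝓘(ℝ, E) 𝓘(ℝ, ℝ) Φ) {Ω : Type*} [MeasurableSpace Ω]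
    {x : Ω → M} {v : ∀ w, TangentSpace 𝓘(ℝ, E) (x w)} (hx : ∀ w, x w ∈ 𝒳)
    (hZ : @Measurable _ _ _ (borel (TangentBundle 𝓘(ℝ, E) M))
      fun w => (⟨x w, v w⟩ : TangentBundle 𝓘(ℝ, E) M)) :
    Measurable fun w => ‖v w - rgrad E Φ (x w)‖ := by
  let : MeasurableSpace (TangentBundle 𝓘(ℝ, E) M) := borel _
  have : BorelSpace (TangentBundle 𝓘(ℝ, E) M) := ⟨rfl⟩
  choose h hm heq using fun p : M => exists_measurable_norm_sub_rgrad hΦ p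
  -- Compactness leaves finitely many charts, so the preimage is a finite union of measurable sets.
  obtain ⟨t, -, ht⟩ := h𝒳.elim_nhds_subcover (fun p => (chartAt E p).source)
    fun p _ => (chartAt E p).open_source.mem_nhds (mem_chart_source E p)
  have hproj : Continuous (TotalSpace.proj : TangentBundle 𝓘(ℝ, E) M → M) :=
    FiberBundle.continuous_proj E (TangentSpace 𝓘(ℝ, E) : M → Type _)
  intro A hA
  have : (fun w => ‖v w - rgrad E Φ (x w)‖) ⁻¹' A = ⋃ p ∈ t,
      (fun w => (⟨x w, v w⟩ : TangentBundle 𝓘(ℝ, E) M)) ⁻¹'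
        ((TotalSpace.proj ⁻¹' (chartAt E p).source) ∩ h p ⁻¹' A) := by
    ext w
    simp only [mem_preimage, mem_iUnion, mem_inter_iff, exists_prop]
    constructor
    · intro hw
      obtain ⟨p, hp, hxp⟩ := mem_iUnion₂.1 (ht (hx w))
      exact ⟨p, hp, hxp, by rwa [← heq p ⟨x w, v w⟩ hxp]⟩
    · rintro ⟨p, -, hxp, hw⟩
      rwa [← heq p ⟨x w, v w⟩ hxp] at hw
  rw [this]
  exact t.measurableSet_biUnion fun p _ => hZ
    (((chartAt E p).open_source.preimage hproj).measurableSet.inter (hm p hA))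

end Measurability

/-! ### Second moments of averages of independent samples. -/

section Variance

variable {Ξ : Type*} [MeasurableSpace Ξ] {P : Measure Ξ} [IsProbabilityMeasure P]

lemma memLp_eval {f : Ξ → ℝ} (hf : MemLp f 2 P) (j : ℕ) :
    MemLp (fun s : ℕ → Ξ => f (s j)) 2 (Measure.infinitePi fun _ => P) :=
  hf.comp_measurePreserving (measurePreserving_eval_infinitePi (fun _ => P) j)

lemma integral_eval {H : Type*} [NormedAddCommGroup H] [NormedSpace ℝ H] {f : Ξ → H}
    (hf : AEStronglyMeasurable f P) (j : ℕ) :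
    ∫ s : ℕ → Ξ, f (s j) ∂(Measure.infinitePi fun _ => P) = ∫ ξ, f ξ ∂P := by
  have h := measurePreserving_eval_infinitePi (fun _ : ℕ => P) j
  conv_rhs => rw [← h.map_eq]
  rw [← h.map_eq] at hf
  exact (integral_map (φ := Function.eval j) (measurable_pi_apply j).aemeasurable hf).symm

lemma variance_sum_eval {f : Ξ → ℝ} (hf : MemLp f 2 P) (b : ℕ) :
    Var[fun s : ℕ → Ξ => ∑ j ∈ Finset.range b, f (s j); Measure.infinitePi fun _ => P] =
      b * Var[f; P] := by
  have hi : iIndepFun (fun (j : ℕ) (s : ℕ → Ξ) => hf.1.mk f (s j)) (Measure.infinitePi fun _ => P) :=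
    iIndepFun_infinitePi fun _ => hf.1.stronglyMeasurable_mk.measurable
  have hi' : iIndepFun (fun (j : ℕ) (s : ℕ → Ξ) => f (s j)) (Measure.infinitePi fun _ => P) :=
    hi.congr fun j => ((measurePreserving_eval_infinitePi (fun _ : ℕ => P)
      j).quasiMeasurePreserving.ae_eq hf.1.ae_eq_mk).symm
  have h := IndepFun.variance_sum (s := Finset.range b) (fun j _ => memLp_eval hf j)
    fun i _ j _ hij => hi'.indepFun hij
  have h2 : (fun s : ℕ → Ξ => ∑ j ∈ Finset.range b, f (s j)) =
      ∑ j ∈ Finset.range b, fun s : ℕ → Ξ => f (s j) := by ext; simp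
  rw [h2, h]
  have h3 (j : ℕ) : Var[fun s : ℕ → Ξ => f (s j); Measure.infinitePi fun _ => P] = Var[f; P] := by
    have hm := measurePreserving_eval_infinitePi (fun _ : ℕ => P) j
    have hf' := hf.1.aemeasurable
    conv_rhs => rw [← hm.map_eq]
    rw [← hm.map_eq] at hf'
    exact (variance_map hf' (measurable_pi_apply j).aemeasurable).symm
  simp [h3]

/-- Second moment equals variance plus squared mean. The mean is `a`, the variance is `Var f / b` by
independence, and `Var f` is at most the second moment of `f`. -/
lemma integral_average_add_sq {f : Ξ → ℝ} (hf : MemLp f 2 P) {b : ℕ} (hb : 0 < b) (a : ℝ) :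
    Integrable (fun s : ℕ → Ξ => ((b : ℝ)⁻¹ * ∑ j ∈ Finset.range b, f (s j) - ∫ ξ, f ξ ∂P + a) ^ 2)
      (Measure.infinitePi fun _ => P) ∧
    ∫ s : ℕ → Ξ, ((b : ℝ)⁻¹ * ∑ j ∈ Finset.range b, f (s j) - ∫ ξ, f ξ ∂P + a) ^ 2
      ∂(Measure.infinitePi fun _ => P) ≤ (∫ ξ, f ξ ^ 2 ∂P) / b + a ^ 2 := by
  have hb' : (b : ℝ) ≠ 0 := by positivity
  have hS : MemLp (fun s : ℕ → Ξ => ∑ j ∈ Finset.range b, f (s j)) 2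
      (Measure.infinitePi fun _ => P) := memLp_finsetSum _ fun j _ => memLp_eval hf j
  have hT : MemLp (fun s : ℕ → Ξ => (b : ℝ)⁻¹ * ∑ j ∈ Finset.range b, f (s j) +
      (a - ∫ ξ, f ξ ∂P)) 2 (Measure.infinitePi fun _ => P) :=
    (hS.const_mul _).add (memLp_const _)
  have heq : ∀ s : ℕ → Ξ, (b : ℝ)⁻¹ * ∑ j ∈ Finset.range b, f (s j) - ∫ ξ, f ξ ∂P + a =
      (b : ℝ)⁻¹ * ∑ j ∈ Finset.range b, f (s j) + (a - ∫ ξ, f ξ ∂P) := fun s => by ring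
  simp_rw [heq]
  refine ⟨hT.integrable_sq, ?_⟩
  have h1 := variance_eq_sub hT
  have hmean : ∫ s : ℕ → Ξ, ((b : ℝ)⁻¹ * ∑ j ∈ Finset.range b, f (s j) + (a - ∫ ξ, f ξ ∂P))
      ∂(Measure.infinitePi fun _ => P) = a := by
    rw [integral_add ((hS.const_mul _).integrable one_le_two) (integrable_const _),
      integral_const_mul, integral_finsetSum _ fun j _ => (memLp_eval hf j).integrable one_le_two]
    simp only [integral_eval hf.1, Finset.sum_const, Finset.card_range, nsmul_eq_mul,
      integral_const, probReal_univ, one_smul]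
    field_simp
    ring
  have hvar : Var[fun s : ℕ → Ξ => (b : ℝ)⁻¹ * ∑ j ∈ Finset.range b, f (s j) +
      (a - ∫ ξ, f ξ ∂P); Measure.infinitePi fun _ => P] = Var[f; P] / b := by
    rw [variance_add_const (hS.const_mul _).1, variance_const_mul, variance_sum_eval hf]
    field_simp
  have h2 := variance_le_expectation_sq (μ := P) hf.1
  rw [hvar, hmean] at h1
  simp only [Pi.pow_apply] at h1 h2
  have h3 : Var[f; P] / b ≤ (∫ ξ, f ξ ^ 2 ∂P) / b := by gcongr
  linarith

variable {H : Type*} [NormedAddCommGroup H] [InnerProductSpace ℝ H] [FiniteDimensional ℝ H]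

/-- The mean square error of a shifted average of `b` independent samples. -/
lemma lintegral_average_add_sq {Y : Ξ → H} (hY : Integrable Y P) {c : ℝ}
    (hc : ∀ᵐ ξ ∂P, ‖Y ξ‖ ≤ c) {b : ℕ} (hb : 0 < b) (a : H) :
    ∫⁻ s : ℕ → Ξ, ENNReal.ofReal
      (‖(b : ℝ)⁻¹ • ∑ j ∈ Finset.range b, Y (s j) - ∫ ξ, Y ξ ∂P + a‖ ^ 2)
      ∂(Measure.infinitePi fun _ => P) ≤ ENNReal.ofReal (c ^ 2 / b + ‖a‖ ^ 2) := by
  -- The scalar estimate is applied to each coordinate in an orthonormal basis, and the squares are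
  -- summed.
  set e := stdOrthonormalBasis ℝ H
  have hnorm (v : H) : ‖v‖ ^ 2 = ∑ i, (inner ℝ (e i) v : ℝ) ^ 2 := (e.sum_sq_inner_right v).symm
  have : CompleteSpace H := FiniteDimensional.complete ℝ H
  have hmem (i) : MemLp (fun ξ => (inner ℝ (e i) (Y ξ) : ℝ)) 2 P := by
    refine MemLp.of_bound (hY.1.const_inner) c ?_
    filter_upwards [hc] with ξ hξ
    refine (norm_inner_le_norm _ _).trans ?_
    rwa [e.orthonormal.1 i, one_mul]
  have hmean (i) : ∫ ξ, (inner ℝ (e i) (Y ξ) : ℝ) ∂P = inner ℝ (e i) (∫ ξ, Y ξ ∂P) :=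
    integral_inner hY _
  have h := fun i => integral_average_add_sq (hmem i) hb (inner ℝ (e i) a)
  have hpt (s : ℕ → Ξ) : ‖(b : ℝ)⁻¹ • ∑ j ∈ Finset.range b, Y (s j) - ∫ ξ, Y ξ ∂P + a‖ ^ 2 =
      ∑ i, ((b : ℝ)⁻¹ * ∑ j ∈ Finset.range b, (inner ℝ (e i) (Y (s j)) : ℝ) -
        ∫ ξ, (inner ℝ (e i) (Y ξ) : ℝ) ∂P + inner ℝ (e i) a) ^ 2 := by
    rw [hnorm]
    simp only [inner_add_right, inner_sub_right, inner_smul_right, inner_sum, hmean]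
  simp_rw [hpt]
  rw [← ofReal_integral_eq_lintegral_ofReal (integrable_finsetSum _ fun i _ => (h i).1)
    (ae_of_all _ fun s => Finset.sum_nonneg fun i _ => sq_nonneg _),
    integral_finsetSum _ fun i _ => (h i).1]
  refine ENNReal.ofReal_le_ofReal ((Finset.sum_le_sum fun i _ => (h i).2).trans ?_)
  rw [Finset.sum_add_distrib, ← hnorm, ← Finset.sum_div,
    ← integral_finsetSum _ fun i _ => (hmem i).integrable_sq]
  simp_rw [← hnorm]
  gcongr
  have hi : Integrable (fun ξ => ‖Y ξ‖ ^ 2) P := by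
    simp_rw [hnorm]
    exact integrable_finsetSum _ fun i _ => (hmem i).integrable_sq
  calc ∫ ξ, ‖Y ξ‖ ^ 2 ∂P ≤ ∫ _, c ^ 2 ∂P := by
        refine integral_mono_ae hi (integrable_const _) ?_
        filter_upwards [hc] with ξ hξ
        gcongr
    _ = c ^ 2 := by simp

end Variance

/-! ### Mean square error of batch gradients. -/

section Batch

variable {E : Type*} [NormedAddCommGroup E] [NormedSpace ℝ E] [FiniteDimensional ℝ E]
  {M : Type*} [MetricSpace M] [ChartedSpace E M] [IsManifold 𝓘(ℝ, E) ∞ M]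
  [RiemannianBundle (fun x : M => TangentSpace 𝓘(ℝ, E) x)]
  {Ξ : Type*}

lemma length_sampleBatch (b : ℕ) (s : ℕ → Ξ) : (sampleBatch b s).length = b := by
  simp [sampleBatch]

lemma batchGrad_sampleBatch (φ : Ξ → M → ℝ) (b : ℕ) (s : ℕ → Ξ) (x : M) :
    batchGrad E φ (sampleBatch b s) x =
      (b : ℝ)⁻¹ • ∑ j ∈ Finset.range b, rgrad E (φ (s j)) x := by
  rw [batchGrad, length_sampleBatch, sampleBatch, List.map_map]
  rfl

variable [MeasurableSpace Ξ] {P : Measure Ξ} [IsProbabilityMeasure P]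

lemma lintegral_batchGrad_sub {φ : Ξ → M → ℝ} {Φ : M → ℝ} {x : M}
    (hi : Integrable (fun ξ => rgrad E (φ ξ) x) P) (hm : ∫ ξ, rgrad E (φ ξ) x ∂P = rgrad E Φ x)
    {c : ℝ} (hc : ∀ᵐ ξ ∂P, ‖rgrad E (φ ξ) x‖ ≤ c) {b : ℕ} (hb : 0 < b) :
    ∫⁻ s : ℕ → Ξ, ENNReal.ofReal (‖batchGrad E φ (sampleBatch b s) x - rgrad E Φ x‖ ^ 2)
      ∂(Measure.infinitePi fun _ => P) ≤ ENNReal.ofReal (c ^ 2 / b) := by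
  have h := lintegral_average_add_sq hi hc hb (0 : TangentSpace 𝓘(ℝ, E) x)
  rw [hm] at h
  simpa only [batchGrad_sampleBatch, add_zero, norm_zero, ne_eq, OfNat.ofNat_ne_zero,
    not_false_eq_true, zero_pow] using h

variable [IsContMDiffRiemannianBundle 𝓘(ℝ, E) ∞ E (fun x : M => TangentSpace 𝓘(ℝ, E) x)]
  [IsRiemannianManifold 𝓘(ℝ, E) M]

/-- By linearity of transport, the error is the old error transported by an isometry, plus a centred
average of `grad φ_ξ(y) - Γ grad φ_ξ(x)`. Smoothness bounds each of these vectors by `L * dist x y`,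
and there is no cross term. -/
lemma lintegral_batchGrad_transport {𝒳 : Set M} (h𝒳 : GeodesicallyConvex E 𝒳)
    {φ : Ξ → M → ℝ} {Φ : M → ℝ} {L : ℝ} (hφ : ∀ᵐ ξ ∂P, IsLSmoothOn E 𝒳 L (φ ξ))
    (hm : ∀ x ∈ 𝒳, Integrable (fun ξ => rgrad E (φ ξ) x) P ∧
      ∫ ξ, rgrad E (φ ξ) x ∂P = rgrad E Φ x) {x y : M} (hx : x ∈ 𝒳) (hy : y ∈ 𝒳)
    (g : TangentSpace 𝓘(ℝ, E) x) {b : ℕ} (hb : 0 < b) :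
    ∫⁻ s : ℕ → Ξ, ENNReal.ofReal (‖batchGrad E φ (sampleBatch b s) y -
        parallelTransport x y (batchGrad E φ (sampleBatch b s) x - g) - rgrad E Φ y‖ ^ 2)
      ∂(Measure.infinitePi fun _ => P) ≤
    ENNReal.ofReal ((L * dist x y) ^ 2 / b + ‖g - rgrad E Φ x‖ ^ 2) := by
  set Γ := transportIsometry h𝒳 hx hy
  have hΓ : Integrable (fun ξ => Γ (rgrad E (φ ξ) x)) P :=
    Γ.toContinuousLinearMap.integrable_comp (hm x hx).1
  have hY := (hm y hy).1.sub hΓ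
  have hc : ∀ᵐ ξ ∂P, ‖rgrad E (φ ξ) y - Γ (rgrad E (φ ξ) x)‖ ≤ L * dist x y := by
    filter_upwards [hφ] with ξ hξ using hξ.2 x hx y hy
  have h := lintegral_average_add_sq hY hc hb (Γ (g - rgrad E Φ x))
  have hmean : ∫ ξ, (rgrad E (φ ξ) y - Γ (rgrad E (φ ξ) x)) ∂P =
      rgrad E Φ y - Γ (rgrad E Φ x) := by
    rw [integral_sub (hm y hy).1 hΓ, (hm y hy).2, ← (hm x hx).2]
    congr 1
    exact Γ.toContinuousLinearMap.integral_comp_comm (hm x hx).1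
  simp only [Pi.sub_apply] at h
  rw [hmean, Γ.norm_map] at h
  refine le_trans (le_of_eq ?_) h
  refine lintegral_congr fun s => ?_
  rw [batchGrad_sampleBatch, batchGrad_sampleBatch, ← transportIsometry_apply h𝒳 hx hy]
  congr 3
  simp only [Finset.sum_sub_distrib, smul_sub, map_sub, map_smul, map_sum, Γ]
  abel

end Batch

/-! ### Integration over fresh samples, conditionally on the past. -/

section Fresh

lemma lintegral_comp_prodMk_of_indepFun {Ω Ω' S : Type*} [MeasurableSpace Ω] [MeasurableSpace Ω']
    [MeasurableSpace S] {μ : Measure Ω} [IsProbabilityMeasure μ] {f : Ω → Ω'} {ξ : Ω → S}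
    (hf : Measurable f) (hξ : Measurable ξ) (h : IndepFun f ξ μ) {F : Ω' × S → ℝ≥0∞}
    (hF : Measurable F) :
    ∫⁻ w, F (f w, ξ w) ∂μ = ∫⁻ w, ∫⁻ s, F (f w, s) ∂(μ.map ξ) ∂μ := by
  have : IsProbabilityMeasure (μ.map ξ) := Measure.isProbabilityMeasure_map hξ.aemeasurable
  have h1 := (indepFun_iff_map_prod_eq_prod_map_map hf.aemeasurable hξ.aemeasurable).1 h
  rw [← lintegral_map (f := F) (g := fun w => (f w, ξ w)) hF (hf.prodMk hξ), h1,
    lintegral_prod _ hF.aemeasurable, lintegral_map hF.lintegral_prod_right' hf]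

lemma lintegral_comp_prodMk_of_indep {Ω S : Type*} {m mΩ : MeasurableSpace Ω} (hm : m ≤ mΩ)
    [MeasurableSpace S] {μ : Measure Ω} [IsProbabilityMeasure μ] {ξ : Ω → S}
    (hξ : Measurable ξ) (h : Indep (MeasurableSpace.comap ξ inferInstance) m μ) {F : Ω × S → ℝ≥0∞}
    (hF : @Measurable _ _ (@Prod.instMeasurableSpace _ _ m inferInstance) _ F) :
    ∫⁻ w, F (w, ξ w) ∂μ = ∫⁻ w, ∫⁻ s, F (w, s) ∂(μ.map ξ) ∂μ := by
  -- The past is the identity map into `Ω` equipped with the smaller σ-algebra `m`.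
  refine @lintegral_comp_prodMk_of_indepFun Ω Ω S mΩ m _ μ _ id ξ (measurable_id'' hm) hξ ?_ F hF
  refine (@IndepFun_iff_Indep Ω Ω S mΩ m _ id ξ μ).2 ?_
  rw [MeasurableSpace.comap_id]
  exact h.symm

end Fresh

/-! ### The error recursion along a run. -/

section Run

variable {E : Type*} [NormedAddCommGroup E] [NormedSpace ℝ E] [FiniteDimensional ℝ E]
  {M : Type*} [MetricSpace M] [ChartedSpace E M] [IsManifold 𝓘(ℝ, E) ∞ M]
  [RiemannianBundle (fun x : M => TangentSpace 𝓘(ℝ, E) x)]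
  [IsContMDiffRiemannianBundle 𝓘(ℝ, E) ∞ E (fun x : M => TangentSpace 𝓘(ℝ, E) x)]
  [IsRiemannianManifold 𝓘(ℝ, E) M]
  {Ξ Ω : Type*} [MeasurableSpace Ξ] [mΩ : MeasurableSpace Ω] {𝒳 : Set M} {x₀ : M}
  {φ : Ξ → M → ℝ} {P : Measure Ξ} {L : ℝ} {n : ℕ} {R : BatchRule Ξ}
  {μ : Measure Ω} {ℱ : Filtration ℕ mΩ} {x : ℕ → Ω → M}
  {g : ∀ k w, TangentSpace 𝓘(ℝ, E) (x k w)} {ξ : ℕ → ℕ → Ω → Ξ} {κ : Ω → Fin (n ^ 2)}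
  {Φ : M → ℝ}

lemma one_div_mem_Icc (n : ℕ) : 1 / (n : ℝ) ∈ Icc (0 : ℝ) 1 :=
  ⟨by positivity, by rcases n.eq_zero_or_pos with rfl | hn
                     · simp
                     · exact (div_le_one (by positivity)).2 (by exact_mod_cast hn)⟩

namespace IsSpiderRun

lemma mem (h : IsSpiderRun 𝒳 x₀ φ P L n R μ ℱ x g ξ κ) (h𝒳' : GeodesicallyConvex E 𝒳)
    (hx₀ : x₀ ∈ 𝒳) (w : Ω) : ∀ k ≤ n ^ 2, x k w ∈ 𝒳 := by
  intro k
  induction k with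
  | zero => intro _; rwa [h.init]
  | succ k ih =>
    intro hk
    obtain ⟨z, hz, -, c, hc, hxc⟩ := h.step k hk w
    rw [hxc]
    exact hc.proj_mem h𝒳' (ih (by lia)) hz (one_div_mem_Icc n)

lemma measurable_sample (h : IsSpiderRun 𝒳 x₀ φ P L n R μ ℱ x g ξ κ) {k : ℕ} (hk : k < n ^ 2) :
    Measurable[ℱ (k + 1)] fun w j => ξ k j w :=
  @measurable_pi_lambda _ _ _ (ℱ (k + 1)) _ _ fun j => h.sample_measurable k hk j

lemma map_sample (h : IsSpiderRun 𝒳 x₀ φ P L n R μ ℱ x g ξ κ) {k : ℕ} (hk : k < n ^ 2) :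
    μ.map (fun w j => ξ k j w) = Measure.infinitePi fun _ => P := by
  rw [(h.sample_iIndep k hk).map_fun_eq_infinitePi_map fun j =>
    (h.sample_measurable k hk j).mono (ℱ.le _) le_rfl]
  simp_rw [h.sample_law k hk]

lemma measurable_norm_estimate_sub (h : IsSpiderRun 𝒳 x₀ φ P L n R μ ℱ x g ξ κ)
    (h𝒳 : IsCompact 𝒳) (h𝒳' : GeodesicallyConvex E 𝒳) (hx₀ : x₀ ∈ 𝒳)
    (hΦ : MDifferentiable 𝓘(ℝ, E) 𝓘(ℝ, ℝ) Φ) {k : ℕ} (hk : k < n ^ 2) :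
    @Measurable (Ω × (ℕ → Ξ)) ℝ (@Prod.instMeasurableSpace _ _ (ℱ k) inferInstance) _
      fun q => ‖spiderEstimate φ L n R (fun k => x k q.1) (fun k => g k q.1) k q.2 -
        rgrad E Φ (x k q.1)‖ :=
  @measurable_norm_sub_rgrad E _ _ _ M _ _ _ _ _ 𝒳 h𝒳 Φ hΦ (Ω × (ℕ → Ξ))
    (@Prod.instMeasurableSpace _ _ (ℱ k) inferInstance) (fun q => x k q.1)
    (fun q => spiderEstimate φ L n R (fun k => x k q.1) (fun k => g k q.1) k q.2)
    (fun q => h.mem h𝒳' hx₀ q.1 k hk.le) (h.estimate_measurable k hk)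

lemma measurable_norm_sub (h : IsSpiderRun 𝒳 x₀ φ P L n R μ ℱ x g ξ κ)
    (h𝒳 : IsCompact 𝒳) (h𝒳' : GeodesicallyConvex E 𝒳) (hx₀ : x₀ ∈ 𝒳)
    (hΦ : MDifferentiable 𝓘(ℝ, E) 𝓘(ℝ, ℝ) Φ) {k : ℕ} (hk : k < n ^ 2) :
    Measurable[ℱ (k + 1)] fun w => ‖g k w - rgrad E Φ (x k w)‖ := by
  have h1 : @Measurable Ω (Ω × (ℕ → Ξ)) (ℱ (k + 1))
      (@Prod.instMeasurableSpace _ _ (ℱ k) inferInstance) fun w => (w, fun j => ξ k j w) :=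
    @Measurable.prodMk _ (ℱ (k + 1)) _ _ (ℱ k) _ _ _
      (measurable_id'' (ℱ.mono k.le_succ)) (h.measurable_sample hk)
  have h2 := (h.measurable_norm_estimate_sub h𝒳 h𝒳' hx₀ hΦ hk).comp h1
  convert h2 using 2 with w
  rw [Function.comp, h.estimate k hk w]

variable [IsProbabilityMeasure μ]

/-- Conditioning the estimation error of iteration `k` on the past. -/
lemma lintegral_error_eq (h : IsSpiderRun 𝒳 x₀ φ P L n R μ ℱ x g ξ κ)
    (h𝒳 : IsCompact 𝒳) (h𝒳' : GeodesicallyConvex E 𝒳) (hx₀ : x₀ ∈ 𝒳)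
    (hΦ : MDifferentiable 𝓘(ℝ, E) 𝓘(ℝ, ℝ) Φ) {k : ℕ} (hk : k < n ^ 2) (D : ℝ) :
    ∫⁻ w, ENNReal.ofReal (D ^ 2 * ‖g k w - rgrad E Φ (x k w)‖ ^ 2) ∂μ =
      ∫⁻ w, ∫⁻ s, ENNReal.ofReal (D ^ 2 * ‖spiderEstimate φ L n R (fun k => x k w)
        (fun k => g k w) k s - rgrad E Φ (x k w)‖ ^ 2) ∂(Measure.infinitePi fun _ => P) ∂μ := by
  have hm : ∀ r : ℝ → ℝ≥0∞, Measurable r → @Measurable (Ω × (ℕ → Ξ)) ℝ≥0∞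
      (@Prod.instMeasurableSpace _ _ (ℱ k) inferInstance) _ _ := fun r hr =>
    hr.comp (h.measurable_norm_estimate_sub h𝒳 h𝒳' hx₀ hΦ hk)
  have h1 := lintegral_comp_prodMk_of_indep (ℱ.le k)
    ((h.measurable_sample hk).mono (ℱ.le _) le_rfl) (h.sample_fresh k hk)
    (hm (fun r => ENNReal.ofReal (D ^ 2 * r ^ 2)) (by fun_prop))
  rw [h.map_sample hk] at h1
  refine Eq.trans (lintegral_congr fun w => ?_) h1
  simp only [Function.comp]
  rw [h.estimate k hk w]

/-- A restart costs `a`, and each later iteration of the epoch adds `D ^ 2 * b`. The weight `D ^ 2`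
stays inside the estimate because in the finite-sum rule `S₁` is proportional to the squared
diameter, so only the weighted error can be bounded uniformly for small diameters. -/
lemma lintegral_error_le (h : IsSpiderRun 𝒳 x₀ φ P L n R μ ℱ x g ξ κ)
    [IsProbabilityMeasure P]
    (h𝒳 : IsCompact 𝒳) (h𝒳' : GeodesicallyConvex E 𝒳) (hx₀ : x₀ ∈ 𝒳)
    (hΦ : MDifferentiable 𝓘(ℝ, E) 𝓘(ℝ, ℝ) Φ) (hn : 0 < n) {D a b : ℝ} (ha : 0 ≤ a) (hb : 0 ≤ b)
    (hfirst : ∀ x ∈ 𝒳, ∫⁻ s, ENNReal.ofReal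
      (D ^ 2 * ‖batchGrad E φ (R.first s) x - rgrad E Φ x‖ ^ 2) ∂(Measure.infinitePi fun _ => P) ≤
      ENNReal.ofReal a)
    (hinner : ∀ x ∈ 𝒳, ∀ y ∈ 𝒳, ∀ v : TangentSpace 𝓘(ℝ, E) x, ∫⁻ s, ENNReal.ofReal
      (‖batchGrad E φ (R.inner (2 * n * L ^ 2 * ‖logMap E x y‖ ^ 2 / (1 / (n : ℝ)) ^ 2) s) y -
        parallelTransport x y (batchGrad E φ (R.inner (2 * n * L ^ 2 * ‖logMap E x y‖ ^ 2 /
          (1 / (n : ℝ)) ^ 2) s) x - v) - rgrad E Φ y‖ ^ 2) ∂(Measure.infinitePi fun _ => P) ≤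
      ENNReal.ofReal (b + ‖v - rgrad E Φ x‖ ^ 2)) :
    ∀ k < n ^ 2, ∫⁻ w, ENNReal.ofReal (D ^ 2 * ‖g k w - rgrad E Φ (x k w)‖ ^ 2) ∂μ ≤
      ENNReal.ofReal (a + (k % n : ℕ) * (D ^ 2 * b)) := by
  have hrestart : ∀ k < n ^ 2, k % n = 0 →
      ∫⁻ w, ENNReal.ofReal (D ^ 2 * ‖g k w - rgrad E Φ (x k w)‖ ^ 2) ∂μ ≤
      ENNReal.ofReal (a + (k % n : ℕ) * (D ^ 2 * b)) := fun k hk h0 => by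
    rw [h.lintegral_error_eq h𝒳 h𝒳' hx₀ hΦ hk, h0, Nat.cast_zero, zero_mul, add_zero]
    calc _ ≤ ∫⁻ _, ENNReal.ofReal a ∂μ := lintegral_mono fun w => by
          refine le_trans (le_of_eq (lintegral_congr fun s => ?_))
            (hfirst _ (h.mem h𝒳' hx₀ w k hk.le))
          cases k <;> simp [spiderEstimate, batch, h0]
      _ = ENNReal.ofReal a := by simp
  intro k
  induction k with
  | zero => exact fun hk => hrestart 0 hk (Nat.zero_mod n)
  | succ k ih =>
    intro hk
    by_cases h0 : (k + 1) % n = 0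
    · exact hrestart _ hk h0
    have hmod : (k + 1) % n = k % n + 1 := by
      have h1 := Nat.mod_lt k hn
      have h2 : (k % n + 1) % n = (k + 1) % n := Nat.mod_add_mod k n 1
      rcases (Nat.succ_le_of_lt h1).lt_or_eq with h3 | h3
      · rw [← h2, Nat.mod_eq_of_lt h3]
      · exact absurd (by rw [← h2, show k % n + 1 = n from h3, Nat.mod_self]) h0
    rw [h.lintegral_error_eq h𝒳 h𝒳' hx₀ hΦ hk, hmod]
    calc _ ≤ ∫⁻ w, (ENNReal.ofReal (D ^ 2 * ‖g k w - rgrad E Φ (x k w)‖ ^ 2) +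
            ENNReal.ofReal (D ^ 2 * b)) ∂μ := lintegral_mono fun w => by
          have h1 := hinner _ (h.mem h𝒳' hx₀ w k (by lia)) _ (h.mem h𝒳' hx₀ w (k + 1) hk.le) (g k w)
          rw [← ENNReal.ofReal_add (by positivity) (by positivity),
            show D ^ 2 * ‖g k w - rgrad E Φ (x k w)‖ ^ 2 + D ^ 2 * b =
              D ^ 2 * (b + ‖g k w - rgrad E Φ (x k w)‖ ^ 2) by ring]
          simp_rw [ENNReal.ofReal_mul (sq_nonneg D)]
          rw [lintegral_const_mul' _ _ ENNReal.ofReal_ne_top]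
          gcongr
          refine le_trans (le_of_eq (lintegral_congr fun s => ?_)) h1
          simp [spiderEstimate, batch, h0]
      _ = ∫⁻ w, ENNReal.ofReal (D ^ 2 * ‖g k w - rgrad E Φ (x k w)‖ ^ 2) ∂μ +
            ENNReal.ofReal (D ^ 2 * b) := by
          rw [lintegral_add_right _ measurable_const]; simp
      _ ≤ ENNReal.ofReal (a + (k % n : ℕ) * (D ^ 2 * b)) + ENNReal.ofReal (D ^ 2 * b) := by
          gcongr; exact ih (by lia)
      _ = _ := by
          rw [← ENNReal.ofReal_add (by positivity) (by positivity)]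
          congr 1; push_cast; ring

end IsSpiderRun
end Run

/-! ### Progress of a single step. -/

section Gap

variable {E : Type*} [NormedAddCommGroup E] [NormedSpace ℝ E] [FiniteDimensional ℝ E]
  {M : Type*} [MetricSpace M] [ChartedSpace E M] [IsManifold 𝓘(ℝ, E) ∞ M]
  [RiemannianBundle (fun x : M => TangentSpace 𝓘(ℝ, E) x)]
  [IsContMDiffRiemannianBundle 𝓘(ℝ, E) ∞ E (fun x : M => TangentSpace 𝓘(ℝ, E) x)]
  [IsRiemannianManifold 𝓘(ℝ, E) M]
  {𝒳 : Set M} {Φ : M → ℝ} {L : ℝ}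

lemma logMap_self (h𝒳' : GeodesicallyConvex E 𝒳) {x : M} (hx : x ∈ 𝒳) : logMap E x x = 0 :=
  norm_eq_zero.1 (by rw [norm_logMap h𝒳' hx hx, dist_self])

lemma norm_logMap_le (h𝒳 : IsCompact 𝒳) (h𝒳' : GeodesicallyConvex E 𝒳) {x y : M} (hx : x ∈ 𝒳)
    (hy : y ∈ 𝒳) : ‖logMap E x y‖ ≤ Metric.diam 𝒳 := by
  rw [norm_logMap h𝒳' hx hy]
  exact Metric.dist_le_diam_of_mem h𝒳.isBounded hx hy

/-- Bounds the telescoped sum of decreases by a quantity that does not depend on the objective. -/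
lemma sub_le_of_isLSmoothOn (h𝒳 : IsCompact 𝒳) (h𝒳' : GeodesicallyConvex E 𝒳) (hL : 0 ≤ L)
    (hΦ : IsLSmoothOn E 𝒳 L Φ) {x y : M} (hx : x ∈ 𝒳) (hy : y ∈ 𝒳) {G : ℝ}
    (hG : ‖rgrad E Φ x‖ ≤ G) :
    Φ x - Φ y ≤ G * Metric.diam 𝒳 + L * Metric.diam 𝒳 ^ 2 / 2 := by
  obtain ⟨c, hc, -⟩ := h𝒳' x hx y hy
  have h1 := abs_le.1 (abs_sub_sub_le h𝒳' hΦ hx hy hc (by simp : (1 : ℝ) ∈ Icc (0 : ℝ) 1))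
  have h2 := abs_le.1 (abs_real_inner_le_norm (rgrad E Φ x) (logMap E x y))
  have h3 : ‖rgrad E Φ x‖ * ‖logMap E x y‖ ≤ G * Metric.diam 𝒳 := by
    gcongr
    · exact (norm_nonneg _).trans hG
    · exact norm_logMap_le h𝒳 h𝒳' hx hy
  have h4 : L * dist x y ^ 2 / 2 * 1 ^ 2 ≤ L * Metric.diam 𝒳 ^ 2 / 2 := by
    rw [one_pow, mul_one]
    gcongr
    exact Metric.dist_le_diam_of_mem h𝒳.isBounded hx hy
  rw [hc.2.2.1] at h1
  linarith [h1.1, h2.1]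

/-- The progress of one Frank-Wolfe step of size `1 / n` with an inexact gradient `v`. -/
lemma inner_logMap_le_of_step (h𝒳 : IsCompact 𝒳) (h𝒳' : GeodesicallyConvex E 𝒳) (hL : 0 ≤ L)
    (hΦ : IsLSmoothOn E 𝒳 L Φ) {n : ℕ} (hn : 0 < n) {x z : M} (hx : x ∈ 𝒳) (hz : z ∈ 𝒳)
    {v : TangentSpace 𝓘(ℝ, E) x}
    (hv : ∀ y ∈ 𝒳, (inner ℝ v (logMap E x z) : ℝ) ≤ inner ℝ v (logMap E x y))
    {c : ℝ → TangentBundle 𝓘(ℝ, E) M} (hc : IsMinGeodesic x z c) {y : M} (hy : y ∈ 𝒳) :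
    (inner ℝ (logMap E x y) (-rgrad E Φ x) : ℝ) ≤ n * (Φ x - Φ (c (1 / (n : ℝ))).proj) +
      n * (Metric.diam 𝒳 ^ 2 * ‖v - rgrad E Φ x‖ ^ 2) + (L * Metric.diam 𝒳 ^ 2 / 2 + 1) / n := by
  have hn' : (0 : ℝ) < n := by positivity
  set D := Metric.diam 𝒳
  have hD : 0 ≤ D := Metric.diam_nonneg
  have h1 := (abs_le.1 (abs_sub_sub_le h𝒳' hΦ hx hz hc (one_div_mem_Icc n))).2
  have h2 : L * dist x z ^ 2 / 2 * (1 / (n : ℝ)) ^ 2 ≤ L * D ^ 2 / 2 * (1 / (n : ℝ)) ^ 2 := by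
    gcongr
    exact Metric.dist_le_diam_of_mem h𝒳.isBounded hx hz
  -- Replacing the true gradient by `v` in the comparison of `z` with `y` costs this inner product.
  have h3 : (inner ℝ (v - rgrad E Φ x) (logMap E x y - logMap E x z) : ℝ) ≤
      ‖v - rgrad E Φ x‖ * (D + D) := (real_inner_le_norm _ _).trans (by
    gcongr
    exact (norm_sub_le _ _).trans
      (add_le_add (norm_logMap_le h𝒳 h𝒳' hx hy) (norm_logMap_le h𝒳 h𝒳' hx hz)))
  have h4 := hv y hy
  -- Young's inequality with weight `n`, which balances a squared error of order `1 / n ^ 2` against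
  -- `1 / n`.
  have h5 : ‖v - rgrad E Φ x‖ * (D + D) ≤ n * (D ^ 2 * ‖v - rgrad E Φ x‖ ^ 2) + 1 / n := by
    have : 0 ≤ (n * (D * ‖v - rgrad E Φ x‖) - 1) ^ 2 / n := by positivity
    have h6 : (n * (D * ‖v - rgrad E Φ x‖) - 1) ^ 2 / n =
        n * (D ^ 2 * ‖v - rgrad E Φ x‖ ^ 2) - ‖v - rgrad E Φ x‖ * (D + D) + 1 / n := by
      field_simp
      ring
    linarith
  have h7 : n * (Φ (c (1 / (n : ℝ))).proj - Φ x - 1 / n * inner ℝ (rgrad E Φ x) (logMap E x z)) ≤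
      n * (L * D ^ 2 / 2 * (1 / (n : ℝ)) ^ 2) := by gcongr; exact h1.trans h2
  have h8 : n * (L * D ^ 2 / 2 * (1 / (n : ℝ)) ^ 2) = L * D ^ 2 / 2 / n := by field_simp
  have h9 : n * (Φ (c (1 / (n : ℝ))).proj - Φ x - 1 / n * inner ℝ (rgrad E Φ x) (logMap E x z)) =
      n * (Φ (c (1 / (n : ℝ))).proj - Φ x) - inner ℝ (rgrad E Φ x) (logMap E x z) := by
    field_simp
  rw [h8, h9] at h7
  rw [inner_sub_left, inner_sub_right, inner_sub_right] at h3
  rw [inner_neg_right, real_inner_comm, add_div]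
  linarith

end Gap

/-! ### The expected gap at the random output. -/

section Run

variable {E : Type*} [NormedAddCommGroup E] [NormedSpace ℝ E] [FiniteDimensional ℝ E]
  {M : Type*} [MetricSpace M] [ChartedSpace E M] [IsManifold 𝓘(ℝ, E) ∞ M]
  [RiemannianBundle (fun x : M => TangentSpace 𝓘(ℝ, E) x)]
  [IsContMDiffRiemannianBundle 𝓘(ℝ, E) ∞ E (fun x : M => TangentSpace 𝓘(ℝ, E) x)]
  [IsRiemannianManifold 𝓘(ℝ, E) M]
  {Ξ Ω : Type*} [MeasurableSpace Ξ] [mΩ : MeasurableSpace Ω] {𝒳 : Set M} {x₀ : M}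
  {φ : Ξ → M → ℝ} {P : Measure Ξ} {L : ℝ} {n : ℕ} {R : BatchRule Ξ}
  {μ : Measure Ω} {ℱ : Filtration ℕ mΩ} {x : ℕ → Ω → M}
  {g : ∀ k w, TangentSpace 𝓘(ℝ, E) (x k w)} {ξ : ℕ → ℕ → Ω → Ξ} {κ : Ω → Fin (n ^ 2)}
  {Φ : M → ℝ}

namespace IsSpiderRun

/-- Nonnegativity of the bound is the case `y = x`; it allows sums to pass through `ENNReal.ofReal`.
-/
lemma fwGap_le (h : IsSpiderRun 𝒳 x₀ φ P L n R μ ℱ x g ξ κ)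
    (h𝒳 : IsCompact 𝒳) (h𝒳' : GeodesicallyConvex E 𝒳) (hx₀ : x₀ ∈ 𝒳) (hL : 0 ≤ L)
    (hΦ : IsLSmoothOn E 𝒳 L Φ) (hn : 0 < n) (w : Ω) {k : ℕ} (hk : k < n ^ 2) :
    0 ≤ n * (Φ (x k w) - Φ (x (k + 1) w)) +
      n * (Metric.diam 𝒳 ^ 2 * ‖g k w - rgrad E Φ (x k w)‖ ^ 2) +
      (L * Metric.diam 𝒳 ^ 2 / 2 + 1) / n ∧
    fwGap E 𝒳 Φ (x k w) ≤ n * (Φ (x k w) - Φ (x (k + 1) w)) +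
      n * (Metric.diam 𝒳 ^ 2 * ‖g k w - rgrad E Φ (x k w)‖ ^ 2) +
      (L * Metric.diam 𝒳 ^ 2 / 2 + 1) / n := by
  obtain ⟨z, hz, hmin, c, hc, hxc⟩ := h.step k hk w
  have hx := h.mem h𝒳' hx₀ w k hk.le
  have hb : ∀ y ∈ 𝒳, _ := fun y hy => inner_logMap_le_of_step h𝒳 h𝒳' hL hΦ hn hx hz hmin hc hy
  rw [hxc]
  constructor
  · have := hb _ hx
    rwa [logMap_self h𝒳' hx, inner_zero_left] at this
  · exact csSup_le ((nonempty_of_mem hx).image _) (by rintro _ ⟨y, hy, rfl⟩; exact hb y hy)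

variable [IsProbabilityMeasure μ]

/-- The expectation of a quantity at the output is the mean of its expectations. -/
lemma lintegral_output (h : IsSpiderRun 𝒳 x₀ φ P L n R μ ℱ x g ξ κ) {u : Fin (n ^ 2) → Ω → ℝ≥0∞}
    (hu : ∀ i, Measurable[ℱ (n ^ 2)] (u i)) :
    ∫⁻ w, u (κ w) w ∂μ = ∫⁻ w, (∑ i, u i w) * ((n : ℝ≥0∞) ^ 2)⁻¹ ∂μ := by
  have h1 := lintegral_comp_prodMk_of_indep (ℱ.le (n ^ 2)) h.output_measurable h.output_indep
    (F := fun q => u q.2 q.1)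
    (@measurable_from_prod_countable_left _ _ _ (ℱ (n ^ 2)) _ _ _ _ _ hu)
  refine h1.trans (lintegral_congr fun w => ?_)
  rw [lintegral_fintype, Finset.sum_mul]
  refine Finset.sum_congr rfl fun i _ => ?_
  rw [Measure.map_apply h.output_measurable (measurableSet_singleton i), h.output_law]

theorem lintegral_fwGap_le (h : IsSpiderRun 𝒳 x₀ φ P L n R μ ℱ x g ξ κ)
    (h𝒳 : IsCompact 𝒳) (h𝒳' : GeodesicallyConvex E 𝒳) (hx₀ : x₀ ∈ 𝒳) (hL : 0 ≤ L)
    (hΦ : IsLSmoothOn E 𝒳 L Φ) (hn : 0 < n) {G V : ℝ} (hG : ‖rgrad E Φ x₀‖ ≤ G) (hV : 0 ≤ V)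
    (herr : ∀ k < n ^ 2, ∫⁻ w, ENNReal.ofReal
      (Metric.diam 𝒳 ^ 2 * ‖g k w - rgrad E Φ (x k w)‖ ^ 2) ∂μ ≤ ENNReal.ofReal (V / n ^ 2)) :
    ∫⁻ w, ENNReal.ofReal (fwGap E 𝒳 Φ (x (κ w) w)) ∂μ ≤
      ENNReal.ofReal ((G * Metric.diam 𝒳 + L * Metric.diam 𝒳 ^ 2 + 1 + V) / n) := by
  set D := Metric.diam 𝒳
  have hn' : (0 : ℝ) < n := by positivity
  have hD : 0 ≤ D := Metric.diam_nonneg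
  have hG0 : 0 ≤ G := (norm_nonneg _).trans hG
  set e : ℕ → Ω → ℝ := fun k w => D ^ 2 * ‖g k w - rgrad E Φ (x k w)‖ ^ 2
  have he : ∀ k w, 0 ≤ e k w := fun k w => by positivity
  have hem : ∀ k < n ^ 2, Measurable[ℱ (k + 1)] (e k) := fun k hk =>
    ((h.measurable_norm_sub h𝒳 h𝒳' hx₀ hΦ.1 hk).pow_const 2).const_mul _
  -- A measurable majorant of the gap. The gap is replaced by it through monotonicity of the
  -- integral, so only `u` has to be measurable.
  set u : ℕ → Ω → ℝ := fun k w =>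
    n * (Φ (x k w) - Φ (x (k + 1) w)) + n * e k w + (L * D ^ 2 / 2 + 1) / n
  have hΦm : ∀ k ≤ n ^ 2, Measurable[ℱ (n ^ 2)] fun w => Φ (x k w) := fun k hk => by
    let : MeasurableSpace M := borel M
    have : BorelSpace M := ⟨rfl⟩
    exact hΦ.1.continuous.measurable.comp ((h.iterate_measurable k hk).mono (ℱ.mono hk) le_rfl)
  have hum : ∀ k < n ^ 2, Measurable[ℱ (n ^ 2)] (u k) := fun k hk =>
    ((((hΦm k hk.le).sub (hΦm (k + 1) hk)).const_mul _).add
      (((hem k hk).mono (ℱ.mono hk) le_rfl).const_mul _)).add_const _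
  have hsum : ∀ w, ∑ i : Fin (n ^ 2), u i w ≤
      n * (G * D + L * D ^ 2 + 1) + n * ∑ k ∈ Finset.range (n ^ 2), e k w := fun w => by
    rw [Fin.sum_univ_eq_sum_range (fun k => u k w)]
    simp only [u, Finset.sum_add_distrib, ← Finset.mul_sum, Finset.sum_range_sub',
      Finset.sum_const, Finset.card_range, nsmul_eq_mul]
    have h1 := sub_le_of_isLSmoothOn h𝒳 h𝒳' hL hΦ hx₀ (h.mem h𝒳' hx₀ w _ le_rfl) hG
    have h2 : n * (Φ (x 0 w) - Φ (x (n ^ 2) w)) ≤ n * (G * D + L * D ^ 2 / 2) := by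
      rw [h.init]
      gcongr
    have h3 : ((n ^ 2 : ℕ) : ℝ) * ((L * D ^ 2 / 2 + 1) / n) = n * (L * D ^ 2 / 2 + 1) := by
      push_cast
      field_simp
    rw [h3]
    linarith
  calc ∫⁻ w, ENNReal.ofReal (fwGap E 𝒳 Φ (x (κ w) w)) ∂μ
      ≤ ∫⁻ w, ENNReal.ofReal (u (κ w) w) ∂μ := lintegral_mono fun w =>
        ENNReal.ofReal_le_ofReal (h.fwGap_le h𝒳 h𝒳' hx₀ hL hΦ hn w (κ w).2).2
    _ = ∫⁻ w, (∑ i : Fin (n ^ 2), ENNReal.ofReal (u i w)) * ((n : ℝ≥0∞) ^ 2)⁻¹ ∂μ :=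
        h.lintegral_output (u := fun i w => ENNReal.ofReal (u i w))
          fun i => ENNReal.measurable_ofReal.comp (hum i i.2)
    _ ≤ ∫⁻ w, (ENNReal.ofReal (n * (G * D + L * D ^ 2 + 1)) +
          ENNReal.ofReal n * ∑ k ∈ Finset.range (n ^ 2), ENNReal.ofReal (e k w)) *
          ((n : ℝ≥0∞) ^ 2)⁻¹ ∂μ := lintegral_mono fun w => by
        beta_reduce
        rw [← ENNReal.ofReal_sum_of_nonneg fun i _ => (h.fwGap_le h𝒳 h𝒳' hx₀ hL hΦ hn w i.2).1,
          ← ENNReal.ofReal_sum_of_nonneg fun i _ => he i w, ← ENNReal.ofReal_mul (by positivity),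
          ← ENNReal.ofReal_add (by positivity)
            (mul_nonneg (by positivity) (Finset.sum_nonneg fun i _ => he i w))]
        gcongr
        exact hsum w
    _ = (ENNReal.ofReal (n * (G * D + L * D ^ 2 + 1)) + ENNReal.ofReal n *
          ∑ k ∈ Finset.range (n ^ 2), ∫⁻ w, ENNReal.ofReal (e k w) ∂μ) *
          ((n : ℝ≥0∞) ^ 2)⁻¹ := by
        rw [lintegral_mul_const' _ _ (by simp [hn.ne']), lintegral_add_left measurable_const,
          lintegral_const_mul' _ _ ENNReal.ofReal_ne_top, lintegral_finsetSum]
        · simp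
        · exact fun k hk => ENNReal.measurable_ofReal.comp
            ((hem k (Finset.mem_range.1 hk)).mono (ℱ.le _) le_rfl)
    _ ≤ (ENNReal.ofReal (n * (G * D + L * D ^ 2 + 1)) + ENNReal.ofReal n *
          ∑ k ∈ Finset.range (n ^ 2), ENNReal.ofReal (V / n ^ 2)) * ((n : ℝ≥0∞) ^ 2)⁻¹ := by
        gcongr with k hk
        exact herr k (Finset.mem_range.1 hk)
    _ = _ := by
        have h1 : ((n : ℝ≥0∞) ^ 2)⁻¹ = ENNReal.ofReal (((n : ℝ) ^ 2)⁻¹) := by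
          rw [ENNReal.ofReal_inv_of_pos (by positivity), ENNReal.ofReal_pow hn'.le,
            ENNReal.ofReal_natCast]
        rw [h1, ← ENNReal.ofReal_sum_of_nonneg fun _ _ => by positivity,
          ← ENNReal.ofReal_mul (by positivity), ← ENNReal.ofReal_add (by positivity)
            (mul_nonneg (by positivity) (Finset.sum_nonneg fun _ _ => by positivity)),
          ← ENNReal.ofReal_mul (by positivity)]
        congr 1
        simp only [Finset.sum_const, Finset.card_range, nsmul_eq_mul]
        push_cast
        field_simp

end IsSpiderRun
end Run

/-! ### Effect of the batch sizes on the error and on the cost. -/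

section Rules

variable {E : Type*} [NormedAddCommGroup E] [NormedSpace ℝ E] [FiniteDimensional ℝ E]
  {M : Type*} [MetricSpace M] [ChartedSpace E M] [IsManifold 𝓘(ℝ, E) ∞ M]
  [RiemannianBundle (fun x : M => TangentSpace 𝓘(ℝ, E) x)]
  [IsContMDiffRiemannianBundle 𝓘(ℝ, E) ∞ E (fun x : M => TangentSpace 𝓘(ℝ, E) x)]
  [IsRiemannianManifold 𝓘(ℝ, E) M]
  {𝒳 : Set M} {Φ : M → ℝ} {L : ℝ}

/-- The case of an empty inner batch. Smoothness at the pair `(x, x)` says that transport from `x`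
to itself fixes the gradient, and the isometry property does the rest. -/
lemma norm_zero_sub_transport (h𝒳' : GeodesicallyConvex E 𝒳) (hΦ : IsLSmoothOn E 𝒳 L Φ)
    {x : M} (hx : x ∈ 𝒳) (v : TangentSpace 𝓘(ℝ, E) x) :
    ‖0 - parallelTransport x x (0 - v) - rgrad E Φ x‖ = ‖v - rgrad E Φ x‖ := by
  have h1 := hΦ.2 x hx x hx
  rw [dist_self, mul_zero, norm_le_zero_iff, sub_eq_zero] at h1
  rw [← (transportIsometry h𝒳' hx hx).norm_map (v - rgrad E Φ x), map_sub,
    transportIsometry_apply, transportIsometry_apply, ← h1, zero_sub, zero_sub,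
    ← transportIsometry_apply h𝒳' hx hx, map_neg, neg_neg, transportIsometry_apply]

lemma norm_rgrad_sub_transport (h𝒳' : GeodesicallyConvex E 𝒳) {x y : M} (hx : x ∈ 𝒳) (hy : y ∈ 𝒳)
    (v : TangentSpace 𝓘(ℝ, E) x) :
    ‖rgrad E Φ y - parallelTransport x y (rgrad E Φ x - v) - rgrad E Φ y‖ =
      ‖v - rgrad E Φ x‖ := by
  rw [sub_right_comm, sub_self, zero_sub, norm_neg, ← transportIsometry_apply h𝒳' hx hy,
    LinearIsometry.norm_map, norm_sub_rev]

lemma ceil_pos_and_div_le {r c : ℝ} (hr : 0 < r) (hc : 0 ≤ c) :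
    0 < ⌈r⌉₊ ∧ c / (⌈r⌉₊ : ℝ) ≤ c / r :=
  ⟨Nat.ceil_pos.2 hr, div_le_div_of_nonneg_left hc hr (Nat.le_ceil r)⟩

variable {Ξ : Type*} [MeasurableSpace Ξ] {P : Measure Ξ} [IsProbabilityMeasure P]

/-- The batch size is at least `2 n³ L² d²` with `d = dist x y`, so `(L d)² / b ≤ 1 / (2 n³)`. When
`d = 0` the batch is empty and the error does not change. -/
lemma lintegral_sampleBatch_inner (h𝒳' : GeodesicallyConvex E 𝒳) (hL : 0 < L) {φ : Ξ → M → ℝ}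
    (hφ : ∀ᵐ ξ ∂P, IsLSmoothOn E 𝒳 L (φ ξ)) (hΦ : IsLSmoothOn E 𝒳 L Φ)
    (hm : ∀ x ∈ 𝒳, Integrable (fun ξ => rgrad E (φ ξ) x) P ∧
      ∫ ξ, rgrad E (φ ξ) x ∂P = rgrad E Φ x) {n : ℕ} (hn : 0 < n) {x y : M} (hx : x ∈ 𝒳)
    (hy : y ∈ 𝒳) (v : TangentSpace 𝓘(ℝ, E) x) {b : ℕ}
    (hb : b = ⌈2 * n * L ^ 2 * ‖logMap E x y‖ ^ 2 / (1 / (n : ℝ)) ^ 2⌉₊) :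
    ∫⁻ s : ℕ → Ξ, ENNReal.ofReal (‖batchGrad E φ (sampleBatch b s) y -
        parallelTransport x y (batchGrad E φ (sampleBatch b s) x - v) - rgrad E Φ y‖ ^ 2)
      ∂(Measure.infinitePi fun _ => P) ≤
    ENNReal.ofReal (1 / (2 * n ^ 3) + ‖v - rgrad E Φ x‖ ^ 2) := by
  have hn' : (0 : ℝ) < n := by positivity
  rcases eq_or_ne x y with rfl | hxy
  · rw [logMap_self h𝒳' hx] at hb
    obtain rfl : b = 0 := by simpa using hb
    have hz : ∀ s : ℕ → Ξ, batchGrad E φ (sampleBatch 0 s) x = 0 := fun s => by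
      simp [batchGrad, sampleBatch]
    simp_rw [hz, norm_zero_sub_transport h𝒳' hΦ hx]
    rw [lintegral_const, measure_univ, mul_one]
    gcongr
    exact le_add_of_nonneg_left (by positivity)
  · have hd : 0 < dist x y := dist_pos.2 hxy
    rw [norm_logMap h𝒳' hx hy] at hb
    obtain ⟨h1, h2⟩ := ceil_pos_and_div_le (c := (L * dist x y) ^ 2)
      (r := 2 * n * L ^ 2 * dist x y ^ 2 / (1 / (n : ℝ)) ^ 2) (by positivity) (by positivity)
    rw [← hb] at h1 h2
    refine (lintegral_batchGrad_transport h𝒳' hφ hm hx hy v h1).trans ?_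
    refine ENNReal.ofReal_le_ofReal (add_le_add (h2.trans (le_of_eq ?_)) le_rfl)
    field_simp

lemma lintegral_sampleBatch_first {φ : Ξ → M → ℝ} {x : M}
    (hm : Integrable (fun ξ => rgrad E (φ ξ) x) P ∧ ∫ ξ, rgrad E (φ ξ) x ∂P = rgrad E Φ x)
    {c : ℝ} (hc : ∀ᵐ ξ ∂P, ‖rgrad E (φ ξ) x‖ ≤ c) {D r a : ℝ} (hr : 0 < r)
    (ha : D ^ 2 * (c ^ 2 / r) ≤ a) :
    ∫⁻ s : ℕ → Ξ, ENNReal.ofReal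
      (D ^ 2 * ‖batchGrad E φ (sampleBatch ⌈r⌉₊ s) x - rgrad E Φ x‖ ^ 2)
      ∂(Measure.infinitePi fun _ => P) ≤ ENNReal.ofReal a := by
  obtain ⟨h1, h2⟩ := ceil_pos_and_div_le hr (sq_nonneg c)
  simp_rw [ENNReal.ofReal_mul (sq_nonneg D)]
  rw [lintegral_const_mul' _ _ ENNReal.ofReal_ne_top]
  calc _ ≤ ENNReal.ofReal (D ^ 2) * ENNReal.ofReal (c ^ 2 / r) := by
        gcongr
        exact (lintegral_batchGrad_sub hm.1 hm.2 hc h1).trans (ENNReal.ofReal_le_ofReal h2)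
    _ ≤ _ := by
        rw [← ENNReal.ofReal_mul (sq_nonneg D)]
        exact ENNReal.ofReal_le_ofReal ha

lemma norm_rgrad_le {φ : Ξ → M → ℝ} {x : M}
    (hm : ∫ ξ, rgrad E (φ ξ) x ∂P = rgrad E Φ x) {c : ℝ} (hc : ∀ᵐ ξ ∂P, ‖rgrad E (φ ξ) x‖ ≤ c) :
    ‖rgrad E Φ x‖ ≤ |c| := by
  rw [← hm]
  refine (norm_integral_le_of_norm_le_const hc).trans ?_
  rw [probReal_univ, mul_one]
  exact le_abs_self c

lemma lintegral_stochasticRule_first {φ : Ξ → M → ℝ} {n : ℕ} (hn : 0 < n) {x : M}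
    (hm : Integrable (fun ξ => rgrad E (φ ξ) x) P ∧ ∫ ξ, rgrad E (φ ξ) x ∂P = rgrad E Φ x)
    {C : ℝ} (hC : ∀ᵐ ξ ∂P, ‖rgrad E (φ ξ) x‖ ≤ C) (D : ℝ) :
    ∫⁻ s, ENNReal.ofReal
      (D ^ 2 * ‖batchGrad E φ ((stochasticRule Ξ C n).first s) x - rgrad E Φ x‖ ^ 2)
      ∂(Measure.infinitePi fun _ => P) ≤ ENNReal.ofReal (D ^ 2 / 2 / n ^ 2) := by
  -- For `C = 0` the batch is empty and its gradient is zero by convention, but so is the true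
  -- gradient.
  rcases eq_or_ne C 0 with rfl | hC0
  · have h0 : rgrad E Φ x = 0 := norm_le_zero_iff.1 (by simpa using norm_rgrad_le hm.2 hC)
    simp [stochasticRule, sampleBatch, batchGrad, h0]
  · refine lintegral_sampleBatch_first hm hC (by positivity) (le_of_eq ?_)
    field_simp

variable {Ω : Type*} [mΩ : MeasurableSpace Ω] {x₀ : M}
  {φ : Ξ → M → ℝ} {n : ℕ} {R : BatchRule Ξ}
  {μ : Measure Ω} {ℱ : Filtration ℕ mΩ} {x : ℕ → Ω → M}
  {g : ∀ k w, TangentSpace 𝓘(ℝ, E) (x k w)} {ξ : ℕ → ℕ → Ω → Ξ} {κ : Ω → Fin (n ^ 2)}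

namespace IsSpiderRun

/-- Fewer than `n` inner iterations follow a restart, each adding `D² / (2n³)`; this is the extra
`D² / 2` next to `V`. -/
lemma lintegral_fwGap_le_of_batch [IsProbabilityMeasure μ]
    (h : IsSpiderRun 𝒳 x₀ φ P L n R μ ℱ x g ξ κ)
    (h𝒳 : IsCompact 𝒳) (h𝒳' : GeodesicallyConvex E 𝒳) (hx₀ : x₀ ∈ 𝒳) (hL : 0 ≤ L)
    (hΦ : IsLSmoothOn E 𝒳 L Φ) (hn : 0 < n) {G V : ℝ} (hG : ‖rgrad E Φ x₀‖ ≤ G) (hV : 0 ≤ V)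
    (hfirst : ∀ x ∈ 𝒳, ∫⁻ s, ENNReal.ofReal
      (Metric.diam 𝒳 ^ 2 * ‖batchGrad E φ (R.first s) x - rgrad E Φ x‖ ^ 2)
        ∂(Measure.infinitePi fun _ => P) ≤ ENNReal.ofReal (V / n ^ 2))
    (hinner : ∀ x ∈ 𝒳, ∀ y ∈ 𝒳, ∀ v : TangentSpace 𝓘(ℝ, E) x, ∫⁻ s, ENNReal.ofReal
      (‖batchGrad E φ (R.inner (2 * n * L ^ 2 * ‖logMap E x y‖ ^ 2 / (1 / (n : ℝ)) ^ 2) s) y -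
        parallelTransport x y (batchGrad E φ (R.inner (2 * n * L ^ 2 * ‖logMap E x y‖ ^ 2 /
          (1 / (n : ℝ)) ^ 2) s) x - v) - rgrad E Φ y‖ ^ 2) ∂(Measure.infinitePi fun _ => P) ≤
      ENNReal.ofReal (1 / (2 * n ^ 3) + ‖v - rgrad E Φ x‖ ^ 2)) :
    ∫⁻ w, ENNReal.ofReal (fwGap E 𝒳 Φ (x (κ w) w)) ∂μ ≤ ENNReal.ofReal
      ((G * Metric.diam 𝒳 + L * Metric.diam 𝒳 ^ 2 + 1 + (V + Metric.diam 𝒳 ^ 2 / 2)) / n) := by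
  refine h.lintegral_fwGap_le h𝒳 h𝒳' hx₀ hL hΦ hn hG (by positivity) fun k hk => ?_
  refine (h.lintegral_error_le h𝒳 h𝒳' hx₀ hΦ.1 hn (a := V / n ^ 2) (b := 1 / (2 * n ^ 3))
    (by positivity) (by positivity) hfirst hinner k hk).trans ?_
  gcongr
  have hk' : ((k % n : ℕ) : ℝ) ≤ n := by exact_mod_cast (Nat.mod_lt k hn).le
  calc V / n ^ 2 + ((k % n : ℕ) : ℝ) * (Metric.diam 𝒳 ^ 2 * (1 / (2 * n ^ 3)))
      ≤ V / n ^ 2 + n * (Metric.diam 𝒳 ^ 2 * (1 / (2 * n ^ 3))) := by gcongr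
    _ = _ := by
      have : (0 : ℝ) < n := by positivity
      field_simp

lemma dist_succ_le (h : IsSpiderRun 𝒳 x₀ φ P L n R μ ℱ x g ξ κ)
    (h𝒳 : IsCompact 𝒳) (h𝒳' : GeodesicallyConvex E 𝒳) (hx₀ : x₀ ∈ 𝒳) (w : Ω) {k : ℕ}
    (hk : k < n ^ 2) : dist (x k w) (x (k + 1) w) ≤ Metric.diam 𝒳 / n := by
  obtain ⟨z, hz, -, c, hc, hxc⟩ := h.step k hk w
  rw [hxc, hc.dist_eq (one_div_mem_Icc n), one_div_mul_eq_div]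
  gcongr
  exact Metric.dist_le_diam_of_mem h𝒳.isBounded (h.mem h𝒳' hx₀ w k hk.le) hz

end IsSpiderRun

lemma sum_ite_mod (n p a : ℕ) (hn : 0 < n) :
    ∑ k ∈ Finset.range (a * n), (if k % n = 0 then p else 0) = a * p := by
  induction a with
  | zero => simp
  | succ a ih =>
    rw [add_mul, one_mul, Finset.sum_range_add, ih, add_mul, one_mul, Finset.sum_eq_single 0]
    · simp
    · intro j hj hj0
      rw [Nat.mul_add_mod', Nat.mod_eq_of_lt (Finset.mem_range.1 hj), if_neg hj0]
    · simp [hn]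

/-- There are `n` restarts of cost at most `q n² + 1`. Since consecutive iterates are at distance at
most `D / n`, each of the other iterations costs at most `2 (2 n L² D² + 1)`, whatever the samples.
-/
lemma IsSpiderRun.firstOrderCalls_le (h : IsSpiderRun 𝒳 x₀ φ P L n R μ ℱ x g ξ κ)
    (h𝒳 : IsCompact 𝒳) (h𝒳' : GeodesicallyConvex E 𝒳) (hx₀ : x₀ ∈ 𝒳) (hn : 0 < n) {q : ℝ}
    (hq : 0 ≤ q) (hfirst : ∀ s, (R.first s).length ≤ ⌈q / (1 / (n : ℝ)) ^ 2⌉₊)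
    (hinner : ∀ r s, (R.inner r s).length ≤ ⌈r⌉₊) (w : Ω) :
    (firstOrderCalls E L n R (fun k => x k w) (fun k j => ξ k j w) : ℝ) ≤
      (q + 4 * L ^ 2 * Metric.diam 𝒳 ^ 2 + 3) * n ^ 3 := by
  have hn' : (1 : ℝ) ≤ n := by exact_mod_cast hn
  set D := Metric.diam 𝒳
  set p := ⌈q / (1 / (n : ℝ)) ^ 2⌉₊
  set p' := ⌈2 * n * L ^ 2 * D ^ 2⌉₊
  have h1 : firstOrderCalls E L n R (fun k => x k w) (fun k j => ξ k j w) ≤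
      n * p + n ^ 2 * (2 * p') := by
    calc _ ≤ ∑ k ∈ Finset.range (n ^ 2), ((if k % n = 0 then p else 0) + 2 * p') := by
          refine Finset.sum_le_sum fun k hk => ?_
          rw [Finset.mem_range] at hk
          split_ifs with h0
          · rw [one_mul, batch, if_pos h0]
            exact (hfirst _).trans (Nat.le_add_right _ _)
          · rw [zero_add, batch, if_neg h0]
            refine Nat.mul_le_mul_left 2 ((hinner _ _).trans (Nat.ceil_le_ceil ?_))
            obtain ⟨j, rfl⟩ : ∃ j, k = j + 1 :=
              Nat.exists_eq_succ_of_ne_zero (by rintro rfl; simp at h0)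
            rw [Nat.add_sub_cancel, norm_logMap h𝒳' (h.mem h𝒳' hx₀ w j (by lia))
              (h.mem h𝒳' hx₀ w _ hk.le)]
            calc _ ≤ 2 * n * L ^ 2 * (D / n) ^ 2 / (1 / (n : ℝ)) ^ 2 := by
                  gcongr
                  exact h.dist_succ_le h𝒳 h𝒳' hx₀ w (by lia)
              _ = _ := by field_simp
      _ = _ := by
          rw [Finset.sum_add_distrib, sq n, sum_ite_mod n p n hn]
          simp
  have h2 : (p : ℝ) ≤ q * n ^ 2 + 1 :=
    (Nat.ceil_lt_add_one (by positivity)).le.trans_eq (by rw [one_div, inv_pow, div_inv_eq_mul])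
  have h3 : (p' : ℝ) ≤ 2 * n * L ^ 2 * D ^ 2 + 1 := (Nat.ceil_lt_add_one (by positivity)).le
  calc (firstOrderCalls E L n R (fun k => x k w) (fun k j => ξ k j w) : ℝ)
      ≤ n * p + n ^ 2 * (2 * p') := by exact_mod_cast h1
    _ ≤ n * (q * n ^ 2 + 1) + n ^ 2 * (2 * (2 * n * L ^ 2 * D ^ 2 + 1)) := by gcongr
    _ = (q + 4 * L ^ 2 * D ^ 2) * n ^ 3 + n ^ 1 + 2 * n ^ 2 := by ring
    _ ≤ (q + 4 * L ^ 2 * D ^ 2) * n ^ 3 + n ^ 3 + 2 * n ^ 3 := by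
        gcongr <;> first | exact hn' | norm_num
    _ = _ := by ring

end Rules

/-! ### Finite sums. -/

section FiniteSum

variable {E : Type*} [NormedAddCommGroup E] [NormedSpace ℝ E] [FiniteDimensional ℝ E]
  {M : Type*} [MetricSpace M] [ChartedSpace E M] [IsManifold 𝓘(ℝ, E) ∞ M]
  [RiemannianBundle (fun x : M => TangentSpace 𝓘(ℝ, E) x)]
  {m : ℕ} {φ : Fin m → M → ℝ} {Φ : M → ℝ}

lemma hasMFDerivAt_average (hΦ : ∀ x, Φ x = (1 / (m : ℝ)) * ∑ i, φ i x)
    (hφ : ∀ i, MDifferentiable 𝓘(ℝ, E) 𝓘(ℝ, ℝ) (φ i)) (x : M) :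
    HasMFDerivAt 𝓘(ℝ, E) 𝓘(ℝ, ℝ) Φ x
      ((1 / (m : ℝ)) • ∑ i, (mfderiv 𝓘(ℝ, E) 𝓘(ℝ, ℝ) (φ i) x : TangentSpace 𝓘(ℝ, E) x →L[ℝ] ℝ)) := by
  have h1 := (HasMFDerivAt.sum (t := Finset.univ) fun i _ => (hφ i x).hasMFDerivAt).const_smul
    (1 / (m : ℝ))
  have h2 : Φ = (1 / (m : ℝ)) • ∑ i, φ i := by
    ext y
    simp [hΦ]
  rw [h2]
  exact h1

lemma rgrad_average (hΦ : ∀ x, Φ x = (1 / (m : ℝ)) * ∑ i, φ i x)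
    (hφ : ∀ i, MDifferentiable 𝓘(ℝ, E) 𝓘(ℝ, ℝ) (φ i)) (x : M) :
    rgrad E Φ x = (m : ℝ)⁻¹ • ∑ i, rgrad E (φ i) x := by
  refine ext_inner_right ℝ fun v => ?_
  rw [inner_rgrad, (hasMFDerivAt_average hΦ hφ x).mfderiv, inner_smul_left, sum_inner]
  simp only [inner_rgrad]
  have h (f : Fin m → E →L[ℝ] ℝ) (v : E) : ((1 / (m : ℝ)) • ∑ i, f i) v =
      (m : ℝ)⁻¹ * ∑ i, f i v := by
    rw [one_div, smul_apply, sum_apply, smul_eq_mul]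
  exact h _ v

lemma integral_rgrad_uniform [NeZero m] (hΦ : ∀ x, Φ x = (1 / (m : ℝ)) * ∑ i, φ i x)
    (hφ : ∀ i, MDifferentiable 𝓘(ℝ, E) 𝓘(ℝ, ℝ) (φ i)) (x : M) :
    ∫ i, rgrad E (φ i) x ∂(PMF.uniformOfFintype (Fin m)).toMeasure = rgrad E Φ x := by
  rw [PMF.integral_eq_sum, rgrad_average hΦ hφ, Finset.smul_sum]
  simp

lemma batchGrad_finRange (hΦ : ∀ x, Φ x = (1 / (m : ℝ)) * ∑ i, φ i x)
    (hφ : ∀ i, MDifferentiable 𝓘(ℝ, E) 𝓘(ℝ, ℝ) (φ i)) (x : M) :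
    batchGrad E φ (List.finRange m) x = rgrad E Φ x := by
  rw [batchGrad, List.length_finRange, rgrad_average hΦ hφ, ← List.ofFn_eq_map, List.sum_ofFn]

lemma length_cappedBatch_le (r : ℝ) (s : ℕ → Fin m) : (cappedBatch m r s).length ≤ ⌈r⌉₊ := by
  unfold cappedBatch
  split_ifs with h
  · rwa [List.length_finRange]
  · exact (length_sampleBatch _ s).le

variable [IsContMDiffRiemannianBundle 𝓘(ℝ, E) ∞ E (fun x : M => TangentSpace 𝓘(ℝ, E) x)]
  [IsRiemannianManifold 𝓘(ℝ, E) M] {𝒳 : Set M} {L : ℝ}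

lemma isLSmoothOn_average [NeZero m] (h𝒳' : GeodesicallyConvex E 𝒳)
    (hΦ : ∀ x, Φ x = (1 / (m : ℝ)) * ∑ i, φ i x) (hφ : ∀ i, IsLSmoothOn E 𝒳 L (φ i)) :
    IsLSmoothOn E 𝒳 L Φ := by
  refine ⟨fun x => (hasMFDerivAt_average hΦ (fun i => (hφ i).1) x).mdifferentiableAt,
    fun x hx y hy => ?_⟩
  have hm : (m : ℝ) ≠ 0 := by exact_mod_cast NeZero.ne m
  rw [rgrad_average hΦ (fun i => (hφ i).1), rgrad_average hΦ (fun i => (hφ i).1),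
    ← transportIsometry_apply h𝒳' hx hy, map_smul, map_sum, ← smul_sub, ← Finset.sum_sub_distrib,
    norm_smul]
  calc _ ≤ ‖(m : ℝ)⁻¹‖ * ∑ _i : Fin m, L * dist x y := by
        gcongr
        exact norm_sum_le_of_le _ fun i _ => (hφ i).2 x hx y hy
    _ = L * dist x y := by
        simp only [norm_inv, Real.norm_natCast, Finset.sum_const, Finset.card_univ,
          Fintype.card_fin, nsmul_eq_mul]
        field_simp

/-- Turns the gradient bound at the initial point into one on all of `𝒳`, as needed at every
restart. -/
lemma norm_rgrad_le_add (h𝒳 : IsCompact 𝒳) (h𝒳' : GeodesicallyConvex E 𝒳) (hL : 0 ≤ L)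
    {f : M → ℝ} (hf : IsLSmoothOn E 𝒳 L f) {x y : M} (hx : x ∈ 𝒳) (hy : y ∈ 𝒳) {C : ℝ}
    (hC : ‖rgrad E f x‖ ≤ C) : ‖rgrad E f y‖ ≤ C + L * Metric.diam 𝒳 := by
  have h1 := hf.2 x hx y hy
  have h2 := norm_sub_norm_le (rgrad E f y) (parallelTransport x y (rgrad E f x))
  rw [← transportIsometry_apply h𝒳' hx hy, LinearIsometry.norm_map, transportIsometry_apply] at h2
  have h3 : L * dist x y ≤ L * Metric.diam 𝒳 := by
    gcongr
    exact Metric.dist_le_diam_of_mem h𝒳.isBounded hx hy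
  linarith

variable [NeZero m]

lemma lintegral_finiteSumRule_first {n : ℕ} (hn : 0 < n) (hL : 0 < L) {x : M}
    (hm : ∫ i, rgrad E (φ i) x ∂(PMF.uniformOfFintype (Fin m)).toMeasure = rgrad E Φ x)
    {c : ℝ} (hc : ∀ i, ‖rgrad E (φ i) x‖ ≤ c) {D : ℝ} :
    ∫⁻ s, ENNReal.ofReal
      (D ^ 2 * ‖batchGrad E φ ((finiteSumRule m L D n).first s) x - rgrad E Φ x‖ ^ 2)
      ∂(Measure.infinitePi fun _ => (PMF.uniformOfFintype (Fin m)).toMeasure) ≤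
    ENNReal.ofReal (c ^ 2 / (2 * L ^ 2) / n ^ 2) := by
  -- For `D = 0` the batch is empty, but the weight vanishes too; otherwise `D ^ 2` cancels against
  -- the batch size.
  rcases eq_or_ne D 0 with rfl | hD
  · simp
  · refine lintegral_sampleBatch_first ⟨.of_finite, hm⟩ (ae_of_all _ hc) (by positivity)
      (le_of_eq ?_)
    field_simp

lemma lintegral_cappedBatch_inner (h𝒳' : GeodesicallyConvex E 𝒳) (hL : 0 < L)
    (hΦ : ∀ x, Φ x = (1 / (m : ℝ)) * ∑ i, φ i x) (hφ : ∀ i, IsLSmoothOn E 𝒳 L (φ i))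
    {n : ℕ} (hn : 0 < n) {x y : M} (hx : x ∈ 𝒳) (hy : y ∈ 𝒳) (v : TangentSpace 𝓘(ℝ, E) x) :
    ∫⁻ s, ENNReal.ofReal (‖batchGrad E φ
        (cappedBatch m (2 * n * L ^ 2 * ‖logMap E x y‖ ^ 2 / (1 / (n : ℝ)) ^ 2) s) y -
        parallelTransport x y (batchGrad E φ
          (cappedBatch m (2 * n * L ^ 2 * ‖logMap E x y‖ ^ 2 / (1 / (n : ℝ)) ^ 2) s) x - v) -
        rgrad E Φ y‖ ^ 2)
      ∂(Measure.infinitePi fun _ => (PMF.uniformOfFintype (Fin m)).toMeasure) ≤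
    ENNReal.ofReal (1 / (2 * n ^ 3) + ‖v - rgrad E Φ x‖ ^ 2) := by
  unfold cappedBatch
  split_ifs
  -- With the whole index set the batch gradients are exact, and the old error is merely
  -- transported.
  · simp_rw [batchGrad_finRange hΦ (fun i => (hφ i).1), norm_rgrad_sub_transport h𝒳' hx hy]
    rw [lintegral_const, measure_univ, mul_one]
    gcongr
    exact le_add_of_nonneg_left (by positivity)
  · exact lintegral_sampleBatch_inner h𝒳' hL (ae_of_all _ hφ) (isLSmoothOn_average h𝒳' hΦ hφ)
      (fun x _ => ⟨.of_finite, integral_rgrad_uniform hΦ (fun i => (hφ i).1) x⟩) hn hx hy v rfl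

end FiniteSum

/-! ### Choice of `n` and conclusion. -/

lemma exists_nat_div_le {c ε : ℝ} (hc : 1 ≤ c) (hε : 0 < ε) (hε1 : ε ≤ 1) :
    ∃ n : ℕ, 0 < n ∧ c / n ≤ ε ∧ (n : ℝ) ≤ (c + 1) / ε := by
  have h0 : 0 < c / ε := by positivity
  have hn : 0 < ⌈c / ε⌉₊ := Nat.ceil_pos.2 h0
  refine ⟨⌈c / ε⌉₊, hn, ?_, ?_⟩
  · rw [div_le_comm₀ (by positivity) hε]
    exact Nat.le_ceil _
  · refine (Nat.ceil_lt_add_one h0.le).le.trans ?_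
    rw [add_div]
    gcongr
    exact (one_le_div hε).2 hε1

lemma linearOracleCalls_le {n : ℕ} {c ε : ℝ} (h : (n : ℝ) ≤ c / ε) :
    (linearOracleCalls n : ℝ) ≤ c ^ 2 / ε ^ 2 := by
  rw [← div_pow]
  simp only [linearOracleCalls, Finset.sum_const, Finset.card_range, smul_eq_mul, mul_one]
  push_cast
  gcongr

lemma mul_pow_three_le {n : ℕ} {a c ε N : ℝ} (ha : 0 ≤ a) (h : (n : ℝ) ≤ c / ε)
    (hN : N ≤ a * n ^ 3) : N ≤ a * c ^ 3 / ε ^ 3 := by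
  rw [mul_div_assoc, ← div_pow]
  exact hN.trans (by gcongr)

end SpiderRFW

end

theorem mainTheorem10
    {E : Type*} [NormedAddCommGroup E] [NormedSpace ℝ E] [FiniteDimensional ℝ E]
    {M : Type*} [MetricSpace M] [ChartedSpace E M] [IsManifold 𝓘(ℝ, E) ∞ M]
    [RiemannianBundle (fun x : M => TangentSpace 𝓘(ℝ, E) x)]
    [IsContMDiffRiemannianBundle 𝓘(ℝ, E) ∞ E (fun x : M => TangentSpace 𝓘(ℝ, E) x)]
    [IsRiemannianManifold 𝓘(ℝ, E) M]
    (𝒳 : Set M) (h𝒳 : IsCompact 𝒳) (h𝒳' : SpiderRFW.GeodesicallyConvex E 𝒳)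
    (L C : ℝ) (hL : 0 < L) :
    -- stochastic objectives
    (∃ A B : ℝ, ∀ ε : ℝ, 0 < ε → ε ≤ 1 → ∃ n : ℕ, 0 < n ∧
      (SpiderRFW.linearOracleCalls n : ℝ) ≤ B / ε ^ 2 ∧
      ∀ (Ξ : Type*) [MeasurableSpace Ξ] (P : Measure Ξ) [IsProbabilityMeasure P]
        (φ : Ξ → M → ℝ) (Φ : M → ℝ),
        (∀ x, Integrable (fun ξ => φ ξ x) P ∧ Φ x = ∫ ξ, φ ξ x ∂P) →
        (∀ᵐ ξ ∂P, SpiderRFW.IsLSmoothOn E 𝒳 L (φ ξ)) →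
        SpiderRFW.IsLSmoothOn E 𝒳 L Φ →
        (∀ x ∈ 𝒳, Integrable (fun ξ => SpiderRFW.rgrad E (φ ξ) x) P ∧
          ∫ ξ, SpiderRFW.rgrad E (φ ξ) x ∂P = SpiderRFW.rgrad E Φ x) →
        (∀ x ∈ 𝒳, ∀ᵐ ξ ∂P, ‖SpiderRFW.rgrad E (φ ξ) x‖ ≤ C) →
        ∀ x₀ ∈ 𝒳, ∀ (Ω : Type*) [mΩ : MeasurableSpace Ω] (μ : Measure Ω) [IsProbabilityMeasure μ]
          (ℱ : Filtration ℕ mΩ) (x : ℕ → Ω → M) (g : ∀ k w, TangentSpace 𝓘(ℝ, E) (x k w))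
          (ξ : ℕ → ℕ → Ω → Ξ) (κ : Ω → Fin (n ^ 2)),
          SpiderRFW.IsSpiderRun 𝒳 x₀ φ P L n (SpiderRFW.stochasticRule Ξ C n) μ ℱ x g ξ κ →
          ∫⁻ w, ENNReal.ofReal (SpiderRFW.fwGap E 𝒳 Φ (x (κ w) w)) ∂μ ≤ ENNReal.ofReal ε ∧
          ∀ w, (SpiderRFW.firstOrderCalls E L n (SpiderRFW.stochasticRule Ξ C n)
            (fun k => x k w) (fun k j => ξ k j w) : ℝ) ≤ A / ε ^ 3) ∧
    -- finite sums
    (∃ A B : ℝ, ∀ ε : ℝ, 0 < ε → ε ≤ 1 → ∃ n : ℕ, 0 < n ∧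
      (SpiderRFW.linearOracleCalls n : ℝ) ≤ B / ε ^ 2 ∧
      ∀ (m : ℕ) [NeZero m] (φ : Fin m → M → ℝ) (Φ : M → ℝ),
        (∀ x, Φ x = (1 / (m : ℝ)) * ∑ i, φ i x) →
        (∀ i, SpiderRFW.IsLSmoothOn E 𝒳 L (φ i)) →
        ∀ x₀ ∈ 𝒳, (∀ i, ‖SpiderRFW.rgrad E (φ i) x₀‖ ≤ C) →
        ∀ (Ω : Type*) [mΩ : MeasurableSpace Ω] (μ : Measure Ω) [IsProbabilityMeasure μ]
          (ℱ : Filtration ℕ mΩ) (x : ℕ → Ω → M) (g : ∀ k w, TangentSpace 𝓘(ℝ, E) (x k w))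
          (ξ : ℕ → ℕ → Ω → Fin m) (κ : Ω → Fin (n ^ 2)),
          SpiderRFW.IsSpiderRun 𝒳 x₀ φ (PMF.uniformOfFintype (Fin m)).toMeasure L n
            (SpiderRFW.finiteSumRule m L (Metric.diam 𝒳) n) μ ℱ x g ξ κ →
          ∫⁻ w, ENNReal.ofReal (SpiderRFW.fwGap E 𝒳 Φ (x (κ w) w)) ∂μ ≤ ENNReal.ofReal ε ∧
          ∀ w, (SpiderRFW.firstOrderCalls E L n (SpiderRFW.finiteSumRule m L (Metric.diam 𝒳) n)
            (fun k => x k w) (fun k j => ξ k j w) : ℝ) ≤ A / ε ^ 3) := by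
  have hD : 0 ≤ Metric.diam 𝒳 := Metric.diam_nonneg
  constructor
  -- The numerator of the gap bound with `G = |C|` and restart constant `V = D² / 2`; then `n = ⌈c /
  -- ε⌉`.
  · set c := |C| * Metric.diam 𝒳 + L * Metric.diam 𝒳 ^ 2 + 1 +
      (Metric.diam 𝒳 ^ 2 / 2 + Metric.diam 𝒳 ^ 2 / 2) with hc
    have hc1 : 1 ≤ c := by
      have : 0 ≤ |C| * Metric.diam 𝒳 + L * Metric.diam 𝒳 ^ 2 +
        (Metric.diam 𝒳 ^ 2 / 2 + Metric.diam 𝒳 ^ 2 / 2) := by positivity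
      linarith
    refine ⟨(2 * C ^ 2 + 4 * L ^ 2 * Metric.diam 𝒳 ^ 2 + 3) * (c + 1) ^ 3, (c + 1) ^ 2,
      fun ε hε hε1 => ?_⟩
    obtain ⟨n, hn, hcn, hnc⟩ := SpiderRFW.exists_nat_div_le hc1 hε hε1
    refine ⟨n, hn, SpiderRFW.linearOracleCalls_le hnc, ?_⟩
    intro Ξ _ P _ φ Φ _ hφ hΦ hm hC x₀ hx₀ Ω _ μ _ ℱ x g ξ κ h
    constructor
    · refine (h.lintegral_fwGap_le_of_batch h𝒳 h𝒳' hx₀ hL.le hΦ hn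
        (SpiderRFW.norm_rgrad_le (hm x₀ hx₀).2 (hC x₀ hx₀)) (by positivity)
        (fun y hy => SpiderRFW.lintegral_stochasticRule_first hn (hm y hy) (hC y hy) _)
        (fun y hy z hz v => SpiderRFW.lintegral_sampleBatch_inner h𝒳' hL hφ hΦ hm hn hy hz v
          rfl)).trans (ENNReal.ofReal_le_ofReal hcn)
    · intro w
      refine SpiderRFW.mul_pow_three_le (by positivity) hnc (h.firstOrderCalls_le h𝒳 h𝒳' hx₀ hn
        (by positivity) (fun s => (SpiderRFW.length_sampleBatch _ s).le)
        (fun r s => (SpiderRFW.length_sampleBatch _ s).le) w)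
  -- As before, with `V = (C + L D)² / (2 L²)`, where `C + L D` bounds the component gradients on
  -- `𝒳`.
  · set c := |C| * Metric.diam 𝒳 + L * Metric.diam 𝒳 ^ 2 + 1 +
      ((C + L * Metric.diam 𝒳) ^ 2 / (2 * L ^ 2) + Metric.diam 𝒳 ^ 2 / 2) with hc
    have hc1 : 1 ≤ c := by
      have : 0 ≤ |C| * Metric.diam 𝒳 + L * Metric.diam 𝒳 ^ 2 +
        ((C + L * Metric.diam 𝒳) ^ 2 / (2 * L ^ 2) + Metric.diam 𝒳 ^ 2 / 2) := by positivity
      linarith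
    refine ⟨(2 * L ^ 2 * Metric.diam 𝒳 ^ 2 + 4 * L ^ 2 * Metric.diam 𝒳 ^ 2 + 3) * (c + 1) ^ 3,
      (c + 1) ^ 2, fun ε hε hε1 => ?_⟩
    obtain ⟨n, hn, hcn, hnc⟩ := SpiderRFW.exists_nat_div_le hc1 hε hε1
    refine ⟨n, hn, SpiderRFW.linearOracleCalls_le hnc, ?_⟩
    intro m _ φ Φ hΦφ hφ x₀ hx₀ hC Ω _ μ _ ℱ x g ξ κ h
    have hΦ := SpiderRFW.isLSmoothOn_average h𝒳' hΦφ hφ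
    have hm := SpiderRFW.integral_rgrad_uniform hΦφ fun i => (hφ i).1
    constructor
    · refine (h.lintegral_fwGap_le_of_batch h𝒳 h𝒳' hx₀ hL.le hΦ hn
        (SpiderRFW.norm_rgrad_le (hm x₀) (ae_of_all _ hC)) (by positivity)
        (fun y hy => SpiderRFW.lintegral_finiteSumRule_first hn hL (hm y) fun i =>
          SpiderRFW.norm_rgrad_le_add h𝒳 h𝒳' hL.le (hφ i) hx₀ hy (hC i))
        (fun y hy z hz v => SpiderRFW.lintegral_cappedBatch_inner h𝒳' hL hΦφ hφ hn hy hz v)).trans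
        (ENNReal.ofReal_le_ofReal hcn)
    · intro w
      refine SpiderRFW.mul_pow_three_le (by positivity) hnc (h.firstOrderCalls_le h𝒳 h𝒳' hx₀ hn
        (by positivity) (fun s => (SpiderRFW.length_sampleBatch _ s).le)
        SpiderRFW.length_cappedBatch_le w)
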